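/- **Setting.** Let $\mathfrak g$ be a finite-dimensional simple complex Lie algebra, $G$ a connected (linear) algebraic group over $\mathbf C$ with Lie algebra $\mathfrak g$, and $(\cdot\mid\cdot)$ a nondegenerate symmetric invariant bilinear form on $\mathfrak g$. The dual $\mathfrak g^*$ carries the coadjoint actions $\mathrm{ad}^*$ of $\mathfrak g$ and $\mathrm{Ad}^*$ of $G$, and the Kirillov–Kostant bracket $\{F,H\}(\xi)=\xi([d_\xi F,d_\xi H])$ on $\mathbf C[\mathfrak g^*]$. For $i=1,2$ let $f_i\in\mathfrak g$ be nilpotent, $\chi_i=(f_i\mid\cdot)\in\mathfrak g^*$, and let $\mathfrak g=\bigoplus_{j\in\mathbf Z}\mathfrak g^{(i)}_j$ be a good grading for $f_i$, i.e. a Lie algebra grading with $f_i\in\mathfrak g^{(i)}_{-2}$ such that $\mathrm{ad}(f_i):\mathfrak g^{(i)}_j\to\mathfrak g^{(i)}_{j-2}$ is injective for $j\ge1$ and surjective for $j\le1$. Let $q_i\in\mathfrak g$ be the semisimple element with $\mathfrak g^{(i)}_j=\{x:[q_i,x]=jx\}$ for all $j$, and assume that $q_1,q_2$ lie in a common Cartan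 subalgebra $\mathfrak h$. Choose a Lagrangian subspace $\mathfrak l_i$ of $\mathfrak g^{(i)}_1$ for the symplectic form $\chi_i([\cdot,\cdot])$ and put $\mathfrak m_i=\mathfrak l_i\oplus\bigoplus_{j\ge2}\mathfrak g^{(i)}_j$, a Lie subalgebra of $\mathfrak g$. Let $(e_2,h_2,f_2)$ satisfy $[h_2,e_2]=2e_2$, $[h_2,f_2]=-2f_2$, $[e_2,f_2]=h_2$ with $h_2\in\mathfrak g^{(2)}_0$, $e_2\in\mathfrak g^{(2)}_2$, and let $S_2=\chi_2+\mathrm{Ker}\,\mathrm{ad}^*(e_2)$ be the Slodowy slice of $f_2$. **Assumptions.** 1. $\mathfrak m_2=\mathfrak m_1\oplus\mathfrak m_0$, where $\mathfrak m_1$ is an ideal of $\mathfrak m_2$ and $\mathfrak m_0$ is an $\mathfrak h$-stable Lie subalgebra of $\mathfrak m_2$; 2. $f_0:=f_2-f_1\in\mathfrak g^{(1)}_0$ and $\mathfrak m_0\subseteq\mathfrak g^{(1)}_0$; 3. $[q_2-q_1,f_1]=0$. Let $M_1$ and $M_0$ be the connected unipotent subgroups of $G$ with Lie algebras $\mathfrak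 m_1$ and $\mathfrak m_0$, let $\mu_1:\mathfrak g^*\to\mathfrak m_1^*$, $\xi\mapsto(\xi-\chi_1)|_{\mathfrak m_1}$, and let $\mu_1^{-1}(0)/M_1$ be the quotient for the coadjoint action, with the ring of functions $\mathbf C[\mu_1^{-1}(0)]^{M_1}$. **Theorem.** (a) For every $\mathfrak{sl}_2$-triple $(e_1,h_1,f_1)$ with $h_1\in\mathfrak g^{(1)}_0$ and $e_1\in\mathfrak g^{(1)}_2$ (the zero triple if $f_1=0$), the Slodowy slice $S_{f_1}=\chi_1+\mathrm{Ker}\,\mathrm{ad}^*(e_1)$ is contained in $\mu_1^{-1}(0)$ and $\xi\mapsto[\xi]$ is an isomorphism of varieties $S_{f_1}\cong\mu_1^{-1}(0)/M_1$. The bracket of $\mathbf C[\mathfrak g^*]$ induces a Poisson bracket on the functions on $\mu_1^{-1}(0)/M_1$, computed with arbitrary polynomial lifts. (b) The formula $g\cdot[\xi]=[\mathrm{Ad}^*(g)\xi]$ defines an algebraic action of $M_0$ on $\mu_1^{-1}(0)/M_1$. It is Hamiltonian with moment map $$\mu_0:\mu_1^{-1}(0)/M_1\to\mathfrak m_0^*,\qquad[\xi]\mapsto(\xi-\chi_2)|_{\mathfrak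 m_0},$$ that is: $M_0$ acts by Poisson automorphisms, $\mu_0$ is a well-defined $M_0$-equivariant morphism of varieties, its comap $\mathbf C[\mathfrak m_0^*]\to\mathbf C[\mu_1^{-1}(0)/M_1]$ respects the Poisson brackets, and for $x\in\mathfrak m_0$ and every regular function $F$ one has $\{\mu_0^*x,F\}(p)=\frac{d}{dt}\big|_{t=0}F(\exp(-tx)\cdot p)$. (c) The action is free on $\mu_0^{-1}(0)$ in the following sense: the map $M_0\times S_2\to\mu_0^{-1}(0)$, $(g,\xi)\mapsto g\cdot[\xi]$, is a well-defined $M_0$-equivariant isomorphism of varieties, where $M_0$ acts on $M_0\times S_2$ by left multiplication on the first factor. -/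

import Mathlib

/-!
Affine varieties are represented by their points together with their algebra of regular functions,
a subalgebra of the algebra of all complex functions on the set of points. A morphism is a map that
pulls regular functions back to regular functions.
-/

noncomputable section

namespace SlodowyStages

open Module

section Varieties

/-- Polynomial functions on a finite-dimensional complex vector space: the algebra generated by the
linear forms. -/
def polyFun (E : Type*) [AddCommGroup E] [Module ℂ E] : Subalgebra ℂ (E → ℂ) :=
  Algebra.adjoin ℂ (Set.range fun (l : Dual ℂ E) (x : E) => l x)

/-- Pullback of functions along a map. -/
def pullback {X Y : Type*} (f : X → Y) : (Y → ℂ) →ₐ[ℂ] (X → ℂ) where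
  toFun F := F ∘ f
  map_one' := rfl
  map_mul' _ _ := rfl
  map_zero' := rfl
  map_add' _ _ := rfl
  commutes' _ := rfl

/-- Regular functions on a closed subset: restrictions of the regular functions. -/
def regSub {X : Type*} (A : Subalgebra ℂ (X → ℂ)) (s : Set X) : Subalgebra ℂ (s → ℂ) :=
  A.map (pullback (Subtype.val : s → X))

/-- Regular functions on a product of affine varieties. -/
def regProd {X Y : Type*} (A : Subalgebra ℂ (X → ℂ)) (B : Subalgebra ℂ (Y → ℂ)) :
    Subalgebra ℂ (X × Y → ℂ) :=
  A.map (pullback Prod.fst) ⊔ B.map (pullback Prod.snd)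

/-- Regular functions on a quotient: the functions whose pullback is regular, i.e. the invariant
regular functions. -/
def regQuot {X : Type*} (A : Subalgebra ℂ (X → ℂ)) (r : Setoid X) :
    Subalgebra ℂ (Quotient r → ℂ) :=
  A.comap (pullback (Quotient.mk r))

/-- Morphisms of varieties. -/
def IsMorphism {X Y : Type*} (A : Subalgebra ℂ (X → ℂ)) (B : Subalgebra ℂ (Y → ℂ))
    (f : X → Y) : Prop :=
  ∀ F ∈ B, F ∘ f ∈ A

/-- Isomorphisms of varieties. -/
def IsIsomorphism {X Y : Type*} (A : Subalgebra ℂ (X → ℂ)) (B : Subalgebra ℂ (Y → ℂ))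
    (f : X ≃ Y) : Prop :=
  IsMorphism A B f ∧ IsMorphism B A f.symm

theorem polyFun_comp {E E' : Type*} [AddCommGroup E] [Module ℂ E] [AddCommGroup E'] [Module ℂ E']
    (L : E →ₗ[ℂ] E') {p : E' → ℂ} (hp : p ∈ polyFun E') : p ∘ L ∈ polyFun E := by
  have h : polyFun E' ≤ (polyFun E).comap (pullback L) := by
    refine Algebra.adjoin_le ?_
    rintro _ ⟨l, rfl⟩
    exact Algebra.subset_adjoin ⟨l.comp L, rfl⟩
  exact h hp

end Varieties

section Poisson

/-- A Poisson bracket on a commutative complex algebra. -/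
structure PoissonBracket (A : Type*) [CommRing A] [Algebra ℂ A] where
  bracket : A →ₗ[ℂ] A →ₗ[ℂ] A
  self : ∀ a, bracket a a = 0
  jacobi : ∀ a b c,
    bracket a (bracket b c) = bracket (bracket a b) c + bracket b (bracket a c)
  leibniz : ∀ a b c, bracket a (b * c) = bracket a b * c + b * bracket a c

variable {L : Type*} [LieRing L] [LieAlgebra ℂ L] [FiniteDimensional ℂ L]

/-- The differential at `ξ` of a polynomial function on `L*`, as an element of `L = L**`. -/
def dualGradient (F : Dual ℂ L → ℂ) (ξ : Dual ℂ L) : L :=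
  ∑ i, lineDeriv ℂ F ξ ((finBasis ℂ L).coord i) • finBasis ℂ L i

/-- The Kirillov-Kostant bracket `{F, H}(ξ) = ξ([d_ξ F, d_ξ H])` of polynomial functions on `L*`. -/
def kkBracket (F H : Dual ℂ L → ℂ) (ξ : Dual ℂ L) : ℂ :=
  ξ ⁅dualGradient F ξ, dualGradient H ξ⁆

end Poisson

section AlgebraicGroups

variable {g : Type*} [LieRing g] [LieAlgebra ℂ g] {V : Type*} [AddCommGroup V] [Module ℂ V]

/-- The subgroup `H` of `GL(V)` is Zariski closed. -/
def IsZariskiClosed (H : Subgroup (LinearMap.GeneralLinearGroup ℂ V)) : Prop :=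
  ∃ S : Set (End ℂ V → ℂ), S ⊆ polyFun (End ℂ V) ∧
    ∀ u : LinearMap.GeneralLinearGroup ℂ V, u ∈ H ↔ ∀ p ∈ S, p u = 0

/-- Regular functions on a Zariski closed subgroup of `GL(V)`: polynomials in the entries of `u`
and of `u⁻¹`. -/
def regGroup (H : Subgroup (LinearMap.GeneralLinearGroup ℂ V)) : Subalgebra ℂ (H → ℂ) :=
  Algebra.adjoin ℂ
    ((Set.range fun (l : Dual ℂ (End ℂ V)) (u : H) => l (u : LinearMap.GeneralLinearGroup ℂ V)) ∪
     (Set.range fun (l : Dual ℂ (End ℂ V)) (u : H) =>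
        l ((u⁻¹ : H) : LinearMap.GeneralLinearGroup ℂ V)))

/-- Connectedness in the Zariski topology: the only idempotent regular functions are `0` and
`1`. -/
def IsZariskiConnected (H : Subgroup (LinearMap.GeneralLinearGroup ℂ V)) : Prop :=
  ∀ p ∈ regGroup H, p * p = p → p = 0 ∨ p = 1

/-- The Lie algebra of a closed subgroup of `GL(V)`, as a subset of `gl(V)`: the tangent space at
the identity. -/
def tangentSpace (H : Subgroup (LinearMap.GeneralLinearGroup ℂ V)) : Set (End ℂ V) :=
  {X | ∀ p ∈ polyFun (End ℂ V),
    (∀ u : LinearMap.GeneralLinearGroup ℂ V, u ∈ H → p u = 0) → lineDeriv ℂ p 1 X = 0}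

/-- Conjugation by `u` on `gl(V)`. -/
def conj (u : LinearMap.GeneralLinearGroup ℂ V) : End ℂ V →ₗ[ℂ] End ℂ V :=
  LinearMap.mulLeft ℂ (u : End ℂ V) ∘ₗ LinearMap.mulRight ℂ ((u⁻¹ : (End ℂ V)ˣ) : End ℂ V)

theorem conj_apply (u : LinearMap.GeneralLinearGroup ℂ V) (X : End ℂ V) :
    conj u X = (u : End ℂ V) * (X * ((u⁻¹ : (End ℂ V)ˣ) : End ℂ V)) := rfl

theorem conj_mem_tangentSpace {H : Subgroup (LinearMap.GeneralLinearGroup ℂ V)}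
    {u : LinearMap.GeneralLinearGroup ℂ V} (hu : u ∈ H) {X : End ℂ V} (hX : X ∈ tangentSpace H) :
    conj u X ∈ tangentSpace H := by
  intro p hp hpH
  have h := hX (p ∘ conj u) (polyFun_comp _ hp) (fun v hv => by
    have := hpH (u * v * u⁻¹) (H.mul_mem (H.mul_mem hu hv) (H.inv_mem hu))
    simpa [conj_apply, mul_assoc] using this)
  rw [← h]
  have h1 : conj u 1 = 1 := by simp [conj_apply]
  simp only [lineDeriv, Function.comp, map_add, map_smul, h1]

/-- The polynomial `1 + N + N²/2! + ...` up to degree `dim V`; this is the exponential of `N` when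
`N` is nilpotent. -/
def nilExp (N : End ℂ V) : End ℂ V :=
  ∑ k ∈ Finset.range (finrank ℂ V + 1), ((k.factorial : ℂ)⁻¹) • N ^ k

variable (g V) in
/-- A connected linear algebraic group `G ⊆ GL(V)` together with an identification of `g` with its
Lie algebra. -/
structure ConnectedAlgebraicGroup where
  carrier : Subgroup (LinearMap.GeneralLinearGroup ℂ V)
  closed : IsZariskiClosed carrier
  connected : IsZariskiConnected carrier
  lieMap : g →ₗ[ℂ] End ℂ V
  lieMap_lie : ∀ x y, lieMap ⁅x, y⁆ = lieMap x * lieMap y - lieMap y * lieMap x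
  lieMap_injective : Function.Injective lieMap
  range_lieMap : Set.range lieMap = tangentSpace carrier

end AlgebraicGroups

namespace ConnectedAlgebraicGroup

variable {g V : Type*} [LieRing g] [LieAlgebra ℂ g] [AddCommGroup V] [Module ℂ V]
variable (G : ConnectedAlgebraicGroup g V)

theorem conj_mem_range (u : G.carrier) (x : g) :
    ∃ y : g, G.lieMap y = conj (u : LinearMap.GeneralLinearGroup ℂ V) (G.lieMap x) := by
  have h : G.lieMap x ∈ tangentSpace G.carrier := G.range_lieMap ▸ Set.mem_range_self x
  have h' := conj_mem_tangentSpace u.2 h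
  rwa [← G.range_lieMap] at h'

/-- The element `Ad(u) x` of `g`: the one corresponding to `u x u⁻¹` in `gl(V)`. -/
def adFun (u : G.carrier) (x : g) : g := (G.conj_mem_range u x).choose

theorem lieMap_adFun (u : G.carrier) (x : g) :
    G.lieMap (G.adFun u x) = conj (u : LinearMap.GeneralLinearGroup ℂ V) (G.lieMap x) :=
  (G.conj_mem_range u x).choose_spec

/-- The adjoint action of `G` on `g`. -/
def Ad : Representation ℂ G.carrier g where
  toFun u :=
    { toFun := G.adFun u
      map_add' := fun x y => G.lieMap_injective (by simp only [lieMap_adFun, map_add])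
      map_smul' := fun c x => G.lieMap_injective (by
        simp only [lieMap_adFun, map_smul, RingHom.id_apply]) }
  map_one' := by
    ext x
    apply G.lieMap_injective
    simp [lieMap_adFun, conj_apply]
  map_mul' u v := by
    ext x
    apply G.lieMap_injective
    simp [lieMap_adFun, conj_apply, mul_assoc]

theorem lieMap_Ad (u : G.carrier) (x : g) :
    G.lieMap (G.Ad u x) = (u : LinearMap.GeneralLinearGroup ℂ V).val * G.lieMap x *
      ((u : LinearMap.GeneralLinearGroup ℂ V)⁻¹).val := by
  rw [mul_assoc]
  exact G.lieMap_adFun u x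

/-- The coadjoint action `Ad*(u) ξ = ξ ∘ Ad(u⁻¹)` of `G` on `g*`. -/
def coAd : Representation ℂ G.carrier (Dual ℂ g) := G.Ad.dual

/-- A subgroup of `G`, viewed in `GL(V)`. -/
def toGL (M : Subgroup G.carrier) : Subgroup (LinearMap.GeneralLinearGroup ℂ V) :=
  M.map G.carrier.subtype

/-- `M` is the connected unipotent (closed) subgroup of `G` with Lie algebra `m`. -/
structure IsUnipotentSubgroup (M : Subgroup G.carrier) (m : LieSubalgebra ℂ g) : Prop where
  closed : IsZariskiClosed (G.toGL M)
  connected : IsZariskiConnected (G.toGL M)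
  unipotent : ∀ u ∈ M, IsNilpotent ((u : LinearMap.GeneralLinearGroup ℂ V).val - 1)
  lie : tangentSpace (G.toGL M) = G.lieMap '' (m : Set g)

/-- Regular functions on a closed subgroup of `G`. -/
def regSubgroup (M : Subgroup G.carrier) : Subalgebra ℂ (M → ℂ) :=
  (regGroup (G.toGL M)).map
    (pullback fun u : M => (⟨u.1.1, Subgroup.mem_map_of_mem _ u.2⟩ : G.toGL M))

/-- Two points of `X ⊆ g*` are equivalent when they are in the same `M`-orbit for the coadjoint
action. -/
def orbitSetoid (M : Subgroup G.carrier) (X : Set (Dual ℂ g)) : Setoid X where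
  r ξ η := ∃ u : M, G.coAd (u : G.carrier) (ξ : Dual ℂ g) = η
  iseqv :=
    { refl := fun ξ => ⟨1, by simp⟩
      symm := by
        rintro ξ η ⟨u, hu⟩
        refine ⟨u⁻¹, ?_⟩
        rw [← hu, ← Module.End.mul_apply, ← map_mul]
        simp
      trans := by
        rintro ξ η ζ ⟨u, hu⟩ ⟨v, hv⟩
        refine ⟨v * u, ?_⟩
        rw [← hv, ← hu, ← Module.End.mul_apply, ← map_mul]
        rfl }

end ConnectedAlgebraicGroup

section GoodGradings

variable {g : Type*} [LieRing g] [LieAlgebra ℂ g]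

/-- `Γ` is a good `ℤ`-grading of `g` for `f`. -/
structure IsGoodGrading (Γ : ℤ → Submodule ℂ g) (f : g) : Prop where
  internal : DirectSum.IsInternal Γ
  lie_mem : ∀ i j, ∀ x ∈ Γ i, ∀ y ∈ Γ j, ⁅x, y⁆ ∈ Γ (i + j)
  mem : f ∈ Γ (-2)
  injective : ∀ j, 1 ≤ j → ∀ x ∈ Γ j, ⁅f, x⁆ = 0 → x = 0
  surjective : ∀ j, j ≤ 1 → ∀ y ∈ Γ (j - 2), ∃ x ∈ Γ j, ⁅f, x⁆ = y

/-- `Γ` is the eigenspace decomposition of `ad q`. -/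
def IsGradingElement (Γ : ℤ → Submodule ℂ g) (q : g) : Prop :=
  ∀ i x, x ∈ Γ i ↔ ⁅q, x⁆ = (i : ℂ) • x

/-- `(e, h, f)` is an `sl₂`-triple (possibly zero, when `f = 0`) with `h` of degree `0` and `e` of
degree `2`. -/
structure IsGradedTriple (Γ : ℤ → Submodule ℂ g) (e h f : g) : Prop where
  lie_h_e : ⁅h, e⁆ = (2 : ℂ) • e
  lie_h_f : ⁅h, f⁆ = -((2 : ℂ) • f)
  lie_e_f : ⁅e, f⁆ = h
  h_mem : h ∈ Γ 0
  e_mem : e ∈ Γ 2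

/-- `l` is a Lagrangian subspace of the degree `1` part for the form `χ([·, ·])`. -/
def IsLagrangian (Γ : ℤ → Submodule ℂ g) (χ : Dual ℂ g) (l : Submodule ℂ g) : Prop :=
  ∀ x, x ∈ l ↔ x ∈ Γ 1 ∧ ∀ y ∈ l, χ ⁅x, y⁆ = 0

/-- `m` is a good algebra: the sum of a Lagrangian subspace of the degree `1` part and of the parts
of degree at least `2`. -/
def IsGoodAlgebra (Γ : ℤ → Submodule ℂ g) (χ : Dual ℂ g) (m : LieSubalgebra ℂ g) : Prop :=
  ∃ l : Submodule ℂ g, IsLagrangian Γ χ l ∧ m.toSubmodule = l ⊔ ⨆ i : {i : ℤ // 2 ≤ i}, Γ i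

/-- The Slodowy slice `χ + Ker ad*(e)`. -/
def slice (χ : Dual ℂ g) (e : g) : Set (Dual ℂ g) := {ξ | ⁅e, ξ - χ⁆ = 0}

/-- The twisted restriction `ξ ↦ (ξ - χ)|_m`. -/
def twistedRestriction (χ : Dual ℂ g) (m : LieSubalgebra ℂ g) (ξ : Dual ℂ g) : Dual ℂ m :=
  (ξ - χ).comp m.toSubmodule.subtype

/-- The zero fibre of the twisted restriction. -/
def zeroFibre (χ : Dual ℂ g) (m : LieSubalgebra ℂ g) : Set (Dual ℂ g) :=
  twistedRestriction χ m ⁻¹' {0}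

end GoodGradings

section Reduction

variable {g V : Type*} [LieRing g] [LieAlgebra ℂ g] [FiniteDimensional ℂ g]
  [AddCommGroup V] [Module ℂ V] (G : ConnectedAlgebraicGroup g V)

/-- The quotient `μ⁻¹(0) / M`, where `μ(ξ) = (ξ - χ)|_m`. -/
abbrev Reduced (χ : Dual ℂ g) (m : LieSubalgebra ℂ g) (M : Subgroup G.carrier) :=
  Quotient (G.orbitSetoid M (zeroFibre χ m))

/-- The class in `μ⁻¹(0) / M` of a point of `μ⁻¹(0)`. -/
def cls (χ : Dual ℂ g) (m : LieSubalgebra ℂ g) (M : Subgroup G.carrier) (ξ : zeroFibre χ m) :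
    Reduced G χ m M :=
  Quotient.mk (G.orbitSetoid M (zeroFibre χ m)) ξ

/-- Regular functions on `μ⁻¹(0) / M`. -/
def regReduced (χ : Dual ℂ g) (m : LieSubalgebra ℂ g) (M : Subgroup G.carrier) :
    Subalgebra ℂ (Reduced G χ m M → ℂ) :=
  regQuot (regSub (polyFun (Dual ℂ g)) (zeroFibre χ m)) _

/-- The Poisson bracket `P` on `μ⁻¹(0) / M` is induced by the bracket of `g*`: it is computed with
arbitrary polynomial lifts. -/
def IsReducedBracket (χ : Dual ℂ g) (m : LieSubalgebra ℂ g) (M : Subgroup G.carrier)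
    (P : PoissonBracket (regReduced G χ m M)) : Prop :=
  ∀ F H : regReduced G χ m M, ∀ F' ∈ polyFun (Dual ℂ g), ∀ H' ∈ polyFun (Dual ℂ g),
    (∀ ξ : zeroFibre χ m, F' ξ = (F : Reduced G χ m M → ℂ) (cls G χ m M ξ)) →
    (∀ ξ : zeroFibre χ m, H' ξ = (H : Reduced G χ m M → ℂ) (cls G χ m M ξ)) →
    ∀ ξ : zeroFibre χ m,
      (P.bracket F H : Reduced G χ m M → ℂ) (cls G χ m M ξ) = kkBracket F' H' ξ

variable {Q : Type*}

/-- The action of `M` on the variety `Q` is algebraic. -/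
def IsAlgebraicAction (A : Subalgebra ℂ (Q → ℂ)) (M : Subgroup G.carrier) [MulAction M Q] : Prop :=
  IsMorphism (regProd (G.regSubgroup M) A) A fun x : M × Q => x.1 • x.2

/-- The algebraic action of `M`, with Lie algebra `m`, on the Poisson variety `Q` is Hamiltonian
with moment map `μ`. -/
structure IsHamiltonian (A : Subalgebra ℂ (Q → ℂ)) (P : PoissonBracket A) (M : Subgroup G.carrier)
    (m : LieSubalgebra ℂ g) [MulAction M Q] (μ : Q → Dual ℂ m) : Prop where
  /-- The group acts by Poisson automorphisms. -/
  poisson : ∀ (u : M) (F H F' H' : A), (∀ p, (F' : Q → ℂ) p = (F : Q → ℂ) (u • p)) →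
    (∀ p, (H' : Q → ℂ) p = (H : Q → ℂ) (u • p)) →
    ∀ p, (P.bracket F' H' : Q → ℂ) p = (P.bracket F H : Q → ℂ) (u • p)
  /-- The moment map is a morphism of varieties. -/
  morphism : IsMorphism A (polyFun (Dual ℂ m)) μ
  /-- The moment map is equivariant for the coadjoint action on `m*`. -/
  equivariant : ∀ (u : M) (y : m), ∃ y' : m, (y' : g) = G.Ad (u : G.carrier)⁻¹ y ∧
    ∀ p, μ (u • p) y = μ p y'
  /-- The comap of the moment map is compatible with the brackets. -/
  comap_bracket : ∀ F ∈ polyFun (Dual ℂ m), ∀ H ∈ polyFun (Dual ℂ m), ∀ F' H' : A,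
    (F' : Q → ℂ) = F ∘ μ → (H' : Q → ℂ) = H ∘ μ →
    (P.bracket F' H' : Q → ℂ) = kkBracket F H ∘ μ
  /-- The derivative of the action along `x ∈ m` is the Hamiltonian vector field of the function
  `p ↦ μ(p)(x)`. -/
  infinitesimal : ∀ x : m, ∃ γ : ℂ → M,
    (∀ t, ((γ t : G.carrier) : LinearMap.GeneralLinearGroup ℂ V).val
      = nilExp (t • G.lieMap (x : g))) ∧
    ∀ F X : A, (∀ p, (X : Q → ℂ) p = μ p x) →
      ∀ p, HasDerivAt (fun t => (F : Q → ℂ) (γ (-t) • p)) ((P.bracket X F : Q → ℂ) p) 0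

end Reduction

end SlodowyStages

end

/-! The core is one algebraic fact about a good grading. Let `a`, `b`, `C` be graded subspaces such
that `(x, y, s) ↦ s + [x, f] + [y, f]` is a linear isomorphism onto a subspace `R`. The map `(x, y,
s) ↦ exp(ad x) exp(ad y)(f + s) - f`, if it takes values in `R`, has that isomorphism as its leading
part: all other terms have strictly higher degree, and degrees are bounded. It is therefore the
identity plus a strictly triangular perturbation, and a terminating fixed-point iteration yields a
polynomial inverse (`exists_inverse_of_triangular`, `exists_inverse_adjoint_map`). This takes the
place of a contracting torus action.

The linear hypothesis says that `C` complements `[f, m]` in the orthogonal of `m`. For `C = Ker ad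
e` this follows from `sl₂`-theory (`IsGradedTriple.eq_zero_of_lie_lie_eq_zero` and its
consequences). With `b = 0` the fact gives (a). With `m₂ = m₁ ⊕ m₀` as `a ⊕ b` it says that each
point of `χ₂ + m₂^⊥` is uniquely `exp(x) exp(y) η` with `x ∈ m₁`, `y ∈ m₀`, `η ∈ S₂`. Forgetting `x`
amounts to passing to `M₁`-orbits, and `(y, η)` are the coordinates in (c)
(`IsStageDatum.exists_equiv`). The decomposition must be graded for the second grading: `m₀` is so
by `h`-stability, and `m₁` because it is the part of `m₂` of positive first degree, while `q₂` has
first degree zero.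

Groups enter only through `expEquiv`: a tangent vector that is nilpotent exponentiates into the
group, and the logarithm of a unipotent element is tangent to it.

For (b), invariance under `M₁` means that `ξ` kills the bracket of `m₁` with the gradient of a lift,
while two lifts have gradients differing by `m₁`; so the bracket descends (`IsLift.kkBracket_congr`,
`exists_reducedBracket`). Since `m₀` normalizes `m₁` and fixes its character, `M₀` acts on the
quotient and restriction to `m₀` descends. The character property of `χ₂` on `m₀` absorbs the shift
in the moment map. A regular section of the quotient (`exists_section`) makes the action algebraic.
-/

noncomputable section

namespace SlodowyStages

open Module

/-! ### Morphisms into vector spaces and products. -/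

section PolynomialMaps

variable {X Y : Type*} {A : Subalgebra ℂ (X → ℂ)}
variable {E E' E'' : Type*} [AddCommGroup E] [Module ℂ E] [AddCommGroup E'] [Module ℂ E']
  [AddCommGroup E''] [Module ℂ E'']

theorem dual_mem_polyFun (l : Dual ℂ E) : (fun x => l x) ∈ polyFun E :=
  Algebra.subset_adjoin ⟨l, rfl⟩

theorem const_mem (A : Subalgebra ℂ (X → ℂ)) (c : ℂ) : (fun _ => c) ∈ A :=
  A.algebraMap_mem c

/-- A map to a vector space is a morphism as soon as its coordinates are regular. -/
theorem isMorphism_iff_dual {φ : X → E} :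
    IsMorphism A (polyFun E) φ ↔ ∀ l : Dual ℂ E, (fun x => l (φ x)) ∈ A := by
  refine ⟨fun h l => h _ (dual_mem_polyFun l), fun h => ?_⟩
  have : polyFun E ≤ A.comap (pullback φ) := by
    refine Algebra.adjoin_le ?_
    rintro _ ⟨l, rfl⟩
    exact h l
  exact fun F hF => this hF

theorem IsMorphism.comp {Z : Type*} {B : Subalgebra ℂ (Y → ℂ)} {C : Subalgebra ℂ (Z → ℂ)}
    {ψ : Y → Z} {φ : X → Y} (hψ : IsMorphism B C ψ) (hφ : IsMorphism A B φ) :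
    IsMorphism A C (fun x => ψ (φ x)) :=
  fun F hF => hφ _ (hψ F hF)

theorem isMorphism_id : IsMorphism A A (fun x => x) := fun _ hF => hF

theorem isMorphism_const (c : E) : IsMorphism A (polyFun E) (fun _ => c) :=
  isMorphism_iff_dual.2 fun l => const_mem A (l c)

theorem IsMorphism.add {φ ψ : X → E} (hφ : IsMorphism A (polyFun E) φ)
    (hψ : IsMorphism A (polyFun E) ψ) : IsMorphism A (polyFun E) (fun x => φ x + ψ x) :=
  isMorphism_iff_dual.2 fun l => by
    simpa only [map_add] using!
      A.add_mem (isMorphism_iff_dual.1 hφ l) (isMorphism_iff_dual.1 hψ l)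

theorem IsMorphism.linear {φ : X → E} (L : E →ₗ[ℂ] E') (hφ : IsMorphism A (polyFun E) φ) :
    IsMorphism A (polyFun E') (fun x => L (φ x)) :=
  isMorphism_iff_dual.2 fun l => isMorphism_iff_dual.1 hφ (l.comp L)

theorem isMorphism_linear (L : E →ₗ[ℂ] E') : IsMorphism (polyFun E) (polyFun E') (fun x => L x) :=
  isMorphism_id.linear L

theorem IsMorphism.const_smul {φ : X → E} (c : ℂ) (hφ : IsMorphism A (polyFun E) φ) :
    IsMorphism A (polyFun E) (fun x => c • φ x) :=
  hφ.linear (c • LinearMap.id)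

theorem IsMorphism.neg {φ : X → E} (hφ : IsMorphism A (polyFun E) φ) :
    IsMorphism A (polyFun E) (fun x => -φ x) :=
  hφ.linear (-LinearMap.id)

theorem IsMorphism.sub {φ ψ : X → E} (hφ : IsMorphism A (polyFun E) φ)
    (hψ : IsMorphism A (polyFun E) ψ) : IsMorphism A (polyFun E) (fun x => φ x - ψ x) := by
  simpa only [sub_eq_add_neg] using hφ.add hψ.neg

theorem IsMorphism.sum {ι : Type*} (s : Finset ι) {φ : ι → X → E}
    (hφ : ∀ i ∈ s, IsMorphism A (polyFun E) (φ i)) :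
    IsMorphism A (polyFun E) (fun x => ∑ i ∈ s, φ i x) := by
  classical
  induction s using Finset.induction_on with
  | empty => simpa using isMorphism_const (0 : E)
  | insert i s hi ih =>
    simp only [Finset.sum_insert hi]
    exact (hφ i (Finset.mem_insert_self i s)).add
      (ih fun j hj => hφ j (Finset.mem_insert_of_mem hj))

/-- Expanding the first argument in a basis turns each coordinate into a finite sum of products of
regular functions. -/
theorem IsMorphism.bilinear [FiniteDimensional ℂ E] {φ : X → E} {ψ : X → E'}
    (L : E →ₗ[ℂ] E' →ₗ[ℂ] E'') (hφ : IsMorphism A (polyFun E) φ)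
    (hψ : IsMorphism A (polyFun E') ψ) : IsMorphism A (polyFun E'') (fun x => L (φ x) (ψ x)) := by
  refine isMorphism_iff_dual.2 fun l => ?_
  have h : (fun x => l (L (φ x) (ψ x))) =
      ∑ i, (fun x => (finBasis ℂ E).coord i (φ x)) * fun x => l (L (finBasis ℂ E i) (ψ x)) := by
    funext x
    have := congrArg (fun z => l (L z (ψ x))) ((finBasis ℂ E).sum_repr (φ x))
    simp only [map_sum, map_smul, LinearMap.sum_apply, LinearMap.smul_apply, smul_eq_mul] at this
    simp [this]
  rw [h]
  exact A.sum_mem fun i _ => A.mul_mem (isMorphism_iff_dual.1 hφ _)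
    (isMorphism_iff_dual.1 hψ (l.comp (L (finBasis ℂ E i))))

theorem IsMorphism.smul {c : X → ℂ} {φ : X → E} (hc : c ∈ A) (hφ : IsMorphism A (polyFun E) φ) :
    IsMorphism A (polyFun E) (fun x => c x • φ x) :=
  isMorphism_iff_dual.2 fun l => by
    simpa only [map_smul] using! A.mul_mem hc (isMorphism_iff_dual.1 hφ l)

theorem IsMorphism.codRestrict {φ : X → E} (hφ : IsMorphism A (polyFun E) φ) (p : Submodule ℂ E)
    (h : ∀ x, φ x ∈ p) : IsMorphism A (polyFun p) (fun x => (⟨φ x, h x⟩ : p)) := by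
  obtain ⟨π, hπ⟩ := p.subtype.exists_leftInverse_of_injective (by simp)
  have := hφ.linear π
  convert this using 2 with x
  exact (LinearMap.congr_fun hπ ⟨φ x, h x⟩).symm

theorem IsMorphism.mul [FiniteDimensional ℂ E] {φ ψ : X → End ℂ E}
    (hφ : IsMorphism A (polyFun (End ℂ E)) φ) (hψ : IsMorphism A (polyFun (End ℂ E)) ψ) :
    IsMorphism A (polyFun (End ℂ E)) (fun x => φ x * ψ x) :=
  hφ.bilinear (LinearMap.mul ℂ (End ℂ E)) hψ

theorem IsMorphism.pow [FiniteDimensional ℂ E] {φ : X → End ℂ E}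
    (hφ : IsMorphism A (polyFun (End ℂ E)) φ) (n : ℕ) :
    IsMorphism A (polyFun (End ℂ E)) (fun x => φ x ^ n) := by
  induction n with
  | zero => simpa using isMorphism_const (1 : End ℂ E)
  | succ n ih => simpa only [pow_succ] using ih.mul hφ

theorem IsMorphism.apply [FiniteDimensional ℂ E] {φ : X → End ℂ E} {ψ : X → E}
    (hφ : IsMorphism A (polyFun (End ℂ E)) φ) (hψ : IsMorphism A (polyFun E) ψ) :
    IsMorphism A (polyFun E) (fun x => φ x (ψ x)) :=
  hφ.bilinear LinearMap.id hψ

theorem IsMorphism.nilExp [FiniteDimensional ℂ E] {φ : X → End ℂ E}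
    (hφ : IsMorphism A (polyFun (End ℂ E)) φ) :
    IsMorphism A (polyFun (End ℂ E)) (fun x => nilExp (φ x)) :=
  IsMorphism.sum _ fun k _ => (hφ.pow k).const_smul _

theorem IsMorphism.restrict {φ : X → Y} {B : Subalgebra ℂ (Y → ℂ)} (hφ : IsMorphism A B φ)
    (s : Set X) : IsMorphism (regSub A s) B (fun x => φ x) :=
  fun F hF => ⟨F ∘ φ, hφ F hF, rfl⟩

theorem IsMorphism.codRestrict_set {φ : X → Y} {B : Subalgebra ℂ (Y → ℂ)} (hφ : IsMorphism A B φ)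
    (s : Set Y) (h : ∀ x, φ x ∈ s) : IsMorphism A (regSub B s) (fun x => (⟨φ x, h x⟩ : s)) := by
  rintro _ ⟨F, hF, rfl⟩
  exact hφ F hF

theorem isMorphism_fst {B : Subalgebra ℂ (Y → ℂ)} :
    IsMorphism (regProd A B) A (fun x : X × Y => x.1) :=
  fun F hF => (le_sup_left : _ ≤ regProd A B) ⟨F, hF, rfl⟩

theorem isMorphism_snd {B : Subalgebra ℂ (Y → ℂ)} :
    IsMorphism (regProd A B) B (fun x : X × Y => x.2) :=
  fun F hF => (le_sup_right : _ ≤ regProd A B) ⟨F, hF, rfl⟩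

theorem IsMorphism.prodMk' {Z : Type*} {B : Subalgebra ℂ (Y → ℂ)} {C : Subalgebra ℂ (Z → ℂ)}
    {φ : Z → X} {ψ : Z → Y} (hφ : IsMorphism C A φ) (hψ : IsMorphism C B ψ) :
    IsMorphism C (regProd A B) (fun z => (φ z, ψ z)) := by
  have : regProd A B ≤ C.comap (pullback fun z => (φ z, ψ z)) := by
    refine sup_le ?_ ?_
    · rintro _ ⟨F, hF, rfl⟩
      exact hφ F hF
    · rintro _ ⟨F, hF, rfl⟩
      exact hψ F hF
  exact fun F hF => this hF

end PolynomialMaps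

/-! ### Differentials of polynomial functions. -/

section Differential

variable {E : Type*} [AddCommGroup E] [Module ℂ E]

/-- A polynomial function has a differential which satisfies the chain rule along curves and is
polynomial in the base point. -/
theorem exists_differential {p : E → ℂ} (hp : p ∈ polyFun E) :
    ∃ d : E → Dual ℂ E, (∀ v, (fun x => d x v) ∈ polyFun E) ∧
      ∀ (c : ℂ → E) (t : ℂ) (v : E), (∀ l : Dual ℂ E, HasDerivAt (fun s => l (c s)) (l v) t) →
        HasDerivAt (fun s => p (c s)) (d (c t) v) t := by
  induction hp using Algebra.adjoin_induction with
  | mem p hp =>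
    obtain ⟨l, rfl⟩ := hp
    exact ⟨fun _ => l, fun v => const_mem _ _, fun c t v h => h l⟩
  | algebraMap r =>
    exact ⟨fun _ => 0, fun v => const_mem _ _, fun c t v _ => hasDerivAt_const t r⟩
  | add p q hp hq ihp ihq =>
    obtain ⟨d, hd, hc⟩ := ihp
    obtain ⟨d', hd', hc'⟩ := ihq
    exact ⟨fun x => d x + d' x, fun v => Subalgebra.add_mem _ (hd v) (hd' v),
      fun c t v h => (hc c t v h).add (hc' c t v h)⟩
  | mul p q hp hq ihp ihq =>
    obtain ⟨d, hd, hc⟩ := ihp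
    obtain ⟨d', hd', hc'⟩ := ihq
    refine ⟨fun x => q x • d x + p x • d' x, fun v => Subalgebra.add_mem _
      (Subalgebra.mul_mem _ hq (hd v)) (Subalgebra.mul_mem _ hp (hd' v)), fun c t v h => ?_⟩
    refine ((hc c t v h).mul (hc' c t v h)).congr_deriv ?_
    change _ = q (c t) * d (c t) v + p (c t) * d' (c t) v
    ring

theorem hasDerivAt_line (l : Dual ℂ E) (x v : E) (t : ℂ) :
    HasDerivAt (fun s : ℂ => l (x + s • v)) (l v) t := by
  simpa using ((hasDerivAt_id t).mul_const (l v)).const_add (l x)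

/-- The differential of a polynomial function (zero for other functions). -/
def differential (p : E → ℂ) : E → Dual ℂ E :=
  open Classical in if hp : p ∈ polyFun E then (exists_differential hp).choose else 0

theorem differential_mem {p : E → ℂ} (hp : p ∈ polyFun E) (v : E) :
    (fun x => differential p x v) ∈ polyFun E := by
  simpa only [differential, hp, dif_pos] using (exists_differential hp).choose_spec.1 v

theorem hasDerivAt_comp_curve {p : E → ℂ} (hp : p ∈ polyFun E) {c : ℂ → E} {t : ℂ} {v : E}
    (h : ∀ l : Dual ℂ E, HasDerivAt (fun s => l (c s)) (l v) t) :
    HasDerivAt (fun s => p (c s)) (differential p (c t) v) t := by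
  simpa only [differential, hp, dif_pos] using (exists_differential hp).choose_spec.2 c t v h

theorem hasDerivAt_comp_line {p : E → ℂ} (hp : p ∈ polyFun E) (x v : E) :
    HasDerivAt (fun s : ℂ => p (x + s • v)) (differential p x v) 0 := by
  simpa using hasDerivAt_comp_curve hp (c := fun s : ℂ => x + s • v) (t := 0)
    fun l => hasDerivAt_line l x v 0

theorem lineDeriv_eq_differential {p : E → ℂ} (hp : p ∈ polyFun E) (x v : E) :
    lineDeriv ℂ p x v = differential p x v :=
  (hasDerivAt_comp_line hp x v).deriv

end Differential

/-! ### Polynomials in one variable and orders of vanishing. -/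

section OneVariable

open Polynomial in
theorem exists_polynomial_of_mem_polyFun {φ : ℂ → ℂ} (hφ : φ ∈ polyFun ℂ) :
    ∃ P : ℂ[X], ∀ t, P.eval t = φ t := by
  induction hφ using Algebra.adjoin_induction with
  | mem p hp =>
    obtain ⟨l, rfl⟩ := hp
    refine ⟨C (l 1) * X, fun t => ?_⟩
    have : l t = t * l 1 := by rw [← smul_eq_mul, ← map_smul, smul_eq_mul, mul_one]
    change _ = l t
    rw [this, eval_mul, eval_C, eval_X, mul_comm]
  | algebraMap r => exact ⟨C r, fun t => by simp⟩
  | add p q _ _ hp hq =>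
    obtain ⟨P, hP⟩ := hp
    obtain ⟨Q, hQ⟩ := hq
    exact ⟨P + Q, fun t => by simp [hP, hQ]⟩
  | mul p q _ _ hp hq =>
    obtain ⟨P, hP⟩ := hp
    obtain ⟨Q, hQ⟩ := hq
    exact ⟨P * Q, fun t => by simp [hP, hQ]⟩

theorem id_mem_polyFun : (fun t : ℂ => t) ∈ polyFun ℂ := dual_mem_polyFun (LinearMap.id : Dual ℂ ℂ)

open Polynomial in
-- In characteristic zero, integration raises the order of vanishing at the origin by one. This
-- drives the formal differential equations for `exp` and `log` and the vanishing argument along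
-- one-parameter subgroups.
theorem X_pow_succ_dvd_of_derivative {P : ℂ[X]} {k : ℕ} (h0 : P.coeff 0 = 0)
    (h : X ^ k ∣ derivative P) : X ^ (k + 1) ∣ P := by
  rw [X_pow_dvd_iff] at h ⊢
  rintro (_ | d) hd
  · exact h0
  · have := h d (by omega)
    rw [coeff_derivative] at this
    exact (mul_eq_zero.1 this).resolve_right (Nat.cast_add_one_ne_zero d)

end OneVariable

/-! ### Inversion of unitriangular polynomial maps. -/

section Triangular

variable {E : Type*} [AddCommGroup E] [Module ℂ E]

/-- A polynomial perturbation of the identity which is strictly triangular for a finite filtration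
is invertible, with a polynomial inverse. -/
theorem exists_inverse_of_triangular (W : ℕ → Submodule ℂ E) (h0 : W 0 = ⊤) {n : ℕ} (hn : W n = ⊥)
    (N : E → E) (hN : IsMorphism (polyFun E) (polyFun E) N)
    (htri : ∀ k x y, x - y ∈ W k → N x - N y ∈ W (k + 1)) :
    ∃ I : E → E, IsMorphism (polyFun E) (polyFun E) I ∧ (∀ x, I (x + N x) = x) ∧
      ∀ y, I y + N (I y) = y := by
  -- Fixed-point iteration for `z = y - N z` from `0`. Each round gains one filtration step, so the
  -- `n`-th iterate is exact; it is polynomial because the number of rounds is fixed.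
  let J : ℕ → E → E := fun k y => (fun z => y - N z)^[k] 0
  have hJs : ∀ k y, J (k + 1) y = y - N (J k y) := fun k y => Function.iterate_succ_apply' _ _ _
  have hJ : ∀ k, IsMorphism (polyFun E) (polyFun E) (J k) := by
    intro k
    induction k with
    | zero => exact isMorphism_const 0
    | succ k ih =>
      have := isMorphism_id.sub (hN.comp ih)
      convert this using 2 with y
      exact hJs k y
  have key : ∀ x k, J k (x + N x) - x ∈ W k := by
    intro x k
    induction k with
    | zero => simp [h0]
    | succ k ih =>
      rw [hJs]
      have := htri k x (J k (x + N x)) (by rw [← neg_mem_iff, neg_sub]; exact ih)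
      convert this using 1
      abel
  have hstep : ∀ y k, J (k + 1) y - J k y ∈ W k := by
    intro y k
    induction k with
    | zero => simp [h0]
    | succ k ih =>
      rw [hJs (k + 1), hJs k]
      have := htri k (J k y) (J (k + 1) y) (by rw [← neg_mem_iff, neg_sub]; exact ih)
      rw [← hJs k]
      convert this using 1
      rw [hJs k]
      abel
  refine ⟨J n, hJ n, fun x => ?_, fun y => ?_⟩
  · have := key x n
    rwa [hn, Submodule.mem_bot, sub_eq_zero] at this
  · have := hstep y n
    rw [hn, Submodule.mem_bot, sub_eq_zero, hJs] at this
    exact (sub_eq_iff_eq_add.1 this).symm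

end Triangular

/-! ### Truncated exponential and logarithm. -/

section NilpotentExponential

open Polynomial

/-- The truncated exponential polynomial. -/
def expPoly (n : ℕ) : ℂ[X] := ∑ k ∈ Finset.range (n + 1), C ((k.factorial : ℂ)⁻¹) * X ^ k

/-- The truncation of `log (1 + X)`. -/
def logPoly (n : ℕ) : ℂ[X] := ∑ k ∈ Finset.range n, C ((-1) ^ k * ((k : ℂ) + 1)⁻¹) * X ^ (k + 1)

theorem derivative_expPoly (n : ℕ) :
    derivative (expPoly n) = expPoly n - C ((n.factorial : ℂ)⁻¹) * X ^ n := by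
  have h : ∀ k : ℕ, derivative (C (((k + 1).factorial : ℂ)⁻¹) * X ^ (k + 1)) =
      C ((k.factorial : ℂ)⁻¹) * (X : ℂ[X]) ^ k := by
    intro k
    rw [derivative_C_mul_X_pow, Nat.factorial_succ]
    congr 2
    push_cast
    have : ((k : ℂ) + 1) ≠ 0 := Nat.cast_add_one_ne_zero k
    have : (k.factorial : ℂ) ≠ 0 := by exact_mod_cast k.factorial_ne_zero
    field_simp
  rw [expPoly, Finset.sum_range_succ, add_sub_cancel_right]
  rw [← Finset.sum_range_succ, Finset.sum_range_succ', derivative_add, derivative_sum]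
  simp only [h]
  simp

theorem derivative_logPoly (n : ℕ) :
    derivative (logPoly n) = ∑ k ∈ Finset.range n, (-X) ^ k := by
  rw [logPoly, derivative_sum]
  refine Finset.sum_congr rfl fun k _ => ?_
  have : ((k : ℂ) + 1) ≠ 0 := Nat.cast_add_one_ne_zero k
  rw [derivative_C_mul_X_pow, Nat.add_sub_cancel, neg_pow, Nat.cast_add, Nat.cast_one, mul_assoc,
    inv_mul_cancel₀ this]
  simp [neg_pow (X : ℂ[X]) k]

theorem one_add_X_mul_derivative_logPoly (n : ℕ) :
    (1 + X) * derivative (logPoly n) = 1 - (-X) ^ n := by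
  rw [derivative_logPoly]
  have := mul_neg_geom_sum (-X : ℂ[X]) n
  rwa [sub_neg_eq_add] at this

theorem X_dvd_logPoly (n : ℕ) : X ∣ logPoly n :=
  Finset.dvd_sum fun k _ => Dvd.dvd.mul_left (dvd_pow_self X (Nat.succ_ne_zero k)) _

theorem X_dvd_expPoly_sub_one (n : ℕ) : X ∣ expPoly n - 1 := by
  rw [expPoly, Finset.sum_range_succ']
  simp only [Nat.factorial_zero, Nat.cast_one, inv_one, C_1, pow_zero, mul_one, add_sub_cancel_right]
  exact Finset.dvd_sum fun k _ => Dvd.dvd.mul_left (dvd_pow_self X (Nat.succ_ne_zero k)) _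

/-- Modulo `X ^ n` the truncations satisfy `E' = E` and `(1 + X) L' = 1`, so the derivative of `L(E
- 1) - X` vanishes to order `n`; integration gives one order more. -/
theorem X_pow_dvd_logPoly_comp_expPoly (n : ℕ) :
    X ^ (n + 1) ∣ (logPoly n).comp (expPoly n - 1) - X := by
  set E := expPoly n with hE
  have hX : X ∣ E - 1 := X_dvd_expPoly_sub_one n
  apply X_pow_succ_dvd_of_derivative
  · have h1 : X ∣ (logPoly n).comp (E - 1) := by
      obtain ⟨r, hr⟩ := X_dvd_logPoly n
      rw [hr, mul_comp, X_comp]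
      exact hX.mul_right _
    have := dvd_sub h1 (dvd_refl X)
    exact X_dvd_iff.1 this
  · have h2 := congrArg (fun p : ℂ[X] => p.comp (E - 1)) (one_add_X_mul_derivative_logPoly n)
    simp only [mul_comp, add_comp, one_comp, X_comp, sub_comp, pow_comp, neg_comp,
      add_sub_cancel] at h2
    have h3 : derivative ((logPoly n).comp (E - 1) - X) =
        -(-(E - 1)) ^ n - C ((n.factorial : ℂ)⁻¹) * X ^ n *
          (derivative (logPoly n)).comp (E - 1) := by
      rw [derivative_sub, derivative_comp, derivative_sub, derivative_one, sub_zero, derivative_X,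
        hE, derivative_expPoly, ← hE, sub_mul, h2]
      ring
    rw [h3]
    refine dvd_sub ((dvd_neg).2 (pow_dvd_pow_of_dvd ((dvd_neg).2 hX) n)) ?_
    exact Dvd.dvd.mul_right (dvd_mul_left _ _) _

/-- With `R = exp ∘ log`, both `R` and `1 + X` solve `(1 + X) y' = y` modulo `X ^ n`, with the same
value at `0`. The order of vanishing of their difference is bootstrapped: order `k + 1` of the
difference passes to its derivative because `1 + X` is prime to `X`, and integration then gives
order `k + 2`. -/
theorem X_pow_dvd_expPoly_comp_logPoly (n : ℕ) :
    X ^ (n + 1) ∣ (expPoly n).comp (logPoly n) - (1 + X) := by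
  set L := logPoly n with hL
  have hX : X ∣ L := X_dvd_logPoly n
  set R := (expPoly n).comp L with hR
  have hR' : derivative R = (R - C ((n.factorial : ℂ)⁻¹) * L ^ n) * derivative L := by
    rw [hR, derivative_comp, derivative_expPoly]
    simp
    ring
  have hode : X ^ n ∣ (1 + X) * derivative (R - (1 + X)) - (R - (1 + X)) := by
    have : (1 + X) * derivative (R - (1 + X)) - (R - (1 + X)) =
        -(R * (-X) ^ n) - C ((n.factorial : ℂ)⁻¹) * L ^ n * ((1 + X) * derivative L) := by
      rw [derivative_sub, hR', derivative_add, derivative_one, derivative_X]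
      have := one_add_X_mul_derivative_logPoly n
      rw [← hL] at this
      linear_combination (R) * this
    rw [this]
    refine dvd_sub ((dvd_neg).2 (Dvd.dvd.mul_left ?_ _)) ?_
    · exact pow_dvd_pow_of_dvd ((dvd_neg).2 dvd_rfl) n
    · exact Dvd.dvd.mul_right (Dvd.dvd.mul_left (pow_dvd_pow_of_dvd hX n) _) _
  have h0 : (R - (1 + X)).coeff 0 = 0 := by
    have h1 : X ∣ (expPoly n - 1).comp L := by
      obtain ⟨r, hr⟩ := X_dvd_expPoly_sub_one n
      rw [hr, mul_comp, X_comp]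
      exact hX.mul_right _
    rw [sub_comp, one_comp] at h1
    rw [← X_dvd_iff, ← sub_sub]
    exact dvd_sub h1 dvd_rfl
  have key : ∀ k ≤ n, X ^ (k + 1) ∣ R - (1 + X) := by
    intro k
    induction k with
    | zero => intro _; simpa using X_dvd_iff.2 h0
    | succ k ih =>
      intro hk
      have h1 := ih (by omega)
      apply X_pow_succ_dvd_of_derivative h0
      have h2 : X ^ (k + 1) ∣ (1 + X) * derivative (R - (1 + X)) := by
        have := dvd_add ((pow_dvd_pow X hk).trans hode) h1
        simpa using this
      refine IsCoprime.dvd_of_dvd_mul_left ?_ h2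
      exact IsCoprime.pow_left ⟨-1, 1, by ring⟩
  exact key n le_rfl

variable {V : Type*} [AddCommGroup V] [Module ℂ V]

theorem nilExp_eq_aeval (N : End ℂ V) : nilExp N = aeval N (expPoly (finrank ℂ V)) := by
  simp [nilExp, expPoly, Algebra.smul_def]

/-- The logarithm of a unipotent endomorphism. -/
def nilLog (u : End ℂ V) : End ℂ V := aeval (u - 1) (logPoly (finrank ℂ V))

theorem isNilpotent_nilLog {u : End ℂ V} (hu : IsNilpotent (u - 1)) : IsNilpotent (nilLog u) := by
  obtain ⟨r, hr⟩ := X_dvd_logPoly (finrank ℂ V)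
  rw [nilLog, hr, map_mul, aeval_X]
  refine Commute.isNilpotent_mul_right ?_ hu
  simpa only [aeval_X] using Commute.map (Commute.all X r) (aeval (u - 1))

variable [FiniteDimensional ℂ V]

/-- The characteristic polynomial of a nilpotent endomorphism is `X ^ dim`, and Cayley-Hamilton
applies; hence the truncation in `nilExp` loses nothing. -/
theorem pow_finrank_eq_zero {N : End ℂ V} (hN : IsNilpotent N) : N ^ finrank ℂ V = 0 := by
  have := (LinearMap.charpoly_eq_X_pow_iff N).2
    (fun v => hN.imp fun n hn => by simp [hn])
  have h := N.aeval_self_charpoly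
  rwa [this, map_pow, aeval_X] at h

theorem aeval_eq_of_X_pow_dvd_sub {N : End ℂ V} (hN : IsNilpotent N) {P Q : ℂ[X]}
    (h : X ^ (finrank ℂ V + 1) ∣ P - Q) : aeval N P = aeval N Q := by
  obtain ⟨r, hr⟩ := h
  rw [← sub_eq_zero, ← map_sub, hr, map_mul, map_pow, aeval_X, pow_succ, pow_finrank_eq_zero hN]
  simp

theorem nilLog_nilExp {N : End ℂ V} (hN : IsNilpotent N) : nilLog (nilExp N) = N := by
  have := aeval_eq_of_X_pow_dvd_sub hN (X_pow_dvd_logPoly_comp_expPoly (finrank ℂ V))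
  rw [aeval_comp, map_sub, aeval_X, map_one, ← nilExp_eq_aeval] at this
  exact this

theorem nilExp_nilLog {u : End ℂ V} (hu : IsNilpotent (u - 1)) : nilExp (nilLog u) = u := by
  have := aeval_eq_of_X_pow_dvd_sub hu (X_pow_dvd_expPoly_comp_logPoly (finrank ℂ V))
  rw [aeval_comp, map_add, aeval_X, map_one, add_sub_cancel] at this
  rw [nilExp_eq_aeval]
  exact this

/-- Any truncation length at which the powers vanish is allowed. Exponentials of different
endomorphisms, even on different spaces, can thus be compared term by term at a common length. -/
theorem nilExp_eq_sum {N : End ℂ V} {n : ℕ} (hN : N ^ n = 0) :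
    nilExp N = ∑ k ∈ Finset.range n, ((k.factorial : ℂ)⁻¹) • N ^ k := by
  have hfin := pow_finrank_eq_zero ⟨n, hN⟩
  have : ∀ a b : ℕ, a ≤ b → N ^ a = 0 → ∑ k ∈ Finset.range b, ((k.factorial : ℂ)⁻¹) • N ^ k =
      ∑ k ∈ Finset.range a, ((k.factorial : ℂ)⁻¹) • N ^ k := by
    intro a b hab ha
    refine (Finset.sum_subset (Finset.range_mono hab) fun k _ hk => ?_).symm
    rw [pow_eq_zero_of_le (by simpa using hk) ha, smul_zero]
  rw [nilExp, this _ _ (Nat.le_succ _) hfin]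
  rcases le_total n (finrank ℂ V) with h | h
  · exact this _ _ h hN
  · exact (this _ _ h hfin).symm

/-- Serves to transfer the addition formula from `IsNilpotent.exp`; the point is that the rational
and complex scalars `1 / k!` agree. -/
theorem nilExp_eq_exp [Module ℚ (End ℂ V)] {N : End ℂ V} (hN : IsNilpotent N) :
    nilExp N = IsNilpotent.exp N := by
  obtain ⟨n, hn⟩ := hN
  rw [nilExp_eq_sum hn, IsNilpotent.exp_eq_sum hn]
  refine Finset.sum_congr rfl fun k _ => ?_
  have h1 : ((k.factorial : ℚ)⁻¹ • N ^ k : End ℂ V) = ((k.factorial : ℂ)⁻¹) • N ^ k := by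
    have h0 : (k.factorial : ℂ) ≠ 0 := by exact_mod_cast k.factorial_ne_zero
    have h0' : (k.factorial : ℚ) ≠ 0 := by exact_mod_cast k.factorial_ne_zero
    have h2 : (k.factorial : ℂ) • ((k.factorial : ℚ)⁻¹ • N ^ k : End ℂ V) = N ^ k := by
      rw [Nat.cast_smul_eq_nsmul, ← Nat.cast_smul_eq_nsmul ℚ, smul_smul, mul_inv_cancel₀ h0',
        one_smul]
    rw [← h2, smul_smul, inv_mul_cancel₀ h0, one_smul, h2]
  exact h1.symm

variable (V) in
/-- The rational structure underlying a complex algebra of endomorphisms. -/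
abbrev ratModuleEnd : Module ℚ (End ℂ V) := Module.compHom _ (algebraMap ℚ ℂ)

theorem nilExp_add_of_commute {N N' : End ℂ V} (h : Commute N N') (hN : IsNilpotent N)
    (hN' : IsNilpotent N') : nilExp (N + N') = nilExp N * nilExp N' := by
  let := ratModuleEnd V
  rw [nilExp_eq_exp (h.isNilpotent_add hN hN'), nilExp_eq_exp hN, nilExp_eq_exp hN',
    IsNilpotent.exp_add_of_commute h hN hN']

theorem nilExp_zero : nilExp (0 : End ℂ V) = 1 := by
  rw [nilExp_eq_sum (n := 1) (by simp)]
  simp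

theorem nilExp_mul_nilExp_neg {N : End ℂ V} (hN : IsNilpotent N) :
    nilExp N * nilExp (-N) = 1 := by
  rw [← nilExp_add_of_commute ((Commute.refl N).neg_right) hN hN.neg, add_neg_cancel, nilExp_zero]

theorem nilExp_neg_mul_nilExp {N : End ℂ V} (hN : IsNilpotent N) :
    nilExp (-N) * nilExp N = 1 := by
  simpa using nilExp_mul_nilExp_neg hN.neg

theorem nilExp_natCast_smul {N : End ℂ V} (hN : IsNilpotent N) (n : ℕ) :
    nilExp ((n : ℂ) • N) = nilExp N ^ n := by
  induction n with
  | zero => simp [nilExp_zero]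
  | succ n ih =>
    rw [Nat.cast_add, Nat.cast_one, add_smul, one_smul, pow_succ, ← ih]
    exact nilExp_add_of_commute ((Commute.refl N).smul_left _) (hN.smul _) hN

theorem hasDerivAt_nilExp_smul {N : End ℂ V} (hN : IsNilpotent N) (l : Dual ℂ (End ℂ V)) (t : ℂ) :
    HasDerivAt (fun s : ℂ => l (nilExp (s • N))) (l (nilExp (t • N) * N)) t := by
  have hpow := pow_finrank_eq_zero hN
  set n := finrank ℂ V with hn
  have hfun : (fun s : ℂ => l (nilExp (s • N))) = fun s => ∑ k ∈ Finset.range (n + 1),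
      s ^ k * (((k.factorial : ℂ)⁻¹) * l (N ^ k)) := by
    funext s
    simp only [nilExp, map_sum, map_smul, _root_.smul_pow, smul_eq_mul]
    exact Finset.sum_congr rfl fun k _ => by ring
  rw [hfun]
  refine (HasDerivAt.fun_sum fun k _ => (hasDerivAt_pow k t).mul_const _).congr_deriv ?_
  rw [nilExp_eq_sum (n := n) (by rw [_root_.smul_pow, hpow, smul_zero]), Finset.sum_range_succ', Finset.sum_mul,
    map_sum]
  simp only [Nat.cast_zero, zero_mul, add_zero]
  refine Finset.sum_congr rfl fun k _ => ?_
  rw [smul_mul_assoc, _root_.smul_pow, smul_mul_assoc, map_smul, map_smul, ← pow_succ, Nat.factorial_succ]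
  have : ((k : ℂ) + 1) ≠ 0 := Nat.cast_add_one_ne_zero k
  have : (k.factorial : ℂ) ≠ 0 := by exact_mod_cast k.factorial_ne_zero
  simp only [smul_eq_mul, Nat.add_sub_cancel]
  push_cast
  field_simp

end NilpotentExponential

/-! ### Exponentials, intertwiners and conjugation. -/

section ExponentialAlgebra

variable {V W : Type*} [AddCommGroup V] [Module ℂ V] [AddCommGroup W] [Module ℂ W]

theorem isNilpotent_mulLeft {N : End ℂ V} (hN : IsNilpotent N) :
    IsNilpotent (LinearMap.mulLeft ℂ N) :=
  hN.imp fun n hn => by rw [LinearMap.pow_mulLeft, hn, LinearMap.mulLeft_zero_eq_zero]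

theorem isNilpotent_mulRight {N : End ℂ V} (hN : IsNilpotent N) :
    IsNilpotent (LinearMap.mulRight ℂ N) :=
  hN.imp fun n hn => by rw [LinearMap.pow_mulRight, hn, LinearMap.mulRight_zero_eq_zero]

variable [FiniteDimensional ℂ V] [FiniteDimensional ℂ W]

theorem nilExp_intertwine {N : End ℂ V} {N' : End ℂ W} (hN : IsNilpotent N) (hN' : IsNilpotent N')
    (T : V →ₗ[ℂ] W) (h : ∀ v, N' (T v) = T (N v)) (v : V) : nilExp N' (T v) = T (nilExp N v) := by
  obtain ⟨n, hn⟩ := hN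
  obtain ⟨n', hn'⟩ := hN'
  rw [nilExp_eq_sum (pow_eq_zero_of_le (le_max_left n n') hn),
    nilExp_eq_sum (pow_eq_zero_of_le (le_max_right n n') hn')]
  have hk : ∀ k : ℕ, (N' ^ k) (T v) = T ((N ^ k) v) := by
    intro k
    induction k with
    | zero => rfl
    | succ k ih => rw [pow_succ', pow_succ', Module.End.mul_apply, Module.End.mul_apply, ih, h]
  simp [LinearMap.sum_apply, hk]

theorem nilExp_mulLeft {N : End ℂ V} (hN : IsNilpotent N) :
    nilExp (LinearMap.mulLeft ℂ N) = LinearMap.mulLeft ℂ (nilExp N) := by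
  obtain ⟨n, hn⟩ := hN
  rw [nilExp_eq_sum hn, nilExp_eq_sum (n := n) (by
    rw [LinearMap.pow_mulLeft, hn, LinearMap.mulLeft_zero_eq_zero])]
  ext x : 1
  simp [LinearMap.pow_mulLeft, LinearMap.sum_apply, Finset.sum_mul]

theorem nilExp_mulRight {N : End ℂ V} (hN : IsNilpotent N) :
    nilExp (LinearMap.mulRight ℂ N) = LinearMap.mulRight ℂ (nilExp N) := by
  obtain ⟨n, hn⟩ := hN
  rw [nilExp_eq_sum hn, nilExp_eq_sum (n := n) (by
    rw [LinearMap.pow_mulRight, hn, LinearMap.mulRight_zero_eq_zero])]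
  ext x : 1
  simp [LinearMap.pow_mulRight, LinearMap.sum_apply, Finset.mul_sum]

/-- Left and right multiplications commute, so the exponential of their sum splits into a product.
-/
theorem nilExp_conj {N : End ℂ V} (hN : IsNilpotent N) (Y : End ℂ V) :
    nilExp (LinearMap.mulLeft ℂ N + LinearMap.mulRight ℂ (-N)) Y =
      nilExp N * Y * nilExp (-N) := by
  rw [nilExp_add_of_commute (LinearMap.commute_mulLeft_right N (-N)) (isNilpotent_mulLeft hN)
    (isNilpotent_mulRight hN.neg), nilExp_mulLeft hN, nilExp_mulRight hN.neg]
  simp [mul_assoc]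

/-- The exponential of a nilpotent endomorphism, as an element of the general linear group. -/
def expGL (N : End ℂ V) (hN : IsNilpotent N) : LinearMap.GeneralLinearGroup ℂ V :=
  ⟨nilExp N, nilExp (-N), nilExp_mul_nilExp_neg hN, nilExp_neg_mul_nilExp hN⟩

theorem expGL_val (N : End ℂ V) (hN : IsNilpotent N) : (expGL N hN).val = nilExp N := rfl

end ExponentialAlgebra

/-! ### Exponential and logarithm between a closed group and its tangent space. -/

section TangentSpace

variable {V : Type*} [AddCommGroup V] [Module ℂ V]
variable {H : Subgroup (LinearMap.GeneralLinearGroup ℂ V)}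

theorem isMorphism_differential {E : Type*} [AddCommGroup E] [Module ℂ E] [FiniteDimensional ℂ E]
    {p : E → ℂ} (hp : p ∈ polyFun E) :
    IsMorphism (polyFun E) (polyFun (Dual ℂ E)) (differential p) := by
  refine isMorphism_iff_dual.2 fun l => ?_
  obtain ⟨v, rfl⟩ := (evalEquiv ℂ E).surjective l
  exact differential_mem hp v

/-- The derivative of a polynomial function along the left invariant vector field defined
by `X`. -/
def leftDerivative (X : End ℂ V) (p : End ℂ V → ℂ) : End ℂ V → ℂ :=
  fun u => differential p u (u * X)

/-- Left translation by `u ∈ H` preserves the functions vanishing on `H`, so tangency at the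
identity propagates to `u`. -/
theorem leftDerivative_vanishes {X : End ℂ V} (hX : X ∈ tangentSpace H) {p : End ℂ V → ℂ}
    (hp : p ∈ polyFun (End ℂ V))
    (hpH : ∀ u : LinearMap.GeneralLinearGroup ℂ V, u ∈ H → p u = 0)
    (u : LinearMap.GeneralLinearGroup ℂ V) (hu : u ∈ H) : leftDerivative X p u = 0 := by
  have h := hX (p ∘ LinearMap.mulLeft ℂ (u : End ℂ V)) (polyFun_comp _ hp)
    (fun v hv => hpH (u * v) (H.mul_mem hu hv))
  rw [← h, leftDerivative, ← lineDeriv_eq_differential hp]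
  simp [lineDeriv, mul_add]

variable [FiniteDimensional ℂ V]

theorem leftDerivative_mem (X : End ℂ V) {p : End ℂ V → ℂ} (hp : p ∈ polyFun (End ℂ V)) :
    leftDerivative X p ∈ polyFun (End ℂ V) := by
  have := (isMorphism_differential hp).bilinear (LinearMap.id)
    (isMorphism_linear (LinearMap.mulRight ℂ X))
  exact isMorphism_iff_dual.1 this LinearMap.id

theorem isMorphism_nilExp_smul (X : End ℂ V) :
    IsMorphism (polyFun ℂ) (polyFun (End ℂ V)) (fun t : ℂ => nilExp (t • X)) :=
  IsMorphism.nilExp (IsMorphism.smul id_mem_polyFun (isMorphism_const X))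

open Polynomial in
-- Along `t ↦ exp(tX)`, differentiating `p` produces its left derivative, which again vanishes on
-- `H`. All Taylor coefficients at `0` therefore vanish, and the function of `t` is a polynomial.
theorem vanishes_on_exp {X : End ℂ V} (hX : X ∈ tangentSpace H) (hnil : IsNilpotent X)
    {p : End ℂ V → ℂ} (hp : p ∈ polyFun (End ℂ V))
    (hpH : ∀ u : LinearMap.GeneralLinearGroup ℂ V, u ∈ H → p u = 0) (t : ℂ) :
    p (nilExp (t • X)) = 0 := by
  -- The statement is uniform in `p` because the induction replaces `p` by its left derivative.
  have key : ∀ (k : ℕ) (p : End ℂ V → ℂ), p ∈ polyFun (End ℂ V) →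
      (∀ u : LinearMap.GeneralLinearGroup ℂ V, u ∈ H → p u = 0) →
      ∀ P : ℂ[X], (∀ t, P.eval t = p (nilExp (t • X))) → Polynomial.X ^ k ∣ P := by
    intro k
    induction k with
    | zero => intros; simp
    | succ k ih =>
      intro p hp hpH P hP
      have hd := leftDerivative_mem X hp
      apply X_pow_succ_dvd_of_derivative
      · rw [coeff_zero_eq_eval_zero, hP]
        simpa [nilExp_zero] using hpH 1 H.one_mem
      · refine ih _ hd (leftDerivative_vanishes hX hp hpH) _ fun t => ?_
        have h1 : HasDerivAt (fun s => P.eval s) (leftDerivative X p (nilExp (t • X))) t := by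
          simp only [hP]
          exact hasDerivAt_comp_curve hp fun l => hasDerivAt_nilExp_smul hnil l t
        exact (P.hasDerivAt t).unique h1
  obtain ⟨P, hP⟩ := exists_polynomial_of_mem_polyFun (isMorphism_nilExp_smul X p hp)
  have hP0 : P = 0 := by
    by_contra h0
    have h1 := key (P.natDegree + 1) p hp hpH P hP
    have h2 := natDegree_le_of_dvd h1 h0
    rw [natDegree_X_pow] at h2
    omega
  rw [← Function.comp_apply (f := p) (g := fun t : ℂ => nilExp (t • X)), ← hP, hP0, eval_zero]

theorem expGL_mem (hH : IsZariskiClosed H) {X : End ℂ V} (hX : X ∈ tangentSpace H)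
    (hnil : IsNilpotent X) : expGL X hnil ∈ H := by
  obtain ⟨S, hS, hmem⟩ := hH
  refine (hmem _).2 fun p hp => ?_
  have := vanishes_on_exp hX hnil (hS hp) (fun u hu => (hmem u).1 hu p hp) 1
  rwa [one_smul] at this

open Polynomial in
-- The polynomial `t ↦ p(exp(t log u))` vanishes at every natural number, since its value there is
-- `p(u ^ n)`. It is thus zero, and so is its derivative at `0`.
theorem nilLog_mem_tangentSpace {u : LinearMap.GeneralLinearGroup ℂ V} (hu : u ∈ H)
    (hnil : IsNilpotent (u.val - 1)) : nilLog u.val ∈ tangentSpace H := by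
  intro p hp hpH
  have hN := isNilpotent_nilLog hnil
  obtain ⟨P, hP⟩ := exists_polynomial_of_mem_polyFun (isMorphism_nilExp_smul (nilLog u.val) p hp)
  have hP' : ∀ t : ℂ, P.eval t = p (nilExp (t • nilLog u.val)) := hP
  have hP0 : P = 0 := by
    refine eq_zero_of_infinite_isRoot P (Set.Infinite.mono ?_
      (Set.infinite_range_of_injective (Nat.cast_injective (R := ℂ))))
    rintro _ ⟨n, rfl⟩
    rw [Set.mem_ofPred_eq, IsRoot.def, hP', nilExp_natCast_smul hN, nilExp_nilLog hnil]
    simpa using hpH (u ^ n) (H.pow_mem hu n)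
  have h1 : HasDerivAt (fun s => P.eval s) (differential p 1 (nilLog u.val)) 0 := by
    simp only [hP']
    simpa [nilExp_zero] using hasDerivAt_comp_curve hp fun l => hasDerivAt_nilExp_smul hN l 0
  rw [lineDeriv_eq_differential hp, ← (P.hasDerivAt 0).unique h1, hP0]
  simp

end TangentSpace

/-! ### Exponential coordinates on unipotent subgroups. -/

namespace ConnectedAlgebraicGroup

variable {g V : Type*} [LieRing g] [LieAlgebra ℂ g] [AddCommGroup V] [Module ℂ V]
variable (G : ConnectedAlgebraicGroup g V)

theorem lieMap_ad (x y : g) : (LinearMap.mulLeft ℂ (G.lieMap x) +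
    LinearMap.mulRight ℂ (-G.lieMap x)) (G.lieMap y) = G.lieMap (LieAlgebra.ad ℂ g x y) := by
  simp [G.lieMap_lie, sub_eq_add_neg]

/-- Under the embedding `lieMap`, `ad x` becomes left minus right multiplication by a nilpotent
matrix: a sum of commuting nilpotents. -/
theorem isNilpotent_ad_of_lieMap {x : g} (hx : IsNilpotent (G.lieMap x)) :
    IsNilpotent (LieAlgebra.ad ℂ g x) := by
  have h : IsNilpotent (LinearMap.mulLeft ℂ (G.lieMap x) + LinearMap.mulRight ℂ (-G.lieMap x)) :=
    (LinearMap.commute_mulLeft_right _ _).isNilpotent_add (isNilpotent_mulLeft hx)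
      (isNilpotent_mulRight hx.neg)
  obtain ⟨n, hn⟩ := h
  refine ⟨n, LinearMap.ext fun y => G.lieMap_injective ?_⟩
  have hk : ∀ k : ℕ, ((LinearMap.mulLeft ℂ (G.lieMap x) +
      LinearMap.mulRight ℂ (-G.lieMap x)) ^ k) (G.lieMap y) =
        G.lieMap ((LieAlgebra.ad ℂ g x ^ k) y) := by
    intro k
    induction k with
    | zero => rfl
    | succ k ih => rw [pow_succ', pow_succ', Module.End.mul_apply, Module.End.mul_apply, ih,
        lieMap_ad]
  rw [← hk n, hn]
  simp

variable {G} {M : Subgroup G.carrier} {m : LieSubalgebra ℂ g}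

theorem regular_coord (M : Subgroup G.carrier) :
    IsMorphism (G.regSubgroup M) (polyFun (End ℂ V))
      (fun u : M => ((u : G.carrier) : LinearMap.GeneralLinearGroup ℂ V).val) :=
  isMorphism_iff_dual.2 fun l => ⟨_, Algebra.subset_adjoin (Or.inl ⟨l, rfl⟩), rfl⟩

theorem regular_coord_inv (M : Subgroup G.carrier) :
    IsMorphism (G.regSubgroup M) (polyFun (End ℂ V))
      (fun u : M => ((u : G.carrier) : LinearMap.GeneralLinearGroup ℂ V)⁻¹.val) :=
  isMorphism_iff_dual.2 fun l => ⟨_, Algebra.subset_adjoin (Or.inr ⟨l, rfl⟩), rfl⟩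

theorem isMorphism_to_subgroup {X : Type*} {A : Subalgebra ℂ (X → ℂ)} {φ : X → M}
    (h : IsMorphism A (polyFun (End ℂ V))
      (fun x => ((φ x : G.carrier) : LinearMap.GeneralLinearGroup ℂ V).val))
    (h' : IsMorphism A (polyFun (End ℂ V))
      (fun x => ((φ x : G.carrier) : LinearMap.GeneralLinearGroup ℂ V)⁻¹.val)) :
    IsMorphism A (G.regSubgroup M) φ := by
  rintro _ ⟨F, hF, rfl⟩
  have : regGroup (G.toGL M) ≤ A.comap (pullback fun x =>
      (⟨(φ x).1.1, Subgroup.mem_map_of_mem _ (φ x).2⟩ : G.toGL M)) := by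
    refine Algebra.adjoin_le ?_
    rintro _ (⟨l, rfl⟩ | ⟨l, rfl⟩)
    · exact isMorphism_iff_dual.1 h l
    · exact isMorphism_iff_dual.1 h' l
  exact this hF

variable [FiniteDimensional ℂ V]

theorem exists_exp_eq (hM : G.IsUnipotentSubgroup M m)
    (hnil : ∀ x ∈ m, IsNilpotent (G.lieMap x)) (x : m) :
    ∃ u : M, ((u : G.carrier) : LinearMap.GeneralLinearGroup ℂ V) =
      expGL (G.lieMap x) (hnil x x.2) := by
  have h : expGL (G.lieMap x) (hnil x x.2) ∈ G.toGL M :=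
    expGL_mem hM.closed (hM.lie ▸ ⟨x, x.2, rfl⟩) _
  obtain ⟨u, hu, hu'⟩ := h
  exact ⟨⟨u, hu⟩, hu'⟩

theorem exists_eq_exp (hM : G.IsUnipotentSubgroup M m) (u : M) :
    ∃ x : m, nilLog ((u : G.carrier) : LinearMap.GeneralLinearGroup ℂ V).val = G.lieMap x := by
  have h := nilLog_mem_tangentSpace (H := G.toGL M) (Subgroup.mem_map_of_mem _ u.2)
    (hM.unipotent u u.2)
  rw [hM.lie] at h
  obtain ⟨x, hx, hx'⟩ := h
  exact ⟨⟨x, hx⟩, hx'.symm⟩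

/-- The exponential parametrization of a connected unipotent subgroup by its Lie algebra. -/
def expEquiv (hM : G.IsUnipotentSubgroup M m) (hnil : ∀ x ∈ m, IsNilpotent (G.lieMap x)) :
    m ≃ M where
  toFun x := (exists_exp_eq hM hnil x).choose
  invFun u := (exists_eq_exp hM u).choose
  left_inv x := by
    apply Subtype.ext
    apply G.lieMap_injective
    rw [← (exists_eq_exp hM _).choose_spec, (exists_exp_eq hM hnil x).choose_spec, expGL_val,
      nilLog_nilExp (hnil x x.2)]
  right_inv u := by
    apply Subtype.ext
    apply Subtype.ext
    apply Units.ext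
    rw [(exists_exp_eq hM hnil _).choose_spec, expGL_val, ← (exists_eq_exp hM _).choose_spec,
      nilExp_nilLog (hM.unipotent u u.2)]

variable (hM : G.IsUnipotentSubgroup M m) (hnil : ∀ x ∈ m, IsNilpotent (G.lieMap x))

theorem coe_expEquiv (x : m) : ((expEquiv hM hnil x : G.carrier) :
    LinearMap.GeneralLinearGroup ℂ V) = expGL (G.lieMap x) (hnil x x.2) :=
  (exists_exp_eq hM hnil x).choose_spec

theorem isMorphism_expEquiv : IsMorphism (polyFun m) (G.regSubgroup M) (expEquiv hM hnil) := by
  have h : IsMorphism (polyFun m) (polyFun (End ℂ V)) (fun x : m => G.lieMap (x : g)) :=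
    isMorphism_linear (G.lieMap ∘ₗ (m.incl : m →ₗ[ℂ] g))
  apply isMorphism_to_subgroup
  · simp only [coe_expEquiv]
    exact h.nilExp
  · simp only [coe_expEquiv]
    exact h.neg.nilExp

variable [FiniteDimensional ℂ g]

theorem Ad_expEquiv (x : m) (y : g) :
    G.Ad (expEquiv hM hnil x) y = nilExp (LieAlgebra.ad ℂ g (x : g)) y := by
  apply G.lieMap_injective
  have hx := hnil x x.2
  rw [lieMap_Ad, coe_expEquiv, ← nilExp_intertwine (G.isNilpotent_ad_of_lieMap hx) ?_ G.lieMap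
    (G.lieMap_ad x) y, nilExp_conj hx]
  · rfl
  · exact (LinearMap.commute_mulLeft_right _ _).isNilpotent_add (isNilpotent_mulLeft hx)
      (isNilpotent_mulRight hx.neg)

theorem Ad_expEquiv_inv (x : m) (y : g) :
    G.Ad (expEquiv hM hnil x : G.carrier)⁻¹ y = nilExp (-LieAlgebra.ad ℂ g (x : g)) y := by
  have hx := G.isNilpotent_ad_of_lieMap (hnil x x.2)
  have h : G.Ad (expEquiv hM hnil x) (nilExp (-LieAlgebra.ad ℂ g (x : g)) y) = y := by
    rw [Ad_expEquiv, ← Module.End.mul_apply, nilExp_mul_nilExp_neg hx, Module.End.one_apply]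
  rw [← h, ← Module.End.mul_apply, ← map_mul, inv_mul_cancel, map_one, h, Module.End.one_apply]

theorem coAd_expEquiv_apply (x : m) (ξ : Dual ℂ g) (y : g) :
    G.coAd (expEquiv hM hnil x) ξ y = ξ (nilExp (-LieAlgebra.ad ℂ g (x : g)) y) := by
  rw [← Ad_expEquiv_inv hM hnil]
  rfl

/-- `Ad(u⁻¹) y` is recovered from the matrix `u⁻¹ Y u` by a linear left inverse of `lieMap`, hence
is regular in `u`. -/
theorem isMorphism_coAd (M : Subgroup G.carrier) :
    IsMorphism (regProd (G.regSubgroup M) (polyFun (Dual ℂ g))) (polyFun (Dual ℂ g))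
      (fun z : M × Dual ℂ g => G.coAd (z.1 : G.carrier) z.2) := by
  refine isMorphism_iff_dual.2 fun l => ?_
  obtain ⟨y, rfl⟩ := (evalEquiv ℂ g).surjective l
  obtain ⟨π, hπ⟩ := G.lieMap.exists_leftInverse_of_injective
    (LinearMap.ker_eq_bot.2 G.lieMap_injective)
  have h1 : IsMorphism (G.regSubgroup M) (polyFun g) (fun u : M => G.Ad (u : G.carrier)⁻¹ y) := by
    have := (((regular_coord_inv M).mul (isMorphism_const (G.lieMap y))).mul
      (regular_coord M)).linear π
    convert this using 2 with u
    have h2 := G.lieMap_Ad (u : G.carrier)⁻¹ y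
    have h3 := LinearMap.congr_fun hπ (G.Ad (u : G.carrier)⁻¹ y)
    simp only [LinearMap.comp_apply, h2, LinearMap.id_apply] at h3
    rw [← h3]
    simp
  have h2 := (isMorphism_snd (A := G.regSubgroup M) (B := polyFun (Dual ℂ g))).bilinear
    LinearMap.id (h1.comp isMorphism_fst)
  exact isMorphism_iff_dual.1 h2 LinearMap.id

end ConnectedAlgebraicGroup

/-! ### Graded spaces, filtrations and graded subspaces. -/

section Filtration

variable {E E' E'' : Type*} [AddCommGroup E] [Module ℂ E] [AddCommGroup E'] [Module ℂ E']
  [AddCommGroup E''] [Module ℂ E'']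

/-- The decreasing filtration attached to a `ℤ`-indexed family of subspaces. -/
def filt (Γ : ℤ → Submodule ℂ E) (d : ℤ) : Submodule ℂ E := ⨆ i : {i : ℤ // d ≤ i}, Γ i

variable {Γ : ℤ → Submodule ℂ E} {Γ' : ℤ → Submodule ℂ E'} {Γ'' : ℤ → Submodule ℂ E''}

theorem le_filt {d j : ℤ} (h : d ≤ j) : Γ j ≤ filt Γ d :=
  le_iSup (fun i : {i : ℤ // d ≤ i} => Γ i) ⟨j, h⟩

theorem filt_le {d : ℤ} {p : Submodule ℂ E} (h : ∀ j, d ≤ j → Γ j ≤ p) : filt Γ d ≤ p :=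
  iSup_le fun i => h i i.2

theorem filt_antitone {d d' : ℤ} (h : d ≤ d') : filt Γ d' ≤ filt Γ d :=
  filt_le fun _ hj => le_filt (h.trans hj)

theorem map_mem_filt {T : E →ₗ[ℂ] E'} {i : ℤ} (hT : ∀ j, ∀ x ∈ Γ j, T x ∈ Γ' (i + j)) {d : ℤ}
    {x : E} (hx : x ∈ filt Γ d) : T x ∈ filt Γ' (i + d) := by
  have : filt Γ d ≤ (filt Γ' (i + d)).comap T :=
    filt_le fun j hj y hy => le_filt (by omega) (hT j y hy)
  exact this hx

theorem bilinear_mem_filt {T : E →ₗ[ℂ] E' →ₗ[ℂ] E''}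
    (hT : ∀ i j, ∀ x ∈ Γ i, ∀ y ∈ Γ' j, T x y ∈ Γ'' (i + j)) {a b : ℤ} {x : E} {y : E'}
    (hx : x ∈ filt Γ a) (hy : y ∈ filt Γ' b) : T x y ∈ filt Γ'' (a + b) := by
  have : filt Γ a ≤ (filt Γ'' (a + b)).comap (T.flip y) := by
    refine filt_le fun i hi x hx => ?_
    exact filt_antitone (by omega) (map_mem_filt (T := T x) (fun j y hy => hT i j x hx y hy) hy)
  exact this hx

theorem exists_filt_eq_bot [FiniteDimensional ℂ E] (h : iSupIndep Γ) :
    ∃ n : ℕ, filt Γ n = ⊥ := by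
  have hfin := WellFoundedGT.finite_ne_bot_of_iSupIndep h
  obtain ⟨b, hb⟩ := hfin.bddAbove
  refine ⟨(b + 1).toNat, ?_⟩
  rw [eq_bot_iff]
  refine filt_le fun j hj => ?_
  by_contra hne
  have := hb (show Γ j ≠ ⊥ from fun h0 => hne h0.le)
  omega

/-- The commutator with `Q` gives `End W` independent integer eigenspaces, only finitely many of
them nonzero, and powers of `ρ x` climb through their filtration. Since only independence is needed,
`Q` need not be diagonalizable on `W`; this makes positive-degree elements nilpotent in any
representation. -/
theorem isNilpotent_of_mem_filt {W : Type*} [AddCommGroup W] [Module ℂ W] [FiniteDimensional ℂ W]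
    (ρ : E →ₗ[ℂ] End ℂ W) (Q : End ℂ W)
    (hρ : ∀ j : ℤ, ∀ x ∈ Γ j, Q * ρ x - ρ x * Q = (j : ℂ) • ρ x) {x : E} (hx : x ∈ filt Γ 1) :
    IsNilpotent (ρ x) := by
  let T : End ℂ (End ℂ W) := LinearMap.mulLeft ℂ Q - LinearMap.mulRight ℂ Q
  let Δ : ℤ → Submodule ℂ (End ℂ W) := fun j => T.eigenspace (j : ℂ)
  have hΔ : ∀ j X, X ∈ Δ j ↔ Q * X - X * Q = (j : ℂ) • X := by
    intro j X
    simp [Δ, T]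
  have hind : iSupIndep Δ := T.eigenspaces_iSupIndep.comp Int.cast_injective
  have hmul : ∀ i j, ∀ X ∈ Δ i, ∀ Y ∈ Δ j, LinearMap.mul ℂ (End ℂ W) X Y ∈ Δ (i + j) := by
    intro i j X hX Y hY
    rw [hΔ] at hX hY ⊢
    have : Q * (X * Y) - X * Y * Q = (Q * X - X * Q) * Y + X * (Q * Y - Y * Q) := by noncomm_ring
    rw [LinearMap.mul_apply', this, hX, hY, smul_mul_assoc, mul_smul_comm, ← add_smul]
    push_cast
    rfl
  have hx1 : ρ x ∈ filt Δ 1 := by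
    have := map_mem_filt (Γ' := Δ) (T := ρ) (i := 0) (fun j y hy => by
      rw [zero_add, hΔ]; exact hρ j y hy) hx
    simpa using this
  have hpow : ∀ k : ℕ, ρ x ^ (k + 1) ∈ filt Δ ((k : ℤ) + 1) := by
    intro k
    induction k with
    | zero => simpa using hx1
    | succ k ih =>
      rw [pow_succ]
      push_cast
      exact bilinear_mem_filt hmul ih hx1
  obtain ⟨n, hn⟩ := exists_filt_eq_bot hind
  refine ⟨n + 1, ?_⟩
  have := filt_antitone (show (n : ℤ) ≤ n + 1 by omega) (hpow n)
  rwa [hn, Submodule.mem_bot] at this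

variable (hΓ : DirectSum.IsInternal Γ)

/-- The projection to a homogeneous component. -/
def gproj (j : ℤ) : E →ₗ[ℂ] E :=
  (Γ j).subtype ∘ₗ DirectSum.component ℂ ℤ (fun i => Γ i) j ∘ₗ
    ((LinearEquiv.ofBijective (DirectSum.coeLinearMap Γ) hΓ).symm : E →ₗ[ℂ] _)

theorem gproj_mem (j : ℤ) (x : E) : gproj hΓ j x ∈ Γ j := Subtype.property _

theorem gproj_of_mem {i : ℤ} (j : ℤ) {x : E} (hx : x ∈ Γ i) :
    gproj hΓ j x = if i = j then x else 0 := by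
  have h : (LinearEquiv.ofBijective (DirectSum.coeLinearMap Γ) hΓ).symm x =
      DirectSum.lof ℂ ℤ (fun i => Γ i) i ⟨x, hx⟩ := by
    rw [LinearEquiv.symm_apply_eq]
    exact (DirectSum.coeLinearMap_lof Γ i ⟨x, hx⟩).symm
  simp only [gproj, LinearMap.comp_apply, LinearEquiv.coe_coe, h, DirectSum.component.of]
  split_ifs with hij
  · subst hij
    rfl
  · rfl

theorem gproj_same {j : ℤ} {x : E} (hx : x ∈ Γ j) : gproj hΓ j x = x := by
  simp [gproj_of_mem hΓ j hx]

theorem gproj_of_ne {i j : ℤ} (h : i ≠ j) {x : E} (hx : x ∈ Γ i) : gproj hΓ j x = 0 := by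
  simp [gproj_of_mem hΓ j hx, h]

include hΓ in
/-- Linear maps which agree on the homogeneous components are equal. -/
theorem linearMap_ext_of_homogeneous {S T : E →ₗ[ℂ] E'} (h : ∀ j, ∀ x ∈ Γ j, S x = T x) :
    S = T := by
  have : (⊤ : Submodule ℂ E) ≤ LinearMap.eqLocus S T := by
    rw [← hΓ.submodule_iSup_eq_top]
    exact iSup_le fun j x hx => h j x hx
  exact LinearMap.ext fun x => this trivial

theorem exists_sum_gproj [FiniteDimensional ℂ E] :
    ∃ s : Finset ℤ, ∀ x, ∑ j ∈ s, gproj hΓ j x = x := by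
  have hfin := WellFoundedGT.finite_ne_bot_of_iSupIndep hΓ.submodule_iSupIndep
  refine ⟨hfin.toFinset, fun x => ?_⟩
  have : ∑ j ∈ hfin.toFinset, gproj hΓ j = LinearMap.id := by
    refine linearMap_ext_of_homogeneous hΓ fun i x hx => ?_
    simp only [LinearMap.sum_apply, gproj_of_mem hΓ _ hx, Finset.sum_ite_eq, LinearMap.id_apply,
      Set.Finite.mem_toFinset]
    split_ifs with h
    · rfl
    · have h0 : Γ i = ⊥ := by simpa using h
      rw [h0, Submodule.mem_bot] at hx
      exact hx.symm
  simpa using LinearMap.congr_fun this x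

theorem mem_of_forall_gproj_mem [FiniteDimensional ℂ E] {p : Submodule ℂ E} {x : E}
    (h : ∀ j, gproj hΓ j x ∈ p) : x ∈ p := by
  obtain ⟨s, hs⟩ := exists_sum_gproj hΓ
  rw [← hs x]
  exact p.sum_mem fun j _ => h j

theorem gproj_eq_zero_of_mem_filt {d j : ℤ} (hj : j < d) {x : E} (hx : x ∈ filt Γ d) :
    gproj hΓ j x = 0 := by
  have : filt Γ d ≤ LinearMap.ker (gproj hΓ j) :=
    filt_le fun i hi y hy => gproj_of_ne hΓ (by omega) hy
  exact this hx

theorem mem_filt_of_gproj_eq_zero [FiniteDimensional ℂ E] {d : ℤ} {x : E}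
    (h : ∀ j < d, gproj hΓ j x = 0) : x ∈ filt Γ d := by
  refine mem_of_forall_gproj_mem hΓ fun j => ?_
  rcases lt_or_ge j d with hj | hj
  · rw [h j hj]
    exact zero_mem _
  · exact le_filt hj (gproj_mem hΓ j x)

/-- Graded subspaces. -/
def IsHomogeneousSub (p : Submodule ℂ E) : Prop := ∀ j, ∀ x ∈ p, gproj hΓ j x ∈ p

theorem isHomogeneousSub_filt (d : ℤ) : IsHomogeneousSub hΓ (filt Γ d) := by
  intro j x hx
  rcases lt_or_ge j d with hj | hj
  · rw [gproj_eq_zero_of_mem_filt hΓ hj hx]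
    exact zero_mem _
  · exact le_filt hj (gproj_mem hΓ j x)

theorem IsHomogeneousSub.inf {p p' : Submodule ℂ E} (hp : IsHomogeneousSub hΓ p)
    (hp' : IsHomogeneousSub hΓ p') : IsHomogeneousSub hΓ (p ⊓ p') :=
  fun j x hx => ⟨hp j x hx.1, hp' j x hx.2⟩

theorem IsHomogeneousSub.sup {p p' : Submodule ℂ E} (hp : IsHomogeneousSub hΓ p)
    (hp' : IsHomogeneousSub hΓ p') : IsHomogeneousSub hΓ (p ⊔ p') := by
  intro j x hx
  obtain ⟨y, hy, z, hz, rfl⟩ := Submodule.mem_sup.1 hx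
  rw [map_add]
  exact Submodule.add_mem_sup (hp j y hy) (hp' j z hz)

theorem isHomogeneousSub_of_le {i : ℤ} {p : Submodule ℂ E} (hp : p ≤ Γ i) :
    IsHomogeneousSub hΓ p := by
  intro j x hx
  rw [gproj_of_mem hΓ j (hp hx)]
  split_ifs
  · exact hx
  · exact zero_mem _

theorem isHomogeneousSub_bot : IsHomogeneousSub hΓ (⊥ : Submodule ℂ E) := by
  intro j x hx
  rw [Submodule.mem_bot] at hx
  simp [hx]

theorem gproj_map {Γ' : ℤ → Submodule ℂ E'} (hΓ' : DirectSum.IsInternal Γ') (T : E →ₗ[ℂ] E')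
    {i : ℤ} (hT : ∀ j, ∀ x ∈ Γ j, T x ∈ Γ' (i + j)) (j : ℤ) (x : E) :
    gproj hΓ' (i + j) (T x) = T (gproj hΓ j x) := by
  have : gproj hΓ' (i + j) ∘ₗ T = T ∘ₗ gproj hΓ j := by
    refine linearMap_ext_of_homogeneous hΓ fun k x hx => ?_
    simp only [LinearMap.comp_apply, gproj_of_mem hΓ j hx, gproj_of_mem hΓ' _ (hT k x hx),
      add_right_inj]
    split_ifs <;> simp
  exact LinearMap.congr_fun this x

/-- A subspace that is stable under an operator acting on the components by distinct scalars is
graded. -/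
theorem isHomogeneousSub_of_stable [FiniteDimensional ℂ E] (T : End ℂ E)
    (hT : ∀ j : ℤ, ∀ x ∈ Γ j, T x = (j : ℂ) • x) {p : Submodule ℂ E} (hp : ∀ x ∈ p, T x ∈ p) :
    IsHomogeneousSub hΓ p := by
  classical
  intro j
  have hfin := WellFoundedGT.finite_ne_bot_of_iSupIndep hΓ.submodule_iSupIndep
  -- The index `j` is inserted even when its component is zero, so that the interpolation polynomial
  -- is `1` at `j` and `0` at every other occurring degree: the projection is then a polynomial in
  -- `T`.
  set s : Finset ℤ := insert j hfin.toFinset with hs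
  let P : Polynomial ℂ := Lagrange.basis s (fun i : ℤ => (i : ℂ)) j
  have hinj : Set.InjOn (fun i : ℤ => (i : ℂ)) s := Int.cast_injective.injOn
  have haev : ∀ (R : Polynomial ℂ) (i : ℤ) (x : E), x ∈ Γ i →
      Polynomial.aeval T R x = R.eval (i : ℂ) • x := by
    intro R i x hx
    by_cases h0 : x = 0
    · simp [h0]
    · exact Module.End.aeval_apply_of_hasEigenvector
        ⟨Module.End.mem_eigenspace_iff.2 (hT i x hx), h0⟩
  have hP : gproj hΓ j = Polynomial.aeval T P := by
    refine linearMap_ext_of_homogeneous hΓ fun i x hx => ?_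
    rw [gproj_of_mem hΓ j hx, haev P i x hx]
    split_ifs with hij
    · subst hij
      simp only [P]
      rw [Lagrange.eval_basis_self hinj (Finset.mem_insert_self _ _), one_smul]
    · by_cases his : i ∈ s
      · simp only [P]
        rw [Lagrange.eval_basis_of_ne (Ne.symm hij) his, zero_smul]
      · have h0 : Γ i = ⊥ := by
          by_contra h
          exact his (Finset.mem_insert_of_mem (hfin.mem_toFinset.2 h))
        rw [h0, Submodule.mem_bot] at hx
        simp [hx]
  rw [hP]
  intro x hx
  induction P using Polynomial.induction_on' with
  | add R R' h h' => simpa using p.add_mem h h'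
  | monomial n a =>
    rw [Polynomial.aeval_monomial, ← Algebra.smul_def, LinearMap.smul_apply]
    refine p.smul_mem a ?_
    clear hP
    induction n with
    | zero => exact hx
    | succ n ih =>
      rw [pow_succ']
      exact hp _ ih

/-- Graded subspaces have graded complements. -/
theorem exists_isCompl_homogeneous [FiniteDimensional ℂ E] {p : Submodule ℂ E}
    (hp : IsHomogeneousSub hΓ p) : ∃ C, IsHomogeneousSub hΓ C ∧ IsCompl p C := by
  obtain ⟨s, hs⟩ := exists_sum_gproj hΓ
  obtain ⟨π, hπ⟩ := p.subtype.exists_leftInverse_of_injective (by simp)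
  have hπ' : ∀ x ∈ p, (π x : E) = x := fun x hx =>
    congrArg Subtype.val (LinearMap.congr_fun hπ ⟨x, hx⟩)
  -- The degree-preserving part of an arbitrary projection onto `p`: still a projection onto `p`,
  -- but commuting with the grading, so that its kernel is graded.
  let σ : E →ₗ[ℂ] E := ∑ j ∈ s, gproj hΓ j ∘ₗ p.subtype ∘ₗ π ∘ₗ gproj hΓ j
  have hσ : ∀ x, σ x = ∑ j ∈ s, gproj hΓ j (π (gproj hΓ j x)) := fun x => by
    simp [σ, LinearMap.sum_apply]
  have hσp : ∀ x, σ x ∈ p := fun x => by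
    rw [hσ]
    exact p.sum_mem fun j _ => hp j _ (Subtype.property _)
  have hσid : ∀ x ∈ p, σ x = x := fun x hx => by
    rw [hσ]
    conv_rhs => rw [← hs x]
    refine Finset.sum_congr rfl fun j _ => ?_
    rw [hπ' _ (hp j x hx), gproj_same hΓ (gproj_mem hΓ j x)]
  have hσg : ∀ k x, σ (gproj hΓ k x) = gproj hΓ k (σ x) := fun k x => by
    rw [hσ, hσ, map_sum]
    refine Finset.sum_congr rfl fun j _ => ?_
    rw [gproj_of_mem hΓ j (gproj_mem hΓ k x), gproj_of_mem hΓ k (gproj_mem hΓ j _)]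
    by_cases hjk : j = k
    · subst hjk
      simp
    · simp [hjk, Ne.symm hjk]
  refine ⟨LinearMap.ker σ, fun j x hx => ?_, ?_⟩
  · rw [LinearMap.mem_ker] at hx ⊢
    rw [hσg, hx, map_zero]
  · rw [isCompl_iff, disjoint_iff, codisjoint_iff]
    constructor
    · rw [eq_bot_iff]
      rintro x ⟨hx, hx'⟩
      rw [Submodule.mem_bot, ← hσid x hx]
      exact hx'
    · rw [eq_top_iff]
      rintro x -
      rw [Submodule.mem_sup]
      refine ⟨σ x, hσp x, x - σ x, ?_, by abel⟩
      rw [LinearMap.mem_ker, map_sub, hσid _ (hσp x), sub_self]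

end Filtration

/-! ### Exponentials modulo a stable subspace. -/

section Exponential

variable {E : Type*} [AddCommGroup E] [Module ℂ E]

/-- Every non-constant term of the series applied to `x` stays in `p`. This carries all later
stability statements from Lie algebras to groups. -/
theorem nilExp_sub_mem {N : End ℂ E} {p : Submodule ℂ E} (hp : ∀ x ∈ p, N x ∈ p) {x : E}
    (hx : N x ∈ p) : nilExp N x - x ∈ p := by
  have hk : ∀ k : ℕ, (N ^ (k + 1)) x ∈ p := by
    intro k
    induction k with
    | zero => simpa using hx
    | succ k ih =>
      rw [pow_succ']
      exact hp _ ih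
  rw [nilExp, Finset.sum_range_succ', LinearMap.add_apply]
  simp only [Nat.factorial_zero, Nat.cast_one, inv_one, pow_zero, one_smul, Module.End.one_apply,
    add_sub_cancel_right, LinearMap.sum_apply, LinearMap.smul_apply]
  exact p.sum_mem fun k _ => p.smul_mem _ (hk k)

end Exponential

/-! ### Leading terms of the adjoint action and its polynomial inversion. -/

section LieFiltration

variable {g : Type*} [LieRing g] [LieAlgebra ℂ g] {Γ : ℤ → Submodule ℂ g}

theorem lie_mem_filt (hlie : ∀ i j, ∀ x ∈ Γ i, ∀ y ∈ Γ j, ⁅x, y⁆ ∈ Γ (i + j)) {a b c : ℤ} {x y : g}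
    (hx : x ∈ filt Γ a) (hy : y ∈ filt Γ b) (hc : c ≤ a + b) : ⁅x, y⁆ ∈ filt Γ c :=
  filt_antitone hc (bilinear_mem_filt (T := (LieAlgebra.ad ℂ g : g →ₗ[ℂ] End ℂ g)) hlie hx hy)

theorem ad_pow_mem_filt (hlie : ∀ i j, ∀ x ∈ Γ i, ∀ y ∈ Γ j, ⁅x, y⁆ ∈ Γ (i + j)) {d : ℤ} {x w : g}
    (hx : x ∈ filt Γ 1) (hw : w ∈ filt Γ d) (k : ℕ) :
    (LieAlgebra.ad ℂ g x ^ k) w ∈ filt Γ (d + k) := by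
  induction k with
  | zero => simpa using hw
  | succ k ih =>
    rw [pow_succ']
    exact lie_mem_filt hlie hx ih (by push_cast; omega)

/-- Telescoping in the outermost factor: changing `x` costs `(d + 2) + (-2 + k)`, and the remaining
difference gains `1` from `x'`. The bound exceeds `d` once `k ≥ 2`, so only the terms of order at
most one contribute to the leading part. -/
theorem ad_pow_sub_mem_filt (hlie : ∀ i j, ∀ x ∈ Γ i, ∀ y ∈ Γ j, ⁅x, y⁆ ∈ Γ (i + j)) {d : ℤ}
    {x x' w w' : g} (hx : x ∈ filt Γ 1) (hx' : x' ∈ filt Γ 1) (hxx' : x - x' ∈ filt Γ (d + 2))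
    (hw : w ∈ filt Γ (-2)) (hww' : w - w' ∈ filt Γ d) (k : ℕ) :
    (LieAlgebra.ad ℂ g x ^ k) w - (LieAlgebra.ad ℂ g x' ^ k) w' ∈ filt Γ (d + k - 1) := by
  induction k with
  | zero => exact filt_antitone (by simp) hww'
  | succ k ih =>
    have h : (LieAlgebra.ad ℂ g x ^ (k + 1)) w - (LieAlgebra.ad ℂ g x' ^ (k + 1)) w' =
        ⁅x - x', (LieAlgebra.ad ℂ g x ^ k) w⁆ +
          ⁅x', (LieAlgebra.ad ℂ g x ^ k) w - (LieAlgebra.ad ℂ g x' ^ k) w'⁆ := by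
      rw [pow_succ', pow_succ']
      simp [lie_sub, sub_lie]
    rw [h]
    exact add_mem (lie_mem_filt hlie hxx' (ad_pow_mem_filt hlie hx hw k) (by push_cast; omega))
      (lie_mem_filt hlie hx' ih (by push_cast; omega))

variable [FiniteDimensional ℂ g]

theorem isNilpotent_ad_of_mem_filt {q : g} (hq : IsGradingElement Γ q) {x : g}
    (hx : x ∈ filt Γ 1) : IsNilpotent (LieAlgebra.ad ℂ g x) := by
  refine isNilpotent_of_mem_filt (Γ := Γ) (LieAlgebra.ad ℂ g : g →ₗ[ℂ] End ℂ g)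
    (LieAlgebra.ad ℂ g q) (fun j y hy => ?_) hx
  have h := (hq j y).1 hy
  have h2 : LieAlgebra.ad ℂ g ⁅q, y⁆ = LieAlgebra.ad ℂ g q * LieAlgebra.ad ℂ g y -
      LieAlgebra.ad ℂ g y * LieAlgebra.ad ℂ g q := by
    ext z
    simp
  rw [h, map_smul] at h2
  exact h2.symm

/-- The leading term of the difference of two values of the adjoint action. -/
theorem nilExp_ad_sub_mem_filt (hlie : ∀ i j, ∀ x ∈ Γ i, ∀ y ∈ Γ j, ⁅x, y⁆ ∈ Γ (i + j)) {q : g}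
    (hq : IsGradingElement Γ q) {d : ℤ} {f x x' w w' : g} (hf : f ∈ Γ (-2))
    (hx : x ∈ filt Γ 1) (hx' : x' ∈ filt Γ 1) (hxx' : x - x' ∈ filt Γ (d + 2))
    (hw : w - f ∈ filt Γ (-1)) (hww' : w - w' ∈ filt Γ d) :
    nilExp (LieAlgebra.ad ℂ g x) w - nilExp (LieAlgebra.ad ℂ g x') w' -
      ((w - w') + ⁅x - x', f⁆) ∈ filt Γ (d + 1) := by
  obtain ⟨n, hn⟩ := isNilpotent_ad_of_mem_filt hq hx
  obtain ⟨n', hn'⟩ := isNilpotent_ad_of_mem_filt hq hx'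
  have hw2 : w ∈ filt Γ (-2) := by
    rw [← sub_add_cancel w f]
    exact add_mem (filt_antitone (by omega) hw) (le_filt le_rfl hf)
  rw [nilExp_eq_sum (n := n + n' + 2) (pow_eq_zero_of_le (by omega) hn),
    nilExp_eq_sum (n := n + n' + 2) (pow_eq_zero_of_le (by omega) hn'), LinearMap.sum_apply,
    LinearMap.sum_apply, ← Finset.sum_sub_distrib, Finset.sum_range_succ', Finset.sum_range_succ',
    add_assoc, add_sub_assoc]
  refine add_mem (Submodule.sum_mem _ fun k _ => ?_) ?_
  · rw [LinearMap.smul_apply, LinearMap.smul_apply, ← smul_sub]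
    refine Submodule.smul_mem _ _ (filt_antitone ?_
      (ad_pow_sub_mem_filt hlie hx hx' hxx' hw2 hww' (k + 1 + 1)))
    push_cast
    omega
  -- The terms `k = 0, 1` minus the claimed leading part leave exactly these two brackets.
  · have h : ⁅x - x', w - f⁆ + ⁅x', w - w'⁆ ∈ filt Γ (d + 1) :=
      add_mem (lie_mem_filt hlie hxx' hw (by omega)) (lie_mem_filt hlie hx' hww' (by omega))
    convert h using 1
    simp [lie_sub, sub_lie]
    abel

/-- Let `a`, `b`, `C` be graded subspaces of degrees at least `1`, `1` and `-1`. If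
`(x, y, s) ↦ s + [x, f] + [y, f]` is an isomorphism onto `R`, then
`(x, y, s) ↦ exp (ad x) exp (ad y) (f + s) - f` is a polynomial isomorphism onto `R`. -/
theorem exists_inverse_adjoint_map (hΓ : DirectSum.IsInternal Γ)
    (hlie : ∀ i j, ∀ x ∈ Γ i, ∀ y ∈ Γ j, ⁅x, y⁆ ∈ Γ (i + j)) {q : g}
    (hq : IsGradingElement Γ q) {f : g} (hf : f ∈ Γ (-2)) {a b C R : Submodule ℂ g}
    (ha : a ≤ filt Γ 1) (hb : b ≤ filt Γ 1) (hC : C ≤ filt Γ (-1))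
    (ha' : IsHomogeneousSub hΓ a) (hb' : IsHomogeneousSub hΓ b) (hC' : IsHomogeneousSub hΓ C)
    (hinj : ∀ x ∈ a, ∀ y ∈ b, ∀ s ∈ C, s + ⁅x, f⁆ + ⁅y, f⁆ = 0 → x = 0 ∧ y = 0 ∧ s = 0)
    (hlin : ∀ x ∈ a, ∀ y ∈ b, ∀ s ∈ C, s + ⁅x, f⁆ + ⁅y, f⁆ ∈ R)
    (hsurj : ∀ z ∈ R, ∃ x ∈ a, ∃ y ∈ b, ∃ s ∈ C, s + ⁅x, f⁆ + ⁅y, f⁆ = z)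
    (hmap : ∀ x ∈ a, ∀ y ∈ b, ∀ s ∈ C,
      nilExp (LieAlgebra.ad ℂ g x) (nilExp (LieAlgebra.ad ℂ g y) (f + s)) - f ∈ R) :
    ∃ T : g → a × b × C, IsMorphism (polyFun g) (polyFun (a × b × C)) T ∧
      (∀ z ∈ R, nilExp (LieAlgebra.ad ℂ g (T z).1)
        (nilExp (LieAlgebra.ad ℂ g (T z).2.1) (f + (T z).2.2)) - f = z) ∧
      ∀ v : a × b × C, T (nilExp (LieAlgebra.ad ℂ g v.1)
        (nilExp (LieAlgebra.ad ℂ g v.2.1) (f + v.2.2)) - f) = v := by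
  let Λ : a × b × C →ₗ[ℂ] g :=
    C.subtype ∘ₗ LinearMap.snd ℂ b C ∘ₗ LinearMap.snd ℂ a (b × C)
    - LieAlgebra.ad ℂ g f ∘ₗ a.subtype ∘ₗ LinearMap.fst ℂ a (b × C)
    - LieAlgebra.ad ℂ g f ∘ₗ b.subtype ∘ₗ LinearMap.fst ℂ b C ∘ₗ LinearMap.snd ℂ a (b × C)
  have hΛ : ∀ v : a × b × C, Λ v = (v.2.2 : g) + ⁅(v.1 : g), f⁆ + ⁅(v.2.1 : g), f⁆ := by
    intro v
    simp only [Λ, LinearMap.sub_apply, LinearMap.comp_apply, LinearMap.fst_apply,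
      LinearMap.snd_apply, Submodule.subtype_apply, LieAlgebra.ad_apply]
    rw [← lie_skew f (v.1 : g), ← lie_skew f (v.2.1 : g)]
    abel
  have hΛR : ∀ v, Λ v ∈ R := fun v => by
    rw [hΛ]
    exact hlin _ v.1.2 _ v.2.1.2 _ v.2.2.2
  have hΛinj : ∀ v, Λ v = 0 → v = 0 := by
    intro v hv
    rw [hΛ] at hv
    obtain ⟨h1, h2, h3⟩ := hinj _ v.1.2 _ v.2.1.2 _ v.2.2.2 hv
    exact Prod.ext (Subtype.ext h1) (Prod.ext (Subtype.ext h2) (Subtype.ext h3))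
  let L : (a × b × C) ≃ₗ[ℂ] R := LinearEquiv.ofBijective (Λ.codRestrict R hΛR) (by
    constructor
    · rw [← LinearMap.ker_eq_bot, LinearMap.ker_eq_bot']
      intro v hv
      exact hΛinj v (congrArg Subtype.val hv)
    · rintro ⟨z, hz⟩
      obtain ⟨x, hx, y, hy, s, hs, rfl⟩ := hsurj z hz
      exact ⟨(⟨x, hx⟩, ⟨y, hy⟩, ⟨s, hs⟩), Subtype.ext (hΛ _)⟩)
  have hL : ∀ v, (L v : g) = Λ v := fun v => rfl
  let Θ : a × b × C → g := fun v => nilExp (LieAlgebra.ad ℂ g v.1)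
    (nilExp (LieAlgebra.ad ℂ g v.2.1) (f + v.2.2)) - f
  have hΘ : ∀ v, Θ v ∈ R := fun v => hmap _ v.1.2 _ v.2.1.2 _ v.2.2.2
  -- The shift by two between the first two factors and the last compensates the degree `-2` of `f`:
  -- the map `Λ` sends `W k` into degrees at least `k - 1`.
  let W : ℕ → Submodule ℂ (a × b × C) := fun k =>
    ((filt Γ ((k : ℤ) + 1)).comap a.subtype).prod
      (((filt Γ ((k : ℤ) + 1)).comap b.subtype).prod ((filt Γ ((k : ℤ) - 1)).comap C.subtype))
  have hW : ∀ k v, v ∈ W k ↔ (v.1 : g) ∈ filt Γ ((k : ℤ) + 1) ∧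
      (v.2.1 : g) ∈ filt Γ ((k : ℤ) + 1) ∧ (v.2.2 : g) ∈ filt Γ ((k : ℤ) - 1) := by
    intro k v
    simp [W, Submodule.mem_prod]
  have hW0 : W 0 = ⊤ := by
    rw [eq_top_iff]
    intro v _
    rw [hW]
    exact ⟨by simpa using ha v.1.2, by simpa using hb v.2.1.2, by simpa using hC v.2.2.2⟩
  obtain ⟨n, hn⟩ := exists_filt_eq_bot hΓ.submodule_iSupIndep
  have hWn : W (n + 1) = ⊥ := by
    rw [eq_bot_iff]
    intro v hv
    rw [hW] at hv
    push_cast at hv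
    have hle : ∀ d : ℤ, (n : ℤ) ≤ d → filt Γ d = ⊥ := fun d hd =>
      eq_bot_iff.2 (hn ▸ filt_antitone hd)
    rw [hle _ (by omega), hle _ (by omega)] at hv
    simp only [Submodule.mem_bot, ZeroMemClass.coe_eq_zero] at hv
    exact Prod.ext hv.1 (Prod.ext hv.2.1 hv.2.2)
  -- `Λ` is strictly compatible with filtrations: each homogeneous component of `Λ v` involves
  -- single components of `x`, `y`, `s`, lying in the graded subspaces, so injectivity applies
  -- degree by degree.
  have hΛW : ∀ (k : ℕ) v, Λ v ∈ filt Γ k → v ∈ W (k + 1) := by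
    intro k v hv
    rw [hW]
    push_cast
    have key : ∀ j : ℤ, j < k → gproj hΓ (j + 2) (v.1 : g) = 0 ∧
        gproj hΓ (j + 2) (v.2.1 : g) = 0 ∧ gproj hΓ j (v.2.2 : g) = 0 := by
      intro j hj
      have h0 := gproj_eq_zero_of_mem_filt hΓ hj hv
      have hc : ∀ x : g, gproj hΓ j ⁅x, f⁆ = ⁅gproj hΓ (j + 2) x, f⁆ := by
        intro x
        have := gproj_map hΓ hΓ (LieAlgebra.ad ℂ g f) (i := -2) (fun j x hx => hlie _ _ f hf x hx)
          (j + 2) x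
        rw [show -2 + (j + 2) = j by omega] at this
        rw [← lie_skew x f, map_neg, ← lie_skew _ f]
        exact congrArg Neg.neg this
      rw [hΛ, map_add, map_add, hc, hc] at h0
      exact hinj _ (ha' _ _ v.1.2) _ (hb' _ _ v.2.1.2) _ (hC' _ _ v.2.2.2) h0
    refine ⟨mem_filt_of_gproj_eq_zero hΓ fun j hj => ?_,
      mem_filt_of_gproj_eq_zero hΓ fun j hj => ?_, mem_filt_of_gproj_eq_zero hΓ fun j hj => ?_⟩
    · simpa using (key (j - 2) (by omega)).1
    · simpa using (key (j - 2) (by omega)).2.1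
    · exact (key j (by omega)).2.2
  have hΘpoly : IsMorphism (polyFun (a × b × C)) (polyFun g) Θ := by
    have h1 : IsMorphism (polyFun (a × b × C)) (polyFun g) (fun v => (v.1 : g)) :=
      isMorphism_linear (a.subtype ∘ₗ LinearMap.fst ℂ a (b × C))
    have h2 : IsMorphism (polyFun (a × b × C)) (polyFun g) (fun v => (v.2.1 : g)) :=
      isMorphism_linear (b.subtype ∘ₗ LinearMap.fst ℂ b C ∘ₗ LinearMap.snd ℂ a (b × C))
    have h3 : IsMorphism (polyFun (a × b × C)) (polyFun g) (fun v => (v.2.2 : g)) :=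
      isMorphism_linear (C.subtype ∘ₗ LinearMap.snd ℂ b C ∘ₗ LinearMap.snd ℂ a (b × C))
    exact ((h1.linear (LieAlgebra.ad ℂ g : g →ₗ[ℂ] End ℂ g)).nilExp.apply
      ((h2.linear (LieAlgebra.ad ℂ g : g →ₗ[ℂ] End ℂ g)).nilExp.apply
        ((isMorphism_const f).add h3))).sub (isMorphism_const f)
  -- `L⁻¹ ∘ Θ` is the identity plus `N`; the claim is that `N` raises the filtration.
  let N : a × b × C → a × b × C := fun v => L.symm ⟨Θ v, hΘ v⟩ - v
  have hN : IsMorphism (polyFun (a × b × C)) (polyFun (a × b × C)) N :=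
    ((hΘpoly.codRestrict R hΘ).linear (L.symm : R →ₗ[ℂ] a × b × C)).sub isMorphism_id
  have htri : ∀ k v v', v - v' ∈ W k → N v - N v' ∈ W (k + 1) := by
    intro k v v' hvv
    apply hΛW
    have h1 : Λ (N v - N v') = Θ v - Θ v' - Λ (v - v') := by
      rw [map_sub, ← hL, ← hL]
      simp only [N, map_sub, LinearEquiv.apply_symm_apply, Submodule.coe_sub, hL]
      abel
    rw [h1]
    rw [hW] at hvv
    obtain ⟨hv1, hv2, hv3⟩ := hvv
    have hk : (k : ℤ) = ((k : ℤ) - 1) + 1 := by omega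
    have hk2 : (k : ℤ) + 1 = ((k : ℤ) - 1) + 2 := by omega
    rw [hk2] at hv1 hv2
    have hsC : ∀ u : a × b × C, (f + (u.2.2 : g)) - f ∈ filt Γ (-1) := fun u => by
      simpa using hC u.2.2.2
    have hs : (f + (v.2.2 : g)) - (f + v'.2.2) ∈ filt Γ ((k : ℤ) - 1) := by simpa using hv3
    have hfw : f + (v.2.2 : g) ∈ filt Γ (-2) :=
      add_mem (le_filt le_rfl hf) (filt_antitone (by omega) (hC v.2.2.2))
    -- The leading-term estimate is used twice, for the inner exponential and then the outer one;
    -- the sum of the two leading parts is `Λ (v - v')`.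
    have e1 := nilExp_ad_sub_mem_filt hlie hq hf (hb v.2.1.2) (hb v'.2.1.2) hv2 (hsC v) hs
    set w := nilExp (LieAlgebra.ad ℂ g (v.2.1 : g)) (f + v.2.2)
    set w' := nilExp (LieAlgebra.ad ℂ g (v'.2.1 : g)) (f + v'.2.2)
    have hw : w - f ∈ filt Γ (-1) := by
      have h2 : w - (f + v.2.2) ∈ filt Γ (-1) :=
        nilExp_sub_mem (p := filt Γ (-1))
          (fun y hy => lie_mem_filt hlie (hb v.2.1.2) hy (by omega))
          (lie_mem_filt hlie (hb v.2.1.2) hfw (by omega))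
      have := add_mem h2 (hC v.2.2.2)
      convert this using 1
      abel
    have hww : w - w' ∈ filt Γ ((k : ℤ) - 1) := by
      have h3 : (f + (v.2.2 : g)) - (f + v'.2.2) + ⁅(v.2.1 : g) - v'.2.1, f⁆ ∈
          filt Γ ((k : ℤ) - 1) :=
        add_mem hs (lie_mem_filt hlie hv2 (le_filt le_rfl hf) (by omega))
      simpa using add_mem (filt_antitone (by omega) e1) h3
    have e2 := nilExp_ad_sub_mem_filt hlie hq hf (ha v.1.2) (ha v'.1.2) hv1 hw hww
    rw [← hk] at e1 e2
    convert add_mem e1 e2 using 1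
    rw [hΛ]
    simp only [Θ, Prod.fst_sub, Prod.snd_sub, Submodule.coe_sub, w, w']
    abel
  obtain ⟨I, hI, hI1, hI2⟩ := exists_inverse_of_triangular W hW0 hWn N hN htri
  obtain ⟨π, hπ⟩ := R.subtype.exists_leftInverse_of_injective (by simp)
  have hπ' : ∀ z (hz : z ∈ R), π z = ⟨z, hz⟩ := fun z hz => LinearMap.congr_fun hπ ⟨z, hz⟩
  have hsum : ∀ v, v + N v = L.symm ⟨Θ v, hΘ v⟩ := fun v => by simp [N]
  refine ⟨fun z => I (L.symm (π z)), hI.comp (isMorphism_linear (L.symm.toLinearMap ∘ₗ π)),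
    fun z hz => ?_, fun v => ?_⟩
  · have := hI2 (L.symm (π z))
    rw [hsum, hπ' z hz] at this
    have h2 := L.symm.injective this
    change Θ (I (L.symm (π z))) = z
    rw [hπ' z hz]
    exact congrArg Subtype.val h2
  · have := hI1 v
    rw [hsum] at this
    change I (L.symm (π (Θ v))) = v
    rw [hπ' _ (hΘ v)]
    exact this

end LieFiltration

/-! ### Invariant forms and gradings. -/

section InvariantForm

variable {g : Type*} [LieRing g] [LieAlgebra ℂ g] {B : LinearMap.BilinForm ℂ g}

theorem form_lie_left (hBinv : B.lieInvariant g) (x y z : g) : B ⁅x, y⁆ z = B x ⁅y, z⁆ := by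
  rw [← lie_skew, map_neg, LinearMap.neg_apply, hBinv, neg_neg]

variable (B) in
/-- The orthogonal of a subspace for an invariant form. -/
def perp (a : Submodule ℂ g) : Submodule ℂ g := a.dualAnnihilator.comap B

theorem mem_perp {a : Submodule ℂ g} {z : g} : z ∈ perp B a ↔ ∀ x ∈ a, B z x = 0 := by
  simp [perp, Submodule.mem_dualAnnihilator]

variable {Γ : ℤ → Submodule ℂ g} {q : g}

/-- Invariance under `q` gives `(i + j) B(x, y) = 0`. -/
theorem form_eq_zero_of_mem (hBinv : B.lieInvariant g) (hq : IsGradingElement Γ q) {i j : ℤ}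
    (hij : i + j ≠ 0) {x y : g} (hx : x ∈ Γ i) (hy : y ∈ Γ j) : B x y = 0 := by
  have h := hBinv q x y
  rw [(hq i x).1 hx, (hq j y).1 hy, map_smul, map_smul, LinearMap.smul_apply, smul_eq_mul,
    smul_eq_mul, eq_neg_iff_add_eq_zero, ← add_mul] at h
  refine (mul_eq_zero.1 h).resolve_left ?_
  exact_mod_cast hij

theorem form_eq_zero_of_mem_filt (hBinv : B.lieInvariant g) (hq : IsGradingElement Γ q) {i d : ℤ}
    (hid : 0 < i + d) {x y : g} (hx : x ∈ Γ i) (hy : y ∈ filt Γ d) : B x y = 0 := by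
  have : filt Γ d ≤ LinearMap.ker (B x) :=
    filt_le fun j hj y hy => form_eq_zero_of_mem hBinv hq (by omega) hx hy
  exact this hy

theorem form_gproj (hBinv : B.lieInvariant g) (hq : IsGradingElement Γ q)
    (hΓ : DirectSum.IsInternal Γ) (j : ℤ) (x y : g) :
    B (gproj hΓ j x) y = B x (gproj hΓ (-j) y) := by
  have : B ∘ₗ gproj hΓ j = B.compl₂ (gproj hΓ (-j)) := by
    refine linearMap_ext_of_homogeneous hΓ fun i x hx => ?_
    refine linearMap_ext_of_homogeneous hΓ fun k y hy => ?_
    simp only [LinearMap.comp_apply, LinearMap.compl₂_apply, gproj_of_mem hΓ _ hx,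
      gproj_of_mem hΓ _ hy]
    split_ifs with h1 h2 h2
    · rfl
    · rw [map_zero]
      exact form_eq_zero_of_mem hBinv hq (by omega) hx hy
    · rw [map_zero, LinearMap.zero_apply]
      exact (form_eq_zero_of_mem hBinv hq (by omega) hx hy).symm
    · simp
  exact LinearMap.congr_fun (LinearMap.congr_fun this x) y

theorem isHomogeneousSub_perp (hBinv : B.lieInvariant g) (hq : IsGradingElement Γ q)
    (hΓ : DirectSum.IsInternal Γ) {a : Submodule ℂ g} (ha : IsHomogeneousSub hΓ a) :
    IsHomogeneousSub hΓ (perp B a) := by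
  intro j x hx
  rw [mem_perp] at hx ⊢
  intro y hy
  rw [form_gproj hBinv hq]
  exact hx _ (ha _ _ hy)

end InvariantForm

/-! ### Good algebras and the `sl₂`-theory of good gradings. -/

section GoodAlgebras

variable {g : Type*} [LieRing g] [LieAlgebra ℂ g] {B : LinearMap.BilinForm ℂ g}
variable {Γ : ℤ → Submodule ℂ g} {f q : g} {m : LieSubalgebra ℂ g}

theorem IsGoodAlgebra.le_filt_one {χ : Dual ℂ g} (hm : IsGoodAlgebra Γ χ m) :
    m.toSubmodule ≤ filt Γ 1 := by
  obtain ⟨l, hl, hm⟩ := hm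
  rw [hm]
  refine sup_le (fun x hx => le_filt le_rfl ((hl x).1 hx).1) (filt_antitone (by omega))

theorem IsGoodAlgebra.filt_two_le {χ : Dual ℂ g} (hm : IsGoodAlgebra Γ χ m) :
    filt Γ 2 ≤ m.toSubmodule := by
  obtain ⟨l, hl, hm⟩ := hm
  rw [hm]
  exact le_sup_right

theorem IsGoodAlgebra.isHomogeneousSub {χ : Dual ℂ g} (hm : IsGoodAlgebra Γ χ m)
    (hΓ : DirectSum.IsInternal Γ) : IsHomogeneousSub hΓ m.toSubmodule := by
  obtain ⟨l, hl, hm⟩ := hm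
  rw [hm]
  exact IsHomogeneousSub.sup hΓ (isHomogeneousSub_of_le hΓ fun x hx => ((hl x).1 hx).1)
    (isHomogeneousSub_filt hΓ 2)

/-- The form `χ` is a character of a good algebra. -/
theorem IsGoodAlgebra.form_lie_eq_zero (hm : IsGoodAlgebra Γ (B f) m) (hBinv : B.lieInvariant g)
    (hq : IsGradingElement Γ q) (hΓ : IsGoodGrading Γ f) {x y : g} (hx : x ∈ m) (hy : y ∈ m) :
    B f ⁅x, y⁆ = 0 := by
  have hx1 := hm.le_filt_one hx
  obtain ⟨l, hl, hm'⟩ := hm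
  rw [← LieSubalgebra.mem_toSubmodule, hm'] at hx hy
  obtain ⟨u, hu, v, hv, rfl⟩ := Submodule.mem_sup.1 hx
  obtain ⟨u', hu', v', hv', rfl⟩ := Submodule.mem_sup.1 hy
  have hv2 : v ∈ filt Γ 2 := hv
  have hv2' : v' ∈ filt Γ 2 := hv'
  have hu1 := ((hl u').1 hu').1
  rw [lie_add, map_add, add_lie, map_add, ((hl u).1 hu).2 u' hu',
    form_eq_zero_of_mem_filt hBinv hq (d := 3) (by omega) hΓ.mem
      (lie_mem_filt hΓ.lie_mem hv2 (le_filt le_rfl hu1) (by omega)),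
    form_eq_zero_of_mem_filt hBinv hq (d := 3) (by omega) hΓ.mem
      (lie_mem_filt hΓ.lie_mem hx1 hv2' (by omega))]
  simp

theorem lie_mem_perp_of_mem (hBinv : B.lieInvariant g) {x z : g} (hx : x ∈ m)
    (hz : z ∈ perp B m.toSubmodule) : ⁅x, z⁆ ∈ perp B m.toSubmodule := by
  rw [mem_perp] at hz ⊢
  intro y hy
  rw [hBinv, hz _ (m.lie_mem hx hy), neg_zero]

theorem IsGoodAlgebra.lie_mem_perp (hm : IsGoodAlgebra Γ (B f) m) (hBinv : B.lieInvariant g)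
    (hq : IsGradingElement Γ q) (hΓ : IsGoodGrading Γ f) {x : g} (hx : x ∈ m) :
    ⁅x, f⁆ ∈ perp B m.toSubmodule := by
  rw [mem_perp]
  intro y hy
  rw [hBinv, hm.form_lie_eq_zero hBinv hq hΓ hx hy, neg_zero]

/-- The infinitesimal action of `x` moves every point of `f + m^⊥` by an element of `m^⊥`, because
`χ` is a character of `m`; hence so does the exponential. -/
theorem IsGoodAlgebra.nilExp_sub_mem_perp (hm : IsGoodAlgebra Γ (B f) m)
    (hBinv : B.lieInvariant g) (hq : IsGradingElement Γ q) (hΓ : IsGoodGrading Γ f) {x z : g}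
    (hx : x ∈ m) (hz : z - f ∈ perp B m.toSubmodule) :
    nilExp (LieAlgebra.ad ℂ g x) z - f ∈ perp B m.toSubmodule := by
  have h : nilExp (LieAlgebra.ad ℂ g x) z - z ∈ perp B m.toSubmodule := by
    refine nilExp_sub_mem (fun y hy => lie_mem_perp_of_mem hBinv hx hy) ?_
    have := add_mem (lie_mem_perp_of_mem hBinv hx hz) (hm.lie_mem_perp hBinv hq hΓ hx)
    rwa [← lie_add, sub_add_cancel] at this
  simpa using add_mem h hz

variable {e h : g}

theorem IsGradedTriple.isHomogeneousSub_ker (ht : IsGradedTriple Γ e h f)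
    (hΓ : IsGoodGrading Γ f) :
    IsHomogeneousSub hΓ.internal (LinearMap.ker (LieAlgebra.ad ℂ g e)) := by
  intro j x hx
  rw [LinearMap.mem_ker] at hx ⊢
  rw [← gproj_map hΓ.internal hΓ.internal (LieAlgebra.ad ℂ g e) (i := 2)
    (fun j x hx => hΓ.lie_mem _ _ e ht.e_mem x hx), hx, map_zero]

variable [FiniteDimensional ℂ g]

theorem IsGoodGrading.eq_zero_of_lie_eq_zero (hΓ : IsGoodGrading Γ f) {x : g} (hx : x ∈ filt Γ 1)
    (h : ⁅x, f⁆ = 0) : x = 0 := by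
  rw [← Submodule.mem_bot ℂ]
  refine mem_of_forall_gproj_mem hΓ.internal fun j => ?_
  rw [Submodule.mem_bot]
  rcases lt_or_ge j 1 with hj | hj
  · exact gproj_eq_zero_of_mem_filt hΓ.internal hj hx
  · refine hΓ.injective j hj _ (gproj_mem hΓ.internal j x) ?_
    have := gproj_map hΓ.internal hΓ.internal (LieAlgebra.ad ℂ g f) (i := -2)
      (fun j x hx => hΓ.lie_mem _ _ f hΓ.mem x hx) j x
    rw [LieAlgebra.ad_apply, ← lie_skew, h, neg_zero, map_zero] at this
    exact this.symm

/-- `m` contains everything of degree at least `2`, so a component of degree at most `-2` orthogonal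
to `m` is orthogonal to all of `g`. -/
theorem IsGoodAlgebra.perp_le (hm : IsGoodAlgebra Γ (B f) m) (hB : B.Nondegenerate)
    (hBinv : B.lieInvariant g) (hq : IsGradingElement Γ q) (hΓ : DirectSum.IsInternal Γ) :
    perp B m.toSubmodule ≤ filt Γ (-1) := by
  intro z hz
  refine mem_filt_of_gproj_eq_zero hΓ fun j hj => ?_
  refine hB.1 _ fun y => ?_
  rw [form_gproj hBinv hq]
  exact mem_perp.1 hz _ (hm.filt_two_le (le_filt (by omega) (gproj_mem hΓ (-j) y)))

/-- On the parts of positive degree, `ad e ∘ ad f` is injective. -/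
theorem IsGradedTriple.eq_zero_of_lie_lie_eq_zero (ht : IsGradedTriple Γ e h f)
    (hΓ : IsGoodGrading Γ f) {j : ℤ} (hj : 1 ≤ j) {x : g} (hx : x ∈ Γ j)
    (hef : ⁅e, ⁅f, x⁆⁆ = 0) : x = 0 := by
  by_contra hx0
  -- `h` is not assumed to be the grading element, so an `h`-eigenvector must be sought in this
  -- `h`-stable space. For an eigenvector `u`, `[f, u]` is a nonzero vector killed by `e`, whence a
  -- natural highest weight `n` and weight `n + 2` for `u`.
  let W : Submodule ℂ g := Γ j ⊓ LinearMap.ker (LieAlgebra.ad ℂ g e ∘ₗ LieAlgebra.ad ℂ g f)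
  have hW : ∀ y, y ∈ W ↔ y ∈ Γ j ∧ ⁅e, ⁅f, y⁆⁆ = 0 := fun y => by
    simp [W]
  have hstab : ∀ y ∈ W, LieAlgebra.ad ℂ g h y ∈ W := by
    intro y hy
    rw [hW] at hy ⊢
    refine ⟨by simpa using hΓ.lie_mem 0 j h ht.h_mem y hy.1, ?_⟩
    have h1 : ⁅f, ⁅h, y⁆⁆ = ⁅h, ⁅f, y⁆⁆ + (2 : ℂ) • ⁅f, y⁆ := by
      rw [leibniz_lie h f y, ht.lie_h_f, neg_lie, smul_lie]
      abel
    have h2 : ⁅e, ⁅h, ⁅f, y⁆⁆⁆ = 0 := by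
      have := leibniz_lie h e ⁅f, y⁆
      rw [ht.lie_h_e, smul_lie, hy.2, lie_zero, smul_zero, zero_add] at this
      exact this.symm
    rw [LieAlgebra.ad_apply, h1, lie_add, h2, lie_smul, hy.2, smul_zero, add_zero]
  have : Nontrivial W := ⟨⟨x, (hW x).2 ⟨hx, hef⟩⟩, 0, fun h0 => hx0 (congrArg Subtype.val h0)⟩
  obtain ⟨c, hc⟩ := Module.End.exists_eigenvalue ((LieAlgebra.ad ℂ g h).restrict hstab)
  obtain ⟨⟨u, huW⟩, hu⟩ := hc.exists_hasEigenvector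
  have hu0 : u ≠ 0 := fun h0 => hu.2 (Subtype.ext h0)
  have hhu : ⁅h, u⁆ = c • u := congrArg Subtype.val hu.apply_eq_smul
  obtain ⟨huj, hefu⟩ := (hW u).1 huW
  have hfu : ⁅f, u⁆ ≠ 0 := fun h0 => hu0 (hΓ.injective j hj u huj h0)
  -- The zero triple is excluded since `f = 0` would contradict the injectivity of `ad f` at `u`.
  have hh0 : h ≠ 0 := by
    rintro rfl
    have := ht.lie_h_f
    rw [zero_lie, eq_comm, neg_eq_zero, smul_eq_zero] at this
    rw [this.resolve_left two_ne_zero, zero_lie] at hfu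
    exact hfu rfl
  have hsl : IsSl2Triple h e f :=
    ⟨hh0, ht.lie_e_f, by rw [ht.lie_h_e, two_smul, two_nsmul],
      by rw [ht.lie_h_f, two_smul, two_nsmul]⟩
  have hprim : hsl.HasPrimitiveVectorWith ⁅f, u⁆ (c - 2) :=
    ⟨hfu, by rw [leibniz_lie, ht.lie_h_f, hhu, lie_smul, neg_lie, smul_lie, sub_smul]; abel, hefu⟩
  obtain ⟨n, hn⟩ := hprim.exists_nat
  have hc : c = n + 2 := by rw [← hn]; ring
  -- With `c = n + 2` these scalars never vanish, so all `(ad e)^k u` are nonzero, although their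
  -- degrees `j + 2k` are unbounded.
  have hfe : ∀ k : ℕ, ⁅f, (LieModule.toEnd ℂ g g e ^ (k + 1)) u⁆ =
      -(((k : ℂ) + 1) * (c + k)) • (LieModule.toEnd ℂ g g e ^ k) u := by
    intro k
    have hbr : ∀ y : g, ⁅f, ⁅e, y⁆⁆ = ⁅e, ⁅f, y⁆⁆ - ⁅h, y⁆ := by
      intro y
      rw [leibniz_lie e f y, ht.lie_e_f]
      abel
    induction k with
    | zero =>
      rw [zero_add, pow_one, pow_zero, LieModule.toEnd_apply_apply, hbr, hefu, hhu]
      simp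
    | succ k ih =>
      rw [pow_succ' _ (k + 1), Module.End.mul_apply, LieModule.toEnd_apply_apply, hbr, ih, lie_smul,
        hsl.lie_h_pow_toEnd_e hhu, IsSl2Triple.lie_e_pow_toEnd_e, ← sub_smul]
      congr 1
      push_cast
      ring
  have hne : ∀ k : ℕ, (LieModule.toEnd ℂ g g e ^ k) u ≠ 0 := by
    intro k
    induction k with
    | zero => simpa using hu0
    | succ k ih =>
      intro h0
      have := hfe k
      rw [h0, lie_zero, eq_comm, smul_eq_zero, neg_eq_zero, hc] at this
      refine this.elim (fun h1 => ?_) ih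
      rcases mul_eq_zero.1 h1 with h1 | h1
      · exact Nat.cast_add_one_ne_zero k h1
      · have : ((n + 2 + k : ℕ) : ℂ) = 0 := by push_cast; exact h1
        rw [Nat.cast_eq_zero] at this
        omega
  have hdeg : ∀ k : ℕ, (LieModule.toEnd ℂ g g e ^ k) u ∈ Γ (j + 2 * k) := by
    intro k
    induction k with
    | zero => simpa using huj
    | succ k ih =>
      rw [pow_succ', Module.End.mul_apply, LieModule.toEnd_apply_apply]
      have := hΓ.lie_mem _ _ e ht.e_mem _ ih
      convert this using 2
      push_cast
      ring
  obtain ⟨k, hk⟩ := exists_filt_eq_bot hΓ.internal.submodule_iSupIndep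
  have := le_filt (show (k : ℤ) ≤ j + 2 * k by omega) (hdeg k)
  rw [hk, Submodule.mem_bot] at this
  exact hne k this

/-- An injective endomorphism of the finite-dimensional component is surjective. -/
theorem IsGradedTriple.exists_lie_lie_eq (ht : IsGradedTriple Γ e h f) (hΓ : IsGoodGrading Γ f)
    {j : ℤ} (hj : 1 ≤ j) {y : g} (hy : y ∈ Γ j) : ∃ x ∈ Γ j, ⁅e, ⁅f, x⁆⁆ = y := by
  have hstab : ∀ x ∈ Γ j, (LieAlgebra.ad ℂ g e ∘ₗ LieAlgebra.ad ℂ g f) x ∈ Γ j := by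
    intro x hx
    have := hΓ.lie_mem _ _ e ht.e_mem _ (hΓ.lie_mem _ _ f hΓ.mem x hx)
    simpa using this
  have hinj : Function.Injective
      ((LieAlgebra.ad ℂ g e ∘ₗ LieAlgebra.ad ℂ g f).restrict hstab) := by
    rw [← LinearMap.ker_eq_bot, LinearMap.ker_eq_bot']
    intro x hx
    exact Subtype.ext (ht.eq_zero_of_lie_lie_eq_zero hΓ hj x.2 (congrArg Subtype.val hx))
  obtain ⟨x, hx⟩ := LinearMap.surjective_of_injective hinj ⟨y, hy⟩
  exact ⟨x, x.2, congrArg Subtype.val hx⟩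

/-- Elements of positive degree lie in the image of `ad e`, which is orthogonal to `Ker ad e` by
invariance. -/
theorem IsGradedTriple.ker_le_perp (ht : IsGradedTriple Γ e h f) (hΓ : IsGoodGrading Γ f)
    (hm : IsGoodAlgebra Γ (B f) m) (hBinv : B.lieInvariant g) :
    LinearMap.ker (LieAlgebra.ad ℂ g e) ≤ perp B m.toSubmodule := by
  intro z hz
  rw [mem_perp]
  intro x hx
  have : filt Γ 1 ≤ LinearMap.ker (B z) := by
    refine filt_le fun j hj x hx => ?_
    obtain ⟨y, -, rfl⟩ := ht.exists_lie_lie_eq hΓ hj hx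
    have hz' : ⁅e, z⁆ = 0 := hz
    rw [LinearMap.mem_ker, ← neg_neg (B z _), ← hBinv, hz']
    simp
  exact this (hm.le_filt_one hx)

/-- Degree by degree: below `-1` the orthogonal vanishes, in degree `-1` it is `[f, l]` by the
Lagrangian property, and from degree `0` on one subtracts `[f, w]` to land in `Ker ad e`. -/
theorem IsGradedTriple.perp_le_sup (ht : IsGradedTriple Γ e h f) (hΓ : IsGoodGrading Γ f)
    (hm : IsGoodAlgebra Γ (B f) m) (hB : B.Nondegenerate) (hBinv : B.lieInvariant g)
    (hq : IsGradingElement Γ q) :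
    perp B m.toSubmodule ≤ LinearMap.ker (LieAlgebra.ad ℂ g e) ⊔
      m.toSubmodule.map (LieAlgebra.ad ℂ g f) := by
  intro z hz
  have hgr := isHomogeneousSub_perp hBinv hq hΓ.internal (hm.isHomogeneousSub hΓ.internal)
  refine mem_of_forall_gproj_mem hΓ.internal fun j => ?_
  have hzj := gproj_mem hΓ.internal j z
  have hzp := hgr j z hz
  set y := gproj hΓ.internal j z
  rcases lt_or_ge j (-1) with hj | hj
  · have : y = 0 := gproj_eq_zero_of_mem_filt hΓ.internal hj
      (hm.perp_le hB hBinv hq hΓ.internal hz)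
    rw [this]
    exact zero_mem _
  rcases hj.eq_or_lt with hj | hj
  · refine Submodule.mem_sup_right ?_
    subst hj
    obtain ⟨w, hw, hwy⟩ := hΓ.surjective 1 le_rfl y hzj
    refine ⟨w, ?_, hwy⟩
    obtain ⟨l, hl, hm'⟩ := hm
    rw [hm', SetLike.mem_coe]
    -- `χ([w, v]) = B([f, w], v)` vanishes for all `v ∈ l`, so maximality of `l` puts `w` in `l`.
    refine Submodule.mem_sup_left ((hl w).2 ⟨hw, fun v hv => ?_⟩)
    rw [← form_lie_left hBinv, hwy]
    exact mem_perp.1 hzp v (hm' ▸ Submodule.mem_sup_left hv)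
  · obtain ⟨w, hw, hwy⟩ := ht.exists_lie_lie_eq hΓ (show 1 ≤ 2 + j by omega)
      (hΓ.lie_mem _ _ e ht.e_mem y hzj)
    refine Submodule.mem_sup.2 ⟨y - ⁅f, w⁆, ?_, ⁅f, w⁆, ⟨w, ?_, rfl⟩, by abel⟩
    · rw [LinearMap.mem_ker, LieAlgebra.ad_apply, lie_sub, hwy, sub_self]
    · exact hm.filt_two_le (le_filt (by omega) hw)

theorem IsGradedTriple.disjoint (ht : IsGradedTriple Γ e h f) (hΓ : IsGoodGrading Γ f)
    {x : g} (hx : x ∈ filt Γ 1) (hef : ⁅e, ⁅f, x⁆⁆ = 0) : x = 0 := by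
  rw [← Submodule.mem_bot ℂ]
  refine mem_of_forall_gproj_mem hΓ.internal fun j => ?_
  rw [Submodule.mem_bot]
  rcases lt_or_ge j 1 with hj | hj
  · exact gproj_eq_zero_of_mem_filt hΓ.internal hj hx
  · refine ht.eq_zero_of_lie_lie_eq_zero hΓ hj (gproj_mem hΓ.internal j x) ?_
    have := gproj_map hΓ.internal hΓ.internal (LieAlgebra.ad ℂ g e ∘ₗ LieAlgebra.ad ℂ g f) (i := 0)
      (fun j x hx => by
        have := hΓ.lie_mem _ _ e ht.e_mem _ (hΓ.lie_mem _ _ f hΓ.mem x hx)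
        simpa using this) j x
    simp only [LinearMap.comp_apply, LieAlgebra.ad_apply, hef, map_zero] at this
    exact this.symm

end GoodAlgebras

/-! ### Transfer to the dual and decomposition of the zero fibre. -/

section DualDecomposition

variable {g : Type*} [LieRing g] [LieAlgebra ℂ g] {B : LinearMap.BilinForm ℂ g}

/-- The coadjoint action of the exponential of `x`. -/
def coexp (x : g) : Dual ℂ g →ₗ[ℂ] Dual ℂ g := (nilExp (-LieAlgebra.ad ℂ g x)).dualMap

theorem coexp_apply (x : g) (ξ : Dual ℂ g) (y : g) :
    coexp x ξ y = ξ (nilExp (-LieAlgebra.ad ℂ g x) y) := rfl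

theorem coexp_form (hBinv : B.lieInvariant g) (x w : g) :
    coexp x (B w) = B (nilExp (LieAlgebra.ad ℂ g x) w) := by
  ext y
  have hk : ∀ (k : ℕ) (w : g), B ((LieAlgebra.ad ℂ g x ^ k) w) y =
      B w (((-LieAlgebra.ad ℂ g x) ^ k) y) := by
    intro k
    induction k with
    | zero => intro w; rfl
    | succ k ih =>
      intro w
      rw [pow_succ, Module.End.mul_apply, ih, pow_succ', Module.End.mul_apply,
        LieAlgebra.ad_apply, hBinv, LinearMap.neg_apply, LieAlgebra.ad_apply, map_neg]
  simp [coexp_apply, nilExp, LinearMap.sum_apply, hk]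

theorem twistedRestriction_apply (χ : Dual ℂ g) (m : LieSubalgebra ℂ g) (ξ : Dual ℂ g) (x : m) :
    twistedRestriction χ m ξ x = ξ x - χ x := rfl

theorem mem_zeroFibre {χ : Dual ℂ g} {m : LieSubalgebra ℂ g} {ξ : Dual ℂ g} :
    ξ ∈ zeroFibre χ m ↔ ∀ x ∈ m, ξ x = χ x := by
  rw [zeroFibre, Set.mem_preimage, Set.mem_singleton_iff, LinearMap.ext_iff]
  constructor
  · intro h x hx
    have := h ⟨x, hx⟩
    rwa [twistedRestriction_apply, LinearMap.zero_apply, sub_eq_zero] at this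
  · rintro h ⟨x, hx⟩
    rw [twistedRestriction_apply, LinearMap.zero_apply, sub_eq_zero]
    exact h x hx

theorem form_mem_zeroFibre {f w : g} {m : LieSubalgebra ℂ g} :
    B w ∈ zeroFibre (B f) m ↔ w - f ∈ perp B m.toSubmodule := by
  rw [mem_zeroFibre, mem_perp]
  simp [sub_eq_zero]

theorem form_mem_slice (hB : B.Nondegenerate) (hBinv : B.lieInvariant g) {f e w : g} :
    B w ∈ slice (B f) e ↔ ⁅e, w - f⁆ = 0 := by
  have h : ⁅e, B w - B f⁆ = B ⁅e, w - f⁆ := by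
    ext y
    rw [← map_sub, Module.Dual.lie_apply, hBinv]
  change ⁅e, B w - B f⁆ = 0 ↔ _
  rw [h]
  constructor
  · intro h0
    exact hB.1 _ fun y => by rw [h0, LinearMap.zero_apply]
  · intro h0
    rw [h0, map_zero]

variable [FiniteDimensional ℂ g] {Γ : ℤ → Submodule ℂ g} {f q : g} {m : LieSubalgebra ℂ g}

/-- The linear hypotheses of `exists_inverse_adjoint_map` reduce to `m^⊥ = C ⊕ [f, m]`, the
splitting `m = a ⊕ b` and injectivity of `ad f` on `m`. -/
theorem exists_inverse_of_complement (hΓ : IsGoodGrading Γ f) (hq : IsGradingElement Γ q)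
    (hB : B.Nondegenerate) (hBinv : B.lieInvariant g) (hm : IsGoodAlgebra Γ (B f) m)
    {a b C : Submodule ℂ g} (hsum : a ⊔ b = m.toSubmodule) (hdisj : Disjoint a b)
    (ha : IsHomogeneousSub hΓ.internal a) (hb : IsHomogeneousSub hΓ.internal b)
    (hC : IsHomogeneousSub hΓ.internal C) (hCle : C ≤ perp B m.toSubmodule)
    (hCsup : perp B m.toSubmodule ≤ C ⊔ m.toSubmodule.map (LieAlgebra.ad ℂ g f))
    (hCdisj : ∀ x ∈ m, ⁅f, x⁆ ∈ C → x = 0) :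
    ∃ T : g → a × b × C, IsMorphism (polyFun g) (polyFun (a × b × C)) T ∧
      (∀ z ∈ perp B m.toSubmodule, nilExp (LieAlgebra.ad ℂ g (T z).1)
        (nilExp (LieAlgebra.ad ℂ g (T z).2.1) (f + (T z).2.2)) - f = z) ∧
      ∀ v : a × b × C, T (nilExp (LieAlgebra.ad ℂ g v.1)
        (nilExp (LieAlgebra.ad ℂ g v.2.1) (f + v.2.2)) - f) = v := by
  have ham : a ≤ m.toSubmodule := hsum ▸ le_sup_left
  have hbm : b ≤ m.toSubmodule := hsum ▸ le_sup_right
  refine exists_inverse_adjoint_map hΓ.internal hΓ.lie_mem hq hΓ.mem (ham.trans hm.le_filt_one)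
    (hbm.trans hm.le_filt_one) (hCle.trans (hm.perp_le hB hBinv hq hΓ.internal)) ha hb hC
    ?_ ?_ ?_ ?_
  · intro x hx y hy s hs h0
    have hxy : ⁅f, x + y⁆ = s := by
      rw [lie_add, ← lie_skew f x, ← lie_skew f y]
      rw [add_assoc, add_eq_zero_iff_eq_neg] at h0
      rw [h0]
      abel
    have hxy0 : x + y = 0 := hCdisj _ (m.add_mem (ham hx) (hbm hy)) (hxy ▸ hs)
    have hx0 : x = 0 := by
      refine Submodule.disjoint_def.1 hdisj x hx ?_
      rw [eq_neg_of_add_eq_zero_left hxy0]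
      exact b.neg_mem hy
    refine ⟨hx0, ?_, ?_⟩
    · rwa [hx0, zero_add] at hxy0
    · rw [← hxy, hxy0, lie_zero]
  · intro x hx y hy s hs
    exact add_mem (add_mem (hCle hs) (hm.lie_mem_perp hBinv hq hΓ (ham hx)))
      (hm.lie_mem_perp hBinv hq hΓ (hbm hy))
  · intro z hz
    obtain ⟨s, hs, _, ⟨w, hw, rfl⟩, rfl⟩ := Submodule.mem_sup.1 (hCsup hz)
    rw [← hsum] at hw
    obtain ⟨x, hx, y, hy, rfl⟩ := Submodule.mem_sup.1 hw
    refine ⟨-x, a.neg_mem hx, -y, b.neg_mem hy, s, hs, ?_⟩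
    rw [LieAlgebra.ad_apply, lie_add, neg_lie, neg_lie, lie_skew, lie_skew, add_assoc]
  · intro x hx y hy s hs
    refine hm.nilExp_sub_mem_perp hBinv hq hΓ (ham hx) (hm.nilExp_sub_mem_perp hBinv hq hΓ (hbm hy) ?_)
    simpa using hCle hs

/-- The decomposition of the points of `χ + m^⊥` provided by a graded complement of `[f, m]` in
`m^⊥`. -/
theorem exists_dual_decomposition (hΓ : IsGoodGrading Γ f) (hq : IsGradingElement Γ q)
    (hB : B.Nondegenerate) (hBinv : B.lieInvariant g) (hm : IsGoodAlgebra Γ (B f) m)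
    {a b C : Submodule ℂ g} (hsum : a ⊔ b = m.toSubmodule) (hdisj : Disjoint a b)
    (ha : IsHomogeneousSub hΓ.internal a) (hb : IsHomogeneousSub hΓ.internal b)
    (hC : IsHomogeneousSub hΓ.internal C) (hCle : C ≤ perp B m.toSubmodule)
    (hCsup : perp B m.toSubmodule ≤ C ⊔ m.toSubmodule.map (LieAlgebra.ad ℂ g f))
    (hCdisj : ∀ x ∈ m, ⁅f, x⁆ ∈ C → x = 0) :
    ∃ (X Y : Dual ℂ g → g) (S : Dual ℂ g → Dual ℂ g),
      IsMorphism (polyFun (Dual ℂ g)) (polyFun g) Y ∧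
      IsMorphism (polyFun (Dual ℂ g)) (polyFun (Dual ℂ g)) S ∧
      (∀ ξ, X ξ ∈ a ∧ Y ξ ∈ b ∧ ∃ s ∈ C, S ξ = B (f + s)) ∧
      (∀ ξ ∈ zeroFibre (B f) m, coexp (X ξ) (coexp (Y ξ) (S ξ)) = ξ) ∧
      ∀ x ∈ a, ∀ y ∈ b, ∀ s ∈ C, coexp x (coexp y (B (f + s))) ∈ zeroFibre (B f) m ∧
        Y (coexp x (coexp y (B (f + s)))) = y ∧
        S (coexp x (coexp y (B (f + s)))) = B (f + s) := by
  obtain ⟨T, hT, hT1, hT2⟩ := exists_inverse_of_complement hΓ hq hB hBinv hm hsum hdisj ha hb hC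
    hCle hCsup hCdisj
  let β := B.toDual hB
  have hβ : ∀ w, β w = B w := fun w => LinearMap.ext fun z => LinearMap.BilinForm.toDual_def hB
  have hβs : ∀ w, β.symm (B w) = w := fun w => by rw [← hβ, LinearEquiv.symm_apply_apply]
  let τ : Dual ℂ g → a × b × C := fun ξ => T (β.symm ξ - f)
  have hτ : IsMorphism (polyFun (Dual ℂ g)) (polyFun (a × b × C)) τ :=
    hT.comp ((isMorphism_linear β.symm.toLinearMap).sub (isMorphism_const f))
  refine ⟨fun ξ => (τ ξ).1, fun ξ => (τ ξ).2.1, fun ξ => B (f + (τ ξ).2.2), ?_, ?_, ?_, ?_, ?_⟩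
  · exact hτ.linear (b.subtype ∘ₗ LinearMap.fst ℂ b C ∘ₗ LinearMap.snd ℂ a (b × C))
  · exact ((isMorphism_const f).add
      (hτ.linear (C.subtype ∘ₗ LinearMap.snd ℂ b C ∘ₗ LinearMap.snd ℂ a (b × C)))).linear B
  · exact fun ξ => ⟨(τ ξ).1.2, (τ ξ).2.1.2, _, (τ ξ).2.2.2, rfl⟩
  · intro ξ hξ
    obtain ⟨w, rfl⟩ := β.surjective ξ
    rw [hβ] at hξ ⊢
    have := hT1 _ (form_mem_zeroFibre.1 hξ)
    rw [coexp_form hBinv, coexp_form hBinv]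
    simp only [τ, hβs]
    rw [sub_left_inj] at this
    rw [this]
  · intro x hx y hy s hs
    have ham : a ≤ m.toSubmodule := hsum ▸ le_sup_left
    have hbm : b ≤ m.toSubmodule := hsum ▸ le_sup_right
    have := hT2 (⟨x, hx⟩, ⟨y, hy⟩, ⟨s, hs⟩)
    rw [coexp_form hBinv, coexp_form hBinv]
    simp only [τ, hβs]
    simp only at this
    rw [this]
    refine ⟨?_, rfl, rfl⟩
    rw [form_mem_zeroFibre]
    refine hm.nilExp_sub_mem_perp hBinv hq hΓ (ham hx)
      (hm.nilExp_sub_mem_perp hBinv hq hΓ (hbm hy) ?_)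
    simpa using hCle hs

theorem mem_slice_iff_exists (hB : B.Nondegenerate) (hBinv : B.lieInvariant g) {e : g}
    {ξ : Dual ℂ g} : ξ ∈ slice (B f) e ↔
      ∃ s ∈ LinearMap.ker (LieAlgebra.ad ℂ g e), ξ = B (f + s) := by
  constructor
  · intro h
    obtain ⟨w, rfl⟩ := (B.toDual hB).surjective ξ
    have hw : B.toDual hB w = B w := LinearMap.ext fun z => LinearMap.BilinForm.toDual_def hB
    rw [hw] at h ⊢
    exact ⟨w - f, (form_mem_slice hB hBinv).1 h, by rw [add_sub_cancel]⟩
  · rintro ⟨s, hs, rfl⟩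
    rw [form_mem_slice hB hBinv, add_sub_cancel_left]
    exact hs

/-- Some graded complement of `[f, m]` in `m^⊥` exists. -/
theorem exists_graded_complement (hΓ : IsGoodGrading Γ f) (hq : IsGradingElement Γ q)
    (hBinv : B.lieInvariant g) (hm : IsGoodAlgebra Γ (B f) m) :
    ∃ C : Submodule ℂ g, IsHomogeneousSub hΓ.internal C ∧ C ≤ perp B m.toSubmodule ∧
      perp B m.toSubmodule ≤ C ⊔ m.toSubmodule.map (LieAlgebra.ad ℂ g f) ∧
      ∀ x ∈ m, ⁅f, x⁆ ∈ C → x = 0 := by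
  have hmg := hm.isHomogeneousSub hΓ.internal
  have hfm : IsHomogeneousSub hΓ.internal (m.toSubmodule.map (LieAlgebra.ad ℂ g f)) := by
    rintro j _ ⟨x, hx, rfl⟩
    refine ⟨gproj hΓ.internal (j + 2) x, hmg _ x hx, ?_⟩
    rw [← gproj_map hΓ.internal hΓ.internal (LieAlgebra.ad ℂ g f) (i := -2)
      (fun j x hx => hΓ.lie_mem _ _ f hΓ.mem x hx)]
    congr 2
    omega
  have hle : m.toSubmodule.map (LieAlgebra.ad ℂ g f) ≤ perp B m.toSubmodule := by
    rintro _ ⟨x, hx, rfl⟩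
    rw [LieAlgebra.ad_apply, ← lie_skew]
    exact neg_mem (hm.lie_mem_perp hBinv hq hΓ hx)
  obtain ⟨C, hC, hcompl⟩ := exists_isCompl_homogeneous hΓ.internal hfm
  refine ⟨C ⊓ perp B m.toSubmodule, hC.inf hΓ.internal
    (isHomogeneousSub_perp hBinv hq hΓ.internal hmg), inf_le_right, ?_, ?_⟩
  · intro z hz
    have : z ∈ m.toSubmodule.map (LieAlgebra.ad ℂ g f) ⊔ C := by
      rw [hcompl.sup_eq_top]
      trivial
    obtain ⟨y, hy, s, hs, rfl⟩ := Submodule.mem_sup.1 this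
    refine Submodule.mem_sup.2 ⟨s, ⟨hs, ?_⟩, y, hy, add_comm _ _⟩
    simpa using sub_mem hz (hle hy)
  · intro x hx hxC
    have h0 := Submodule.disjoint_def.1 hcompl.disjoint ⁅f, x⁆ ⟨x, hx, rfl⟩ hxC.1
    refine hΓ.eq_zero_of_lie_eq_zero (hm.le_filt_one hx) ?_
    rw [← lie_skew, h0, neg_zero]

end DualDecomposition

/-! ### The Jacobi identity from generators. -/

section PoissonAlgebra

variable {A : Type*} [CommRing A] [Algebra ℂ A]

/-- The Jacobi identity of a biderivation holds as soon as it holds for generators. -/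
theorem jacobi_of_generators (β : A →ₗ[ℂ] A →ₗ[ℂ] A) (hself : ∀ a, β a a = 0)
    (hleib : ∀ a b c, β a (b * c) = β a b * c + b * β a c) {s : Set A}
    (hs : Algebra.adjoin ℂ s = ⊤)
    (hjac : ∀ a ∈ s, ∀ b ∈ s, ∀ c ∈ s, β a (β b c) = β (β a b) c + β b (β a c)) (a b c : A) :
    β a (β b c) = β (β a b) c + β b (β a c) := by
  have hskew : ∀ a b, β a b = -β b a := by
    intro a b
    have := hself (a + b)
    simp only [map_add, LinearMap.add_apply, hself, zero_add, add_zero] at this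
    exact eq_neg_of_add_eq_zero_left ((add_comm _ _).trans this)
  let D : A → Derivation ℂ A A := fun a => Derivation.mk' (β a) fun b c => by
    rw [hleib, smul_eq_mul, smul_eq_mul]
    ring
  have hD : ∀ a b, D a b = β a b := fun _ _ => rfl
  -- For fixed `a`, `b` the identity says that the derivations `[D a, D b]` and `D (β a b)` agree,
  -- which is tested on generators in the last slot. Skew-symmetry then moves the other two
  -- arguments into that slot.
  have ext : ∀ a b, (∀ c ∈ s, β a (β b c) = β (β a b) c + β b (β a c)) →
      ∀ c, β a (β b c) = β (β a b) c + β b (β a c) := by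
    intro a b h c
    have : ⁅D a, D b⁆ = D (β a b) := by
      refine Derivation.ext_of_adjoin_eq_top s hs fun c hc => ?_
      simp only [Derivation.commutator_apply, hD]
      rw [h c hc]
      abel
    have := DFunLike.congr_fun this c
    simp only [Derivation.commutator_apply, hD] at this
    rw [← this]
    abel
  have swap : ∀ a b c, β a (β b c) = β (β a b) c + β b (β a c) →
      β a (β c b) = β (β a c) b + β c (β a b) := by
    intro a b c h
    rw [hskew c b, map_neg, h, hskew (β a c) b, hskew c (β a b)]
    abel
  have rot : ∀ a b c, β a (β b c) = β (β a b) c + β b (β a c) →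
      β b (β a c) = β (β b a) c + β a (β b c) := by
    intro a b c h
    rw [h, hskew b a, map_neg, LinearMap.neg_apply]
    abel
  have h1 : ∀ a ∈ s, ∀ b ∈ s, ∀ c, β a (β b c) = β (β a b) c + β b (β a c) :=
    fun a ha b hb => ext a b (hjac a ha b hb)
  have h2 : ∀ a ∈ s, ∀ b c, β a (β b c) = β (β a b) c + β b (β a c) :=
    fun a ha b => ext a b fun c hc => swap _ _ _ (h1 a ha c hc b)
  exact ext a b (fun c hc => swap _ _ _ (rot _ _ _ (h2 c hc a b))) c

end PoissonAlgebra

/-! ### The Kirillov-Kostant bracket on polynomial functions. -/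

section KirillovKostant

variable {L : Type*} [LieRing L] [LieAlgebra ℂ L]

theorem eval_mem_polyFun (x : L) : (fun ξ : Dual ℂ L => ξ x) ∈ polyFun (Dual ℂ L) :=
  dual_mem_polyFun (Dual.eval ℂ L x)

variable [FiniteDimensional ℂ L]

theorem apply_dualGradient {F : Dual ℂ L → ℂ} (hF : F ∈ polyFun (Dual ℂ L)) (ξ η : Dual ℂ L) :
    η (dualGradient F ξ) = differential F ξ η := by
  have h : η = ∑ i, η (finBasis ℂ L i) • (finBasis ℂ L).coord i := by
    refine (finBasis ℂ L).ext fun j => ?_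
    simp
  conv_rhs => rw [h]
  simp only [dualGradient, map_sum, map_smul, smul_eq_mul, lineDeriv_eq_differential hF]
  exact Finset.sum_congr rfl fun i _ => mul_comm _ _

theorem dual_ext {x y : L} (h : ∀ η : Dual ℂ L, η x = η y) : x = y := by
  rw [← sub_eq_zero, ← Module.forall_dual_apply_eq_zero_iff ℂ]
  intro η
  rw [map_sub, h, sub_self]

/-- The gradient is determined by the derivatives along lines. -/
theorem dualGradient_eq {F : Dual ℂ L → ℂ} (hF : F ∈ polyFun (Dual ℂ L)) {ξ : Dual ℂ L} {x : L}
    (h : ∀ η : Dual ℂ L, HasDerivAt (fun t : ℂ => F (ξ + t • η)) (η x) 0) :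
    dualGradient F ξ = x :=
  dual_ext fun η => by
    rw [apply_dualGradient hF]
    exact (hasDerivAt_comp_line hF ξ η).unique (h η)

theorem hasDerivAt_dualGradient {F : Dual ℂ L → ℂ} (hF : F ∈ polyFun (Dual ℂ L))
    (ξ η : Dual ℂ L) : HasDerivAt (fun t : ℂ => F (ξ + t • η)) (η (dualGradient F ξ)) 0 := by
  rw [apply_dualGradient hF]
  exact hasDerivAt_comp_line hF ξ η

variable {F H K : Dual ℂ L → ℂ}

theorem dualGradient_add (hF : F ∈ polyFun (Dual ℂ L)) (hH : H ∈ polyFun (Dual ℂ L))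
    (ξ : Dual ℂ L) : dualGradient (F + H) ξ = dualGradient F ξ + dualGradient H ξ :=
  dualGradient_eq (Subalgebra.add_mem _ hF hH) fun η => by
    rw [map_add]
    exact (hasDerivAt_dualGradient hF ξ η).add (hasDerivAt_dualGradient hH ξ η)

theorem dualGradient_smul (hF : F ∈ polyFun (Dual ℂ L)) (c : ℂ) (ξ : Dual ℂ L) :
    dualGradient (c • F) ξ = c • dualGradient F ξ :=
  dualGradient_eq (Subalgebra.smul_mem _ hF c) fun η => by
    rw [map_smul]
    exact (hasDerivAt_dualGradient hF ξ η).const_mul c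

theorem dualGradient_mul (hF : F ∈ polyFun (Dual ℂ L)) (hH : H ∈ polyFun (Dual ℂ L))
    (ξ : Dual ℂ L) :
    dualGradient (F * H) ξ = H ξ • dualGradient F ξ + F ξ • dualGradient H ξ :=
  dualGradient_eq (Subalgebra.mul_mem _ hF hH) fun η => by
    refine ((hasDerivAt_dualGradient hF ξ η).mul (hasDerivAt_dualGradient hH ξ η)).congr_deriv ?_
    simp only [map_add, map_smul, smul_eq_mul, zero_smul, add_zero]
    ring

theorem dualGradient_eval_sub (x : L) (c : ℂ) (ξ : Dual ℂ L) :
    dualGradient (fun ξ => ξ x - c) ξ = x :=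
  dualGradient_eq (Subalgebra.sub_mem _ (eval_mem_polyFun x) (const_mem _ c)) fun η =>
    (hasDerivAt_line (Dual.eval ℂ L x) ξ η 0).sub_const c

theorem dualGradient_eval (x : L) (ξ : Dual ℂ L) :
    dualGradient (fun ξ : Dual ℂ L => ξ x) ξ = x := by
  simpa using dualGradient_eval_sub x 0 ξ

theorem isMorphism_dualGradient (hF : F ∈ polyFun (Dual ℂ L)) :
    IsMorphism (polyFun (Dual ℂ L)) (polyFun L) (dualGradient F) :=
  isMorphism_iff_dual.2 fun l => by
    simp only [apply_dualGradient hF]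
    exact differential_mem hF l

theorem kkBracket_mem (hF : F ∈ polyFun (Dual ℂ L)) (hH : H ∈ polyFun (Dual ℂ L)) :
    kkBracket F H ∈ polyFun (Dual ℂ L) := by
  have h := (isMorphism_dualGradient hF).bilinear (LieAlgebra.ad ℂ L : L →ₗ[ℂ] End ℂ L)
    (isMorphism_dualGradient hH)
  exact isMorphism_iff_dual.1
    ((isMorphism_id (A := polyFun (Dual ℂ L))).bilinear LinearMap.id h) LinearMap.id

theorem kkBracket_self (F : Dual ℂ L → ℂ) : kkBracket F F = 0 := by
  funext ξ
  simp [kkBracket]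

theorem kkBracket_add_left (hF : F ∈ polyFun (Dual ℂ L)) (hH : H ∈ polyFun (Dual ℂ L)) :
    kkBracket (F + H) K = kkBracket F K + kkBracket H K := by
  funext ξ
  simp [kkBracket, dualGradient_add hF hH]

theorem kkBracket_add_right (hH : H ∈ polyFun (Dual ℂ L)) (hK : K ∈ polyFun (Dual ℂ L)) :
    kkBracket F (H + K) = kkBracket F H + kkBracket F K := by
  funext ξ
  simp [kkBracket, dualGradient_add hH hK]

theorem kkBracket_smul_left (hF : F ∈ polyFun (Dual ℂ L)) (c : ℂ) :
    kkBracket (c • F) H = c • kkBracket F H := by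
  funext ξ
  simp [kkBracket, dualGradient_smul hF]

theorem kkBracket_smul_right (hH : H ∈ polyFun (Dual ℂ L)) (c : ℂ) :
    kkBracket F (c • H) = c • kkBracket F H := by
  funext ξ
  simp [kkBracket, dualGradient_smul hH]

theorem kkBracket_mul (hH : H ∈ polyFun (Dual ℂ L)) (hK : K ∈ polyFun (Dual ℂ L)) :
    kkBracket F (H * K) = kkBracket F H * K + H * kkBracket F K := by
  funext ξ
  simp only [kkBracket, dualGradient_mul hH hK, lie_add, lie_smul, map_add, map_smul, smul_eq_mul,
    Pi.add_apply, Pi.mul_apply]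
  ring

variable (L) in
/-- The Kirillov-Kostant bracket as a bilinear map. -/
def kkBilinear : polyFun (Dual ℂ L) →ₗ[ℂ] polyFun (Dual ℂ L) →ₗ[ℂ] polyFun (Dual ℂ L) :=
  LinearMap.mk₂ ℂ (fun F H => ⟨kkBracket F.1 H.1, kkBracket_mem F.2 H.2⟩)
    (fun F F' _ => Subtype.ext (kkBracket_add_left F.2 F'.2))
    (fun c F _ => Subtype.ext (kkBracket_smul_left F.2 c))
    (fun _ H H' => Subtype.ext (kkBracket_add_right H.2 H'.2))
    (fun c _ H => Subtype.ext (kkBracket_smul_right H.2 c))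

theorem kkBracket_eval_eval (x y : L) :
    kkBracket (fun ξ : Dual ℂ L => ξ x) (fun ξ => ξ y) = fun ξ => ξ ⁅x, y⁆ := by
  funext ξ
  simp only [kkBracket, dualGradient_eval]

/-- On linear functions the bracket is that of `L`, so the identity for generators is the Jacobi
identity of `L`. -/
theorem kkBracket_jacobi (hF : F ∈ polyFun (Dual ℂ L)) (hH : H ∈ polyFun (Dual ℂ L))
    (hK : K ∈ polyFun (Dual ℂ L)) :
    kkBracket F (kkBracket H K) = kkBracket (kkBracket F H) K + kkBracket H (kkBracket F K) := by
  have h := jacobi_of_generators (kkBilinear L) (fun F => Subtype.ext (kkBracket_self F.1))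
    (fun F H K => Subtype.ext (kkBracket_mul H.2 K.2)) (Algebra.adjoin_adjoin_coe_preimage (R := ℂ))
    (fun F hF H hH K hK => ?_) ⟨F, hF⟩ ⟨H, hH⟩ ⟨K, hK⟩
  · exact congrArg Subtype.val h
  · obtain ⟨F, hF'⟩ := F
    obtain ⟨H, hH'⟩ := H
    obtain ⟨K, hK'⟩ := K
    obtain ⟨l, rfl⟩ := hF
    obtain ⟨l', rfl⟩ := hH
    obtain ⟨l'', rfl⟩ := hK
    obtain ⟨x, rfl⟩ := (evalEquiv ℂ L).surjective l
    obtain ⟨y, rfl⟩ := (evalEquiv ℂ L).surjective l'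
    obtain ⟨z, rfl⟩ := (evalEquiv ℂ L).surjective l''
    apply Subtype.ext
    change kkBracket (fun ξ : Dual ℂ L => ξ x) (kkBracket (fun ξ : Dual ℂ L => ξ y) fun ξ => ξ z) =
      kkBracket (kkBracket (fun ξ : Dual ℂ L => ξ x) fun ξ => ξ y) (fun ξ => ξ z) +
        kkBracket (fun ξ : Dual ℂ L => ξ y) (kkBracket (fun ξ : Dual ℂ L => ξ x) fun ξ => ξ z)
    simp only [kkBracket_eval_eval]
    funext ξ
    rw [Pi.add_apply, leibniz_lie, map_add]

end KirillovKostant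

/-! ### The infinitesimal coadjoint action. -/

section CoadjointDerivative

variable {g V : Type*} [LieRing g] [LieAlgebra ℂ g]

/-- If `x` acts on `p + ℂ y` through `p`, and `ξ` vanishes on `p`, then the coadjoint action of the
exponential of `x` does not change the value of `ξ` at `y`. -/
theorem coexp_apply_eq {p : Submodule ℂ g} {x y : g} {ξ : Dual ℂ g}
    (hp : ∀ z ∈ p, ⁅x, z⁆ ∈ p) (hy : ⁅x, y⁆ ∈ p) (hξ : ∀ z ∈ p, ξ z = 0) :
    coexp x ξ y = ξ y := by
  have h : nilExp (-LieAlgebra.ad ℂ g x) y - y ∈ p :=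
    nilExp_sub_mem (fun z hz => p.neg_mem (hp z hz)) (p.neg_mem hy)
  have := hξ _ h
  rwa [map_sub, sub_eq_zero] at this

variable [FiniteDimensional ℂ g]

/-- The coadjoint action of `exp(-tx)` is the transpose of `exp(t ad x)`, so the two signs cancel.
-/
theorem hasDerivAt_coexp {x : g} (hx : IsNilpotent (LieAlgebra.ad ℂ g x)) {F : Dual ℂ g → ℂ}
    (hF : F ∈ polyFun (Dual ℂ g)) (ξ : Dual ℂ g) :
    HasDerivAt (fun t : ℂ => F (coexp (-t • x) ξ)) (ξ ⁅x, dualGradient F ξ⁆) 0 := by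
  have hc : ∀ t : ℂ, coexp (-t • x) ξ = (nilExp (t • LieAlgebra.ad ℂ g x)).dualMap ξ := by
    intro t
    rw [coexp, map_smul, neg_smul, neg_neg]
  have h0 : coexp (-(0 : ℂ) • x) ξ = ξ := by
    rw [hc, zero_smul, nilExp_zero]
    rfl
  have h := hasDerivAt_comp_curve hF (c := fun t : ℂ => coexp (-t • x) ξ) (t := 0)
    (v := (LieAlgebra.ad ℂ g x).dualMap ξ) fun l => ?_
  · simp only [h0] at h
    rwa [← apply_dualGradient hF] at h
  · obtain ⟨y, rfl⟩ := (evalEquiv ℂ g).surjective l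
    simp only [hc]
    have := hasDerivAt_nilExp_smul hx (ξ ∘ₗ LinearMap.applyₗ y) 0
    rw [zero_smul, nilExp_zero, one_mul] at this
    exact this

end CoadjointDerivative

/-! ### The coadjoint action preserves the bracket. -/

namespace ConnectedAlgebraicGroup

variable {g V : Type*} [LieRing g] [LieAlgebra ℂ g] [AddCommGroup V] [Module ℂ V]
variable {G : ConnectedAlgebraicGroup g V}

theorem coAd_apply (u : G.carrier) (ξ : Dual ℂ g) (y : g) : G.coAd u ξ y = ξ (G.Ad u⁻¹ y) := rfl

theorem coAd_mul (u v : G.carrier) (ξ : Dual ℂ g) : G.coAd (u * v) ξ = G.coAd u (G.coAd v ξ) := by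
  rw [map_mul, Module.End.mul_apply]

theorem Ad_lie (u : G.carrier) (x y : g) : G.Ad u ⁅x, y⁆ = ⁅G.Ad u x, G.Ad u y⁆ := by
  apply G.lieMap_injective
  have h : ((u : LinearMap.GeneralLinearGroup ℂ V)⁻¹).val *
      (u : LinearMap.GeneralLinearGroup ℂ V).val = 1 := Units.inv_mul _
  have h2 : ∀ X Y : End ℂ V, (u : LinearMap.GeneralLinearGroup ℂ V).val * X *
      ((u : LinearMap.GeneralLinearGroup ℂ V)⁻¹).val * ((u : LinearMap.GeneralLinearGroup ℂ V).val *
      Y * ((u : LinearMap.GeneralLinearGroup ℂ V)⁻¹).val) =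
      (u : LinearMap.GeneralLinearGroup ℂ V).val * (X * Y) *
      ((u : LinearMap.GeneralLinearGroup ℂ V)⁻¹).val := by
    intro X Y
    simp only [mul_assoc]
    rw [← mul_assoc _ _ (Y * _), h, one_mul]
  rw [lieMap_Ad, lieMap_lie, lieMap_lie, lieMap_Ad, lieMap_Ad, h2, h2, mul_sub, sub_mul]

theorem isNilpotent_lieMap_of_mem_filt [FiniteDimensional ℂ V] {Γ : ℤ → Submodule ℂ g} {q : g}
    (hq : IsGradingElement Γ q) {x : g} (hx : x ∈ filt Γ 1) : IsNilpotent (G.lieMap x) := by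
  refine isNilpotent_of_mem_filt G.lieMap (G.lieMap q) (fun j y hy => ?_) hx
  rw [← G.lieMap_lie, (hq j y).1 hy, map_smul]

section Exponentials

variable [FiniteDimensional ℂ V] {M : Subgroup G.carrier} {m : LieSubalgebra ℂ g}
variable (hM : G.IsUnipotentSubgroup M m) (hnil : ∀ x ∈ m, IsNilpotent (G.lieMap x))

theorem conj_expEquiv (u : G.carrier) (x y : m) (hxy : G.Ad u x = y) :
    u * expEquiv hM hnil x * u⁻¹ = expEquiv hM hnil y := by
  apply Subtype.ext
  apply Units.ext
  rw [coe_expEquiv, expGL_val, ← hxy, lieMap_Ad]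
  simp only [Subgroup.coe_mul, Units.val_mul, coe_expEquiv, expGL_val, Subgroup.coe_inv, nilExp,
    Units.conj_pow, Finset.mul_sum, Finset.sum_mul, mul_smul_comm, smul_mul_assoc]

variable [FiniteDimensional ℂ g]

theorem coAd_expEquiv (x : m) : G.coAd (expEquiv hM hnil x) = coexp (x : g) := by
  ext ξ y
  exact coAd_expEquiv_apply hM hnil x ξ y

end Exponentials

variable [FiniteDimensional ℂ g] {F H : Dual ℂ g → ℂ}

theorem dualGradient_comp_coAd (hF : F ∈ polyFun (Dual ℂ g)) (u : G.carrier) (ξ : Dual ℂ g) :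
    dualGradient (F ∘ G.coAd u) ξ = G.Ad u⁻¹ (dualGradient F (G.coAd u ξ)) :=
  dualGradient_eq (polyFun_comp _ hF) fun η => by
    have := hasDerivAt_dualGradient hF (G.coAd u ξ) (G.coAd u η)
    rw [coAd_apply u η] at this
    simpa only [Function.comp_apply, map_add, map_smul] using this

theorem kkBracket_comp_coAd (hF : F ∈ polyFun (Dual ℂ g)) (hH : H ∈ polyFun (Dual ℂ g))
    (u : G.carrier) (ξ : Dual ℂ g) :
    kkBracket (F ∘ G.coAd u) (H ∘ G.coAd u) ξ = kkBracket F H (G.coAd u ξ) := by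
  rw [kkBracket, dualGradient_comp_coAd hF, dualGradient_comp_coAd hH, ← Ad_lie]
  rfl

end ConnectedAlgebraicGroup

/-! ### The bracket on the quotient. -/

section ReducedBracket

variable {g V : Type*} [LieRing g] [LieAlgebra ℂ g]
  [AddCommGroup V] [Module ℂ V] {G : ConnectedAlgebraicGroup g V}
variable {χ : Dual ℂ g} {m : LieSubalgebra ℂ g} {M : Subgroup G.carrier}

/-- A polynomial function on `g*` which represents a given function on `μ⁻¹(0) / M`. -/
structure IsLift (F : Reduced G χ m M → ℂ) (F' : Dual ℂ g → ℂ) : Prop where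
  mem : F' ∈ polyFun (Dual ℂ g)
  eq : ∀ ξ : zeroFibre χ m, F' ξ = F (cls G χ m M ξ)

theorem IsLift.mem_regReduced {F : Reduced G χ m M → ℂ} {F' : Dual ℂ g → ℂ} (h : IsLift F F') :
    F ∈ regReduced G χ m M :=
  ⟨F', h.mem, funext h.eq⟩

theorem exists_isLift {F : Reduced G χ m M → ℂ} (hF : F ∈ regReduced G χ m M) :
    ∃ F', IsLift F F' := by
  obtain ⟨F', hF', h⟩ := hF
  exact ⟨F', hF', fun ξ => congrFun h ξ⟩

theorem cls_coAd (u : M) (ξ : zeroFibre χ m)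
    (h : G.coAd (u : G.carrier) (ξ : Dual ℂ g) ∈ zeroFibre χ m) :
    cls G χ m M ⟨_, h⟩ = cls G χ m M ξ :=
  (Quotient.sound (s := G.orbitSetoid M (zeroFibre χ m)) ⟨u, rfl⟩).symm

theorem exists_coAd_of_cls_eq {ξ η : zeroFibre χ m} (h : cls G χ m M ξ = cls G χ m M η) :
    ∃ u : M, G.coAd (u : G.carrier) (ξ : Dual ℂ g) = η :=
  Quotient.exact h

theorem IsLift.add {F H : Reduced G χ m M → ℂ} {F' H' : Dual ℂ g → ℂ} (hF : IsLift F F')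
    (hH : IsLift H H') : IsLift (F + H) (F' + H') :=
  ⟨Subalgebra.add_mem _ hF.mem hH.mem, fun ξ => congrArg₂ (· + ·) (hF.eq ξ) (hH.eq ξ)⟩

theorem IsLift.mul {F H : Reduced G χ m M → ℂ} {F' H' : Dual ℂ g → ℂ} (hF : IsLift F F')
    (hH : IsLift H H') : IsLift (F * H) (F' * H') :=
  ⟨Subalgebra.mul_mem _ hF.mem hH.mem, fun ξ => congrArg₂ (· * ·) (hF.eq ξ) (hH.eq ξ)⟩

theorem IsLift.smul {F : Reduced G χ m M → ℂ} {F' : Dual ℂ g → ℂ} (c : ℂ) (hF : IsLift F F') :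
    IsLift (c • F) (c • F') :=
  ⟨Subalgebra.smul_mem _ hF.mem c, fun ξ => congrArg (c * ·) (hF.eq ξ)⟩

theorem regReduced_ext {F H : regReduced G χ m M} {F' : Dual ℂ g → ℂ}
    (hF : IsLift (F : Reduced G χ m M → ℂ) F') (hH : IsLift (H : Reduced G χ m M → ℂ) F') :
    F = H := by
  apply Subtype.ext
  funext p
  obtain ⟨ξ, rfl⟩ := Quotient.exists_rep p
  exact (hF.eq ξ).symm.trans (hH.eq ξ)

variable [FiniteDimensional ℂ g]

/-- The gradients of two lifts of the same function differ by an element of `m`. -/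
theorem dualGradient_sub_mem {F' F'' : Dual ℂ g → ℂ} (hF' : F' ∈ polyFun (Dual ℂ g))
    (hF'' : F'' ∈ polyFun (Dual ℂ g)) (h : ∀ ξ ∈ zeroFibre χ m, F' ξ = F'' ξ) {ξ : Dual ℂ g}
    (hξ : ξ ∈ zeroFibre χ m) : dualGradient F' ξ - dualGradient F'' ξ ∈ m := by
  -- Membership in `m` is tested against `η` vanishing on `m`. The line through `ξ` in the direction
  -- `η` stays in the zero fibre, where both lifts agree.
  rw [← LieSubalgebra.mem_toSubmodule, ← Subspace.dualAnnihilator_dualCoannihilator_eq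
    (W := m.toSubmodule), Submodule.mem_dualCoannihilator]
  intro η hη
  rw [Submodule.mem_dualAnnihilator] at hη
  have h1 := hasDerivAt_dualGradient hF' ξ η
  have h2 := hasDerivAt_dualGradient hF'' ξ η
  have h3 : (fun t : ℂ => F' (ξ + t • η)) = fun t => F'' (ξ + t • η) := by
    funext t
    refine h _ (mem_zeroFibre.2 fun x hx => ?_)
    rw [LinearMap.add_apply, LinearMap.smul_apply, hη x hx, smul_zero, add_zero,
      mem_zeroFibre.1 hξ x hx]
  rw [h3] at h1
  rw [map_sub, h1.unique h2, sub_self]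

variable (hstab : ∀ u : M, ∀ ξ ∈ zeroFibre χ m, G.coAd (u : G.carrier) ξ ∈ zeroFibre χ m)
  (hinv : ∀ (F : Reduced G χ m M → ℂ) (F' : Dual ℂ g → ℂ), IsLift F F' →
    ∀ x ∈ m, ∀ ξ ∈ zeroFibre χ m, ξ ⁅x, dualGradient F' ξ⁆ = 0)

include hinv in
-- Changing a lift changes its gradient by an element of `m`, and `ξ` vanishes on the bracket of
-- such an element with the gradient of any lift, by `hinv`.
theorem IsLift.kkBracket_congr {F H : Reduced G χ m M → ℂ} {F' F'' H' H'' : Dual ℂ g → ℂ}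
    (hF' : IsLift F F') (hF'' : IsLift F F'') (hH' : IsLift H H') (hH'' : IsLift H H'')
    {ξ : Dual ℂ g} (hξ : ξ ∈ zeroFibre χ m) : kkBracket F' H' ξ = kkBracket F'' H'' ξ := by
  have h1 := hinv H H' hH' _ (dualGradient_sub_mem hF'.mem hF''.mem (fun ξ hξ =>
    (hF'.eq ⟨ξ, hξ⟩).trans (hF''.eq ⟨ξ, hξ⟩).symm) hξ) ξ hξ
  have h2 := hinv F F'' hF'' _ (dualGradient_sub_mem hH'.mem hH''.mem (fun ξ hξ =>
    (hH'.eq ⟨ξ, hξ⟩).trans (hH''.eq ⟨ξ, hξ⟩).symm) hξ) ξ hξ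
  rw [sub_lie, map_sub, sub_eq_zero] at h1
  rw [← lie_skew, lie_sub, map_neg, neg_eq_zero, map_sub, sub_eq_zero] at h2
  exact h1.trans h2

include hstab hinv in
-- A lift translated by `u ∈ M` is again a lift of the same function, and translation preserves the
-- bracket; so the bracket of lifts is constant on orbits.
theorem exists_bracket (F H : regReduced G χ m M) : ∃ K : regReduced G χ m M,
    ∀ F' H', IsLift (F : Reduced G χ m M → ℂ) F' → IsLift (H : Reduced G χ m M → ℂ) H' →
      IsLift (K : Reduced G χ m M → ℂ) (kkBracket F' H') := by
  obtain ⟨F', hF'⟩ := exists_isLift F.2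
  obtain ⟨H', hH'⟩ := exists_isLift H.2
  have htrans : ∀ (u : M) (F : Reduced G χ m M → ℂ) (F' : Dual ℂ g → ℂ), IsLift F F' →
      IsLift F (F' ∘ G.coAd (u : G.carrier)) := fun u F F' h =>
    ⟨polyFun_comp _ h.mem, fun ξ => by
      rw [Function.comp_apply, h.eq ⟨_, hstab u ξ ξ.2⟩, cls_coAd]⟩
  let K : Reduced G χ m M → ℂ := Quotient.lift (fun ξ : zeroFibre χ m => kkBracket F' H' ξ) (by
    rintro ξ η ⟨u, hu⟩
    rw [← hu, ← ConnectedAlgebraicGroup.kkBracket_comp_coAd hF'.mem hH'.mem]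
    exact IsLift.kkBracket_congr hinv hF' (htrans u _ _ hF') hH' (htrans u _ _ hH') ξ.2)
  have hK : IsLift K (kkBracket F' H') := ⟨kkBracket_mem hF'.mem hH'.mem, fun ξ => rfl⟩
  refine ⟨⟨K, hK.mem_regReduced⟩, fun F'' H'' hF'' hH'' =>
    ⟨kkBracket_mem hF''.mem hH''.mem, fun ξ => ?_⟩⟩
  exact (IsLift.kkBracket_congr hinv hF'' hF' hH'' hH' ξ.2).trans (hK.eq ξ)

include hstab hinv in
/-- The Kirillov-Kostant bracket induces a Poisson bracket on `μ⁻¹(0) / M`. -/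
theorem exists_reducedBracket :
    ∃ P : PoissonBracket (regReduced G χ m M), IsReducedBracket G χ m M P := by
  choose br hbr using exists_bracket hstab hinv
  choose lift hlift using fun F : regReduced G χ m M => exists_isLift F.2
  have hb : ∀ F H, IsLift (br F H : Reduced G χ m M → ℂ) (kkBracket (lift F) (lift H)) :=
    fun F H => hbr F H _ _ (hlift F) (hlift H)
  refine ⟨{ bracket := LinearMap.mk₂ ℂ br ?_ ?_ ?_ ?_, self := ?_, jacobi := ?_, leibniz := ?_ }, ?_⟩
  · intro F₁ F₂ H
    have h := hbr (F₁ + F₂) H _ _ ((hlift F₁).add (hlift F₂)) (hlift H)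
    rw [kkBracket_add_left (hlift F₁).mem (hlift F₂).mem] at h
    exact regReduced_ext h ((hb F₁ H).add (hb F₂ H))
  · intro c F H
    have h := hbr (c • F) H _ _ ((hlift F).smul c) (hlift H)
    rw [kkBracket_smul_left (hlift F).mem] at h
    exact regReduced_ext h ((hb F H).smul c)
  · intro F H₁ H₂
    have h := hbr F (H₁ + H₂) _ _ (hlift F) ((hlift H₁).add (hlift H₂))
    rw [kkBracket_add_right (hlift H₁).mem (hlift H₂).mem] at h
    exact regReduced_ext h ((hb F H₁).add (hb F H₂))
  · intro c F H
    have h := hbr F (c • H) _ _ (hlift F) ((hlift H).smul c)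
    rw [kkBracket_smul_right (hlift H).mem] at h
    exact regReduced_ext h ((hb F H).smul c)
  · intro F
    have h := hb F F
    rw [kkBracket_self] at h
    exact regReduced_ext h ⟨Subalgebra.zero_mem _, fun _ => rfl⟩
  · intro F H K
    have h := hbr F (br H K) _ _ (hlift F) (hb H K)
    rw [kkBracket_jacobi (hlift F).mem (hlift H).mem (hlift K).mem] at h
    exact regReduced_ext h ((hbr (br F H) K _ _ (hb F H) (hlift K)).add
      (hbr H (br F K) _ _ (hlift H) (hb F K)))
  · intro F H K
    have h := hbr F (H * K) _ _ (hlift F) ((hlift H).mul (hlift K))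
    rw [kkBracket_mul (hlift H).mem (hlift K).mem] at h
    exact regReduced_ext h (((hb F H).mul (hlift K)).add ((hlift H).mul (hb F K)))
  · intro F H F' hF' H' hH' hF hH ξ
    exact ((hbr F H F' H' ⟨hF', hF⟩ ⟨hH', hH⟩).eq ξ).symm

end ReducedBracket

/-! ### Slices as models of quotients. -/

section SliceQuotient

variable {g V : Type*} [LieRing g] [LieAlgebra ℂ g]
  [AddCommGroup V] [Module ℂ V] {G : ConnectedAlgebraicGroup g V}
variable {χ : Dual ℂ g} {m : LieSubalgebra ℂ g} {M : Subgroup G.carrier}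

/-- A slice with a polynomial projection represents the quotient `μ⁻¹(0) / M`. -/
theorem exists_slice_equiv {T : Set (Dual ℂ g)} {S : Dual ℂ g → Dual ℂ g}
    (hS : IsMorphism (polyFun (Dual ℂ g)) (polyFun (Dual ℂ g)) S)
    (h1 : ∀ ξ ∈ zeroFibre χ m, S ξ ∈ T ∧ ∃ u : M, G.coAd (u : G.carrier) (S ξ) = ξ)
    (h2 : ∀ η ∈ T, ∀ u : M, G.coAd (u : G.carrier) η ∈ zeroFibre χ m ∧
      S (G.coAd (u : G.carrier) η) = η) :
    ∃ Ψ : T ≃ Reduced G χ m M,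
      IsIsomorphism (regSub (polyFun (Dual ℂ g)) T) (regReduced G χ m M) Ψ ∧
      ∀ η : T, ∃ hη : (η : Dual ℂ g) ∈ zeroFibre χ m, Ψ η = cls G χ m M ⟨η, hη⟩ := by
  have hT : ∀ η ∈ T, η ∈ zeroFibre χ m ∧ S η = η := fun η hη => by simpa using h2 η hη 1
  have hSinv : ∀ ξ ∈ zeroFibre χ m, ∀ u : M, S (G.coAd (u : G.carrier) ξ) = S ξ := by
    intro ξ hξ u
    obtain ⟨hT, v, hv⟩ := h1 ξ hξ
    have := (h2 _ hT (u * v)).2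
    rwa [Subgroup.coe_mul, ConnectedAlgebraicGroup.coAd_mul, hv] at this
  let Ψ : T ≃ Reduced G χ m M :=
    { toFun := fun η => cls G χ m M ⟨η, (hT η η.2).1⟩
      invFun := Quotient.lift (fun ξ : zeroFibre χ m => (⟨S ξ, (h1 ξ ξ.2).1⟩ : T)) (by
        rintro ξ η ⟨u, hu⟩
        apply Subtype.ext
        change S ξ = S η
        rw [← hu, hSinv ξ ξ.2])
      left_inv := fun η => Subtype.ext (hT η η.2).2
      right_inv := fun p => by
        obtain ⟨ξ, rfl⟩ := Quotient.exists_rep p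
        obtain ⟨hξT, u, hu⟩ := h1 ξ ξ.2
        exact Quotient.sound ⟨u, hu⟩ }
  refine ⟨Ψ, ⟨?_, ?_⟩, fun η => ⟨(hT η η.2).1, rfl⟩⟩
  · intro F hF
    obtain ⟨F', hF'⟩ := exists_isLift hF
    exact ⟨F', hF'.mem, funext fun η => hF'.eq ⟨η, (hT η η.2).1⟩⟩
  · rintro _ ⟨p, hp, rfl⟩
    exact IsLift.mem_regReduced (F' := p ∘ S) ⟨hS p hp, fun ξ => rfl⟩

end SliceQuotient

/-! ### Reduction by stages: action and moment map. -/

section Stages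

open ConnectedAlgebraicGroup

variable {g V : Type*} [LieRing g] [LieAlgebra ℂ g] [AddCommGroup V] [Module ℂ V]
  {G : ConnectedAlgebraicGroup g V}
variable {χ₁ χ₂ : Dual ℂ g} {m₁ m₀ : LieSubalgebra ℂ g} {M₁ M₀ : Subgroup G.carrier}

/-- The compatibilities between two successive reductions: `m₀` normalizes `m₁` and the character
`χ₁` of `m₁`, and `χ₂` is a character of `m₀`. -/
structure IsStageDatum (χ₁ χ₂ : Dual ℂ g) (m₁ m₀ : LieSubalgebra ℂ g) : Prop where
  lie_mem : ∀ x ∈ m₀, ∀ y ∈ m₁, ⁅x, y⁆ ∈ m₁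
  character : ∀ x ∈ m₁, ∀ y ∈ m₁, χ₁ ⁅x, y⁆ = 0
  invariant : ∀ x ∈ m₀, ∀ y ∈ m₁, χ₁ ⁅x, y⁆ = 0
  character' : ∀ x ∈ m₀, ∀ y ∈ m₀, χ₂ ⁅x, y⁆ = 0

/-- The kernel of `χ` on `m`. -/
def charKer (χ : Dual ℂ g) (m : LieSubalgebra ℂ g) : Submodule ℂ g :=
  m.toSubmodule ⊓ LinearMap.ker χ

theorem isMorphism_twistedRestriction :
    IsMorphism (polyFun (Dual ℂ g)) (polyFun (Dual ℂ m₀)) (twistedRestriction χ₂ m₀) := by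
  have h := (isMorphism_linear (m₀.incl : m₀ →ₗ[ℂ] g).dualMap).sub
    (isMorphism_const ((m₀.incl : m₀ →ₗ[ℂ] g).dualMap χ₂))
  exact h

namespace IsStageDatum

variable (hS : IsStageDatum χ₁ χ₂ m₁ m₀)

include hS in
theorem coexp_mem {x : g} (hx : x ∈ m₁ ∨ x ∈ m₀) {ξ : Dual ℂ g} (hξ : ξ ∈ zeroFibre χ₁ m₁) :
    coexp x ξ ∈ zeroFibre χ₁ m₁ := by
  rw [mem_zeroFibre] at hξ ⊢
  intro y hy
  have h : ∀ z ∈ m₁, ⁅x, z⁆ ∈ charKer χ₁ m₁ := fun z hz =>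
    hx.elim (fun hx => ⟨m₁.lie_mem hx hz, hS.character x hx z hz⟩)
      fun hx => ⟨hS.lie_mem x hx z hz, hS.invariant x hx z hz⟩
  rw [coexp_apply_eq (p := charKer χ₁ m₁) (fun z hz => h z hz.1) (h y hy)
    fun z hz => (hξ z hz.1).trans hz.2]
  exact hξ y hy

include hS in
theorem coexp_apply_eq_of_mem {x : g} (hx : x ∈ m₁) {y : g} (hy : y ∈ m₀) {ξ : Dual ℂ g}
    (hξ : ξ ∈ zeroFibre χ₁ m₁) : coexp x ξ y = ξ y := by
  rw [mem_zeroFibre] at hξ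
  refine coexp_apply_eq (p := charKer χ₁ m₁)
    (fun z hz => ⟨m₁.lie_mem hx hz.1, hS.character x hx z hz.1⟩) ?_
    fun z hz => (hξ z hz.1).trans hz.2
  rw [← lie_skew]
  exact neg_mem ⟨hS.lie_mem y hy x hx, hS.invariant y hy x hx⟩

include hS in
theorem coexp_character {x y : g} (hx : x ∈ m₀) (hy : y ∈ m₀) : coexp x χ₂ y = χ₂ y :=
  coexp_apply_eq (p := charKer χ₂ m₀)
    (fun z hz => ⟨m₀.lie_mem hx hz.1, hS.character' x hx z hz.1⟩)
    ⟨m₀.lie_mem hx hy, hS.character' x hx y hy⟩ fun _ hz => hz.2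

end IsStageDatum

variable [FiniteDimensional ℂ g] [FiniteDimensional ℂ V]

/-- An exponential parametrization of a subgroup by nilpotent elements. -/
structure IsExponential (M : Subgroup G.carrier) (m : LieSubalgebra ℂ g) : Prop where
  unipotent : G.IsUnipotentSubgroup M m
  nilpotent : ∀ x ∈ m, IsNilpotent (G.lieMap x)

/-- The exponential map of a connected unipotent subgroup. -/
def IsExponential.exp {M : Subgroup G.carrier} {m : LieSubalgebra ℂ g} (hM : IsExponential M m) :
    m ≃ M :=
  expEquiv hM.unipotent hM.nilpotent

theorem IsExponential.coAd_exp {M : Subgroup G.carrier} {m : LieSubalgebra ℂ g}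
    (hM : IsExponential M m) (x : m) : G.coAd (hM.exp x) = coexp (x : g) :=
  coAd_expEquiv _ _ x

theorem IsExponential.hasDerivAt {M : Subgroup G.carrier} {m : LieSubalgebra ℂ g}
    (hM : IsExponential M m) (x : m) {F : Dual ℂ g → ℂ} (hF : F ∈ polyFun (Dual ℂ g))
    (ξ : Dual ℂ g) :
    HasDerivAt (fun t : ℂ => F (G.coAd (hM.exp (-t • x)) ξ)) (ξ ⁅(x : g), dualGradient F ξ⁆) 0 := by
  simp only [hM.coAd_exp]
  exact hasDerivAt_coexp (G.isNilpotent_ad_of_lieMap (hM.nilpotent x x.2)) hF ξ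

namespace IsStageDatum

variable (hS : IsStageDatum χ₁ χ₂ m₁ m₀)
variable (hM₁ : IsExponential M₁ m₁) (hM₀ : IsExponential M₀ m₀)

include hS hM₁ in
theorem coAd_mem₁ (u : M₁) (ξ : Dual ℂ g) (hξ : ξ ∈ zeroFibre χ₁ m₁) :
    G.coAd (u : G.carrier) ξ ∈ zeroFibre χ₁ m₁ := by
  obtain ⟨x, rfl⟩ := hM₁.exp.surjective u
  rw [hM₁.coAd_exp]
  exact hS.coexp_mem (Or.inl x.2) hξ

include hS hM₀ in
theorem coAd_mem₀ (u : M₀) (ξ : Dual ℂ g) (hξ : ξ ∈ zeroFibre χ₁ m₁) :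
    G.coAd (u : G.carrier) ξ ∈ zeroFibre χ₁ m₁ := by
  obtain ⟨x, rfl⟩ := hM₀.exp.surjective u
  rw [hM₀.coAd_exp]
  exact hS.coexp_mem (Or.inr x.2) hξ

include hS hM₁ hM₀ in
theorem conj_mem (u : M₀) (v : M₁) : (u : G.carrier) * v * (u : G.carrier)⁻¹ ∈ M₁ := by
  obtain ⟨x, rfl⟩ := hM₀.exp.surjective u
  obtain ⟨y, rfl⟩ := hM₁.exp.surjective v
  have hmem : G.Ad (hM₀.exp x : G.carrier) y ∈ m₁ := by
    rw [IsExponential.exp, Ad_expEquiv]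
    have h : nilExp (LieAlgebra.ad ℂ g (x : g)) (y : g) - y ∈ m₁.toSubmodule :=
      nilExp_sub_mem (fun z hz => hS.lie_mem x x.2 z hz) (hS.lie_mem x x.2 y y.2)
    simpa using m₁.add_mem h y.2
  have h := conj_expEquiv hM₁.unipotent hM₁.nilpotent (hM₀.exp x : G.carrier) y ⟨_, hmem⟩ rfl
  exact h ▸ Subtype.property _

/-- The action of `M₀` on `μ₁⁻¹(0) / M₁`. -/
abbrev action : MulAction M₀ (Reduced G χ₁ m₁ M₁) where
  smul u := Quotient.map (fun ξ => ⟨G.coAd (u : G.carrier) ξ, hS.coAd_mem₀ hM₀ u ξ ξ.2⟩) (by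
    rintro ξ η ⟨v, hv⟩
    refine ⟨⟨_, hS.conj_mem hM₁ hM₀ u v⟩, ?_⟩
    change G.coAd ((u : G.carrier) * v * (u : G.carrier)⁻¹) (G.coAd (u : G.carrier) ξ) =
      G.coAd (u : G.carrier) η
    rw [← hv, ← coAd_mul, ← coAd_mul, inv_mul_cancel_right])
  one_smul p := by
    obtain ⟨ξ, rfl⟩ := Quotient.exists_rep p
    refine congrArg (Quotient.mk _) (Subtype.ext ?_)
    simp
  mul_smul u v p := by
    obtain ⟨ξ, rfl⟩ := Quotient.exists_rep p
    exact congrArg (Quotient.mk _) (Subtype.ext (coAd_mul (u : G.carrier) v ξ))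

/-- The moment map on `μ₁⁻¹(0) / M₁`. -/
def moment : Reduced G χ₁ m₁ M₁ → Dual ℂ m₀ :=
  Quotient.lift (fun ξ : zeroFibre χ₁ m₁ => twistedRestriction χ₂ m₀ (ξ : Dual ℂ g)) (by
    rintro ξ η ⟨u, hu⟩
    obtain ⟨x, rfl⟩ := hM₁.exp.surjective u
    rw [hM₁.coAd_exp] at hu
    ext y
    rw [twistedRestriction_apply, twistedRestriction_apply, ← hu,
      hS.coexp_apply_eq_of_mem x.2 y.2 ξ.2])

theorem moment_cls (ξ : zeroFibre χ₁ m₁) :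
    hS.moment hM₁ (cls G χ₁ m₁ M₁ ξ) = twistedRestriction χ₂ m₀ (ξ : Dual ℂ g) := rfl

theorem isLift_comp_moment {F : Dual ℂ m₀ → ℂ} (hF : F ∈ polyFun (Dual ℂ m₀)) :
    IsLift (F ∘ hS.moment hM₁) (F ∘ twistedRestriction χ₂ m₀) :=
  ⟨isMorphism_twistedRestriction F hF, fun _ => rfl⟩

include hS hM₁ in
-- A lift is constant on the orbit of `ξ` under `exp(-tx)`; its derivative along that curve is the
-- given value.
theorem lie_dualGradient_eq_zero (F : Reduced G χ₁ m₁ M₁ → ℂ) (F' : Dual ℂ g → ℂ)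
    (hF : IsLift F F') (x : g) (hx : x ∈ m₁) (ξ : Dual ℂ g) (hξ : ξ ∈ zeroFibre χ₁ m₁) :
    ξ ⁅x, dualGradient F' ξ⁆ = 0 := by
  have h := hM₁.hasDerivAt ⟨x, hx⟩ hF.mem ξ
  have hconst : (fun t : ℂ => F' (G.coAd (hM₁.exp (-t • ⟨x, hx⟩)) ξ)) = fun _ => F' ξ := by
    funext t
    rw [hF.eq ⟨_, hS.coAd_mem₁ hM₁ _ ξ hξ⟩, cls_coAd _ ⟨ξ, hξ⟩, ← hF.eq ⟨ξ, hξ⟩]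
  rw [hconst] at h
  exact h.unique (hasDerivAt_const 0 _)

theorem dualGradient_comp_twistedRestriction {F : Dual ℂ m₀ → ℂ} (hF : F ∈ polyFun (Dual ℂ m₀))
    (ξ : Dual ℂ g) : dualGradient (F ∘ twistedRestriction χ₂ m₀) ξ =
      ((dualGradient F (twistedRestriction χ₂ m₀ ξ) : m₀) : g) := by
  refine dualGradient_eq (isMorphism_twistedRestriction F hF) fun η => ?_
  have h := hasDerivAt_dualGradient hF (twistedRestriction χ₂ m₀ ξ)
    ((m₀.incl : m₀ →ₗ[ℂ] g).dualMap η)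
  have heq : ∀ t : ℂ, twistedRestriction χ₂ m₀ (ξ + t • η) =
      twistedRestriction χ₂ m₀ ξ + t • (m₀.incl : m₀ →ₗ[ℂ] g).dualMap η := by
    intro t
    ext y
    change (ξ + t • η) y - χ₂ y = (ξ y - χ₂ y) + t • η y
    rw [LinearMap.add_apply, LinearMap.smul_apply]
    ring
  simp only [Function.comp_apply, heq]
  exact h

/-- The action of `M₀` on `μ₁⁻¹(0) / M₁` is Hamiltonian. -/
theorem isHamiltonian {P : PoissonBracket (regReduced G χ₁ m₁ M₁)}
    (hP : IsReducedBracket G χ₁ m₁ M₁ P) :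
    letI := hS.action hM₁ hM₀
    IsHamiltonian G (regReduced G χ₁ m₁ M₁) P M₀ m₀ (hS.moment hM₁) := by
  let := hS.action hM₁ hM₀
  have hact : ∀ (u : M₀) (ξ : zeroFibre χ₁ m₁), u • cls G χ₁ m₁ M₁ ξ =
      cls G χ₁ m₁ M₁ ⟨G.coAd (u : G.carrier) ξ, hS.coAd_mem₀ hM₀ u ξ ξ.2⟩ := fun u ξ => rfl
  have hPl : ∀ (F H : regReduced G χ₁ m₁ M₁) (F' H' : Dual ℂ g → ℂ),
      IsLift (F : Reduced G χ₁ m₁ M₁ → ℂ) F' → IsLift (H : Reduced G χ₁ m₁ M₁ → ℂ) H' → ∀ ξ,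
      (P.bracket F H : Reduced G χ₁ m₁ M₁ → ℂ) (cls G χ₁ m₁ M₁ ξ) = kkBracket F' H' ξ :=
    fun F H F' H' hF hH => hP F H F' hF.mem H' hH.mem hF.eq hH.eq
  refine ⟨?_, ?_, ?_, ?_, ?_⟩
  · intro u F H F₁ H₁ hF₁ hH₁ p
    obtain ⟨ξ, rfl⟩ := Quotient.exists_rep p
    obtain ⟨F', hF'⟩ := exists_isLift F.2
    obtain ⟨H', hH'⟩ := exists_isLift H.2
    have htrans : ∀ (F F₁ : Reduced G χ₁ m₁ M₁ → ℂ) (F' : Dual ℂ g → ℂ), IsLift F F' →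
        (∀ p, F₁ p = F (u • p)) → IsLift F₁ (F' ∘ G.coAd (u : G.carrier)) :=
      fun F F₁ F' hF h => ⟨polyFun_comp _ hF.mem, fun ξ => by
        rw [h, hact, ← hF.eq]
        rfl⟩
    change (P.bracket F₁ H₁ : Reduced G χ₁ m₁ M₁ → ℂ) (cls G χ₁ m₁ M₁ ξ) =
      (P.bracket F H : Reduced G χ₁ m₁ M₁ → ℂ) (u • cls G χ₁ m₁ M₁ ξ)
    rw [hact, hPl F₁ H₁ _ _ (htrans _ _ _ hF' hF₁) (htrans _ _ _ hH' hH₁), hPl F H _ _ hF' hH',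
      kkBracket_comp_coAd hF'.mem hH'.mem]
  · exact fun F hF => (hS.isLift_comp_moment hM₁ hF).mem_regReduced
  · intro u y
    obtain ⟨x, rfl⟩ := hM₀.exp.surjective u
    have hmem : G.Ad (hM₀.exp x : G.carrier)⁻¹ y ∈ m₀ := by
      rw [IsExponential.exp, Ad_expEquiv_inv]
      have h : nilExp (-LieAlgebra.ad ℂ g (x : g)) (y : g) - y ∈ m₀.toSubmodule :=
        nilExp_sub_mem (fun z hz => neg_mem (m₀.lie_mem x.2 hz)) (neg_mem (m₀.lie_mem x.2 y.2))
      simpa using m₀.add_mem h y.2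
    refine ⟨⟨_, hmem⟩, rfl, fun p => ?_⟩
    obtain ⟨ξ, rfl⟩ := Quotient.exists_rep p
    have h1 : χ₂ (G.Ad (hM₀.exp x : G.carrier)⁻¹ y) = χ₂ y := by
      rw [← coAd_apply, hM₀.coAd_exp, hS.coexp_character x.2 y.2]
    change G.coAd (hM₀.exp x : G.carrier) ξ y - χ₂ y =
      (ξ : Dual ℂ g) (G.Ad (hM₀.exp x : G.carrier)⁻¹ y) - χ₂ (G.Ad (hM₀.exp x : G.carrier)⁻¹ y)
    rw [h1, coAd_apply]
  · intro F hF H hH F₁ H₁ hF₁ hH₁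
    funext p
    obtain ⟨ξ, rfl⟩ := Quotient.exists_rep p
    change (P.bracket F₁ H₁ : Reduced G χ₁ m₁ M₁ → ℂ) (cls G χ₁ m₁ M₁ ξ) =
      kkBracket F H (hS.moment hM₁ (cls G χ₁ m₁ M₁ ξ))
    -- Pulled-back gradients lie in `m₀`, and `χ₂` vanishes on `[m₀, m₀]`, so the shift by `χ₂` does
    -- not affect the bracket.
    rw [hPl F₁ H₁ _ _ (hF₁ ▸ hS.isLift_comp_moment hM₁ hF) (hH₁ ▸ hS.isLift_comp_moment hM₁ hH),
      hS.moment_cls hM₁, kkBracket, kkBracket, dualGradient_comp_twistedRestriction hF,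
      dualGradient_comp_twistedRestriction hH, twistedRestriction_apply, LieSubalgebra.coe_bracket,
      hS.character' _ (Subtype.property _) _ (Subtype.property _), sub_zero]
  · intro x
    refine ⟨fun t => hM₀.exp (t • x), fun t => ?_, fun F X hX p => ?_⟩
    · rw [IsExponential.exp, coe_expEquiv, expGL_val]
      exact congrArg nilExp (map_smul G.lieMap t (x : g))
    · obtain ⟨ξ, rfl⟩ := Quotient.exists_rep p
      obtain ⟨F', hF'⟩ := exists_isLift F.2
      have hXl : IsLift (X : Reduced G χ₁ m₁ M₁ → ℂ) (fun ξ => ξ (x : g) - χ₂ x) :=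
        ⟨Subalgebra.sub_mem _ (eval_mem_polyFun (x : g)) (const_mem _ _), fun ξ => by
          rw [hX, hS.moment_cls hM₁, twistedRestriction_apply]⟩
      have h := hM₀.hasDerivAt x hF'.mem ξ
      have hb := hPl X F _ _ hXl hF' ξ
      rw [kkBracket, dualGradient_eval_sub] at hb
      rw [← hb] at h
      refine h.congr_of_eventuallyEq (Filter.Eventually.of_forall fun t => ?_)
      exact (hF'.eq ⟨_, hS.coAd_mem₀ hM₀ (hM₀.exp (-t • x)) ξ ξ.2⟩).symm

/-- The action is algebraic when the quotient has a regular section. -/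
theorem isAlgebraicAction {σ : Reduced G χ₁ m₁ M₁ → Dual ℂ g}
    (hσ : IsMorphism (regReduced G χ₁ m₁ M₁) (polyFun (Dual ℂ g)) σ)
    (hσ' : ∀ p, ∃ h : σ p ∈ zeroFibre χ₁ m₁, cls G χ₁ m₁ M₁ ⟨σ p, h⟩ = p) :
    letI := hS.action hM₁ hM₀
    IsAlgebraicAction G (regReduced G χ₁ m₁ M₁) M₀ := by
  let := hS.action hM₁ hM₀
  intro F hF
  obtain ⟨F', hF'⟩ := exists_isLift hF
  -- The section expresses `F(u • [ξ])` as `F'(Ad*(u) σ([ξ]))`, which is visibly regular on the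
  -- product.
  have h := (isMorphism_coAd (G := G) M₀).comp
    ((isMorphism_fst (A := G.regSubgroup M₀) (B := regReduced G χ₁ m₁ M₁)).prodMk'
      (hσ.comp isMorphism_snd)) F' hF'.mem
  convert h using 1
  funext ⟨u, p⟩
  obtain ⟨hp, hp'⟩ := hσ' p
  have := hF'.eq ⟨_, hS.coAd_mem₀ hM₀ u _ hp⟩
  change F (u • p) = F' (G.coAd (u : G.carrier) (σ p))
  rw [this]
  conv_lhs => rw [← hp']
  rfl

end IsStageDatum

end Stages

/-! ### Slices for one reduction and for the second stage. -/

section StageSlices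

open ConnectedAlgebraicGroup

variable {g V : Type*} [LieRing g] [LieAlgebra ℂ g] [AddCommGroup V] [Module ℂ V]
  {G : ConnectedAlgebraicGroup g V}

theorem coexp_zero [FiniteDimensional ℂ g] : coexp (0 : g) = LinearMap.id := by
  rw [coexp, map_zero, neg_zero, nilExp_zero]
  rfl

theorem isMorphism_lieSubalgebra_mk {X : Type*} {A : Subalgebra ℂ (X → ℂ)} {φ : X → g}
    (hφ : IsMorphism A (polyFun g) φ) (m : LieSubalgebra ℂ g) (h : ∀ x, φ x ∈ m) :
    IsMorphism A (polyFun m) (fun x => (⟨φ x, h x⟩ : m)) := by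
  obtain ⟨π, hπ⟩ := (m.incl : m →ₗ[ℂ] g).exists_leftInverse_of_injective
    (LinearMap.ker_eq_bot.2 Subtype.val_injective)
  have := hφ.linear π
  convert this using 2 with x
  exact (LinearMap.congr_fun hπ ⟨φ x, h x⟩).symm

/-- The grading elements of two gradings lying in a common Cartan subalgebra are compatible. -/
theorem IsGradingElement.mem_zero_of_cartan [FiniteDimensional ℂ g] {Γ : ℤ → Submodule ℂ g}
    (hΓ : DirectSum.IsInternal Γ) {q q' : g} (hq : IsGradingElement Γ q) (h : LieSubalgebra ℂ g)
    [h.IsCartanSubalgebra] (hqh : q ∈ h) (hqh' : q' ∈ h) : q' ∈ Γ 0 := by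
  -- A Cartan subalgebra is nilpotent, so a power of `ad q` kills `q'`; acting by `j ^ k` on degree
  -- `j`, that power leaves only degree zero.
  obtain ⟨k, hk⟩ := LieModule.exists_forall_pow_toEnd_eq_zero ℂ h h
  have hcoe : ∀ (n : ℕ) (y : h), (((LieModule.toEnd ℂ h h ⟨q, hqh⟩ ^ n) y : h) : g) =
      (LieAlgebra.ad ℂ g q ^ n) y := by
    intro n
    induction n with
    | zero => intro y; rfl
    | succ n ih =>
      intro y
      rw [pow_succ, pow_succ, Module.End.mul_apply, Module.End.mul_apply, ih]
      rfl
  have h0 : (LieAlgebra.ad ℂ g q ^ k) q' = 0 := by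
    rw [← hcoe k ⟨q', hqh'⟩, hk]
    rfl
  have hpow : ∀ (j : ℤ) (n : ℕ) (x : g), x ∈ Γ j →
      (LieAlgebra.ad ℂ g q ^ n) x = (j : ℂ) ^ n • x := by
    intro j n
    induction n with
    | zero => intro x _; simp
    | succ n ih =>
      intro x hx
      rw [pow_succ, Module.End.mul_apply, LieAlgebra.ad_apply, (hq j x).1 hx, map_smul, ih x hx,
        smul_smul, pow_succ']
  refine mem_of_forall_gproj_mem hΓ fun j => ?_
  by_cases hj : j = 0
  · exact hj ▸ gproj_mem hΓ j q'
  · have hmap := gproj_map hΓ hΓ (LieAlgebra.ad ℂ g q ^ k) (i := 0) (fun i x hx => by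
      rw [hpow i k x hx, zero_add]
      exact Submodule.smul_mem _ _ hx) j q'
    rw [h0, map_zero, hpow j k _ (gproj_mem hΓ j q')] at hmap
    have : gproj hΓ j q' = 0 :=
      (smul_eq_zero.1 hmap.symm).resolve_left (pow_ne_zero _ (Int.cast_ne_zero.2 hj))
    rw [this]
    exact zero_mem _

variable [FiniteDimensional ℂ g] [FiniteDimensional ℂ V]

section Quotient

variable {B : LinearMap.BilinForm ℂ g} {Γ : ℤ → Submodule ℂ g} {f q : g} {m : LieSubalgebra ℂ g}
  {M : Subgroup G.carrier}

/-- A graded complement of `[f, m]` in `m^⊥` defines a slice representing `μ⁻¹(0) / M`. -/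
theorem exists_equiv_of_complement (hΓ : IsGoodGrading Γ f) (hq : IsGradingElement Γ q)
    (hB : B.Nondegenerate) (hBinv : B.lieInvariant g) (hm : IsGoodAlgebra Γ (B f) m)
    (hM : IsExponential M m) {C : Submodule ℂ g}
    (hC : IsHomogeneousSub hΓ.internal C) (hCle : C ≤ perp B m.toSubmodule)
    (hCsup : perp B m.toSubmodule ≤ C ⊔ m.toSubmodule.map (LieAlgebra.ad ℂ g f))
    (hCdisj : ∀ x ∈ m, ⁅f, x⁆ ∈ C → x = 0) {T : Set (Dual ℂ g)}
    (hT : ∀ ξ, ξ ∈ T ↔ ∃ s ∈ C, ξ = B (f + s)) :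
    ∃ Ψ : T ≃ Reduced G (B f) m M,
      IsIsomorphism (regSub (polyFun (Dual ℂ g)) T) (regReduced G (B f) m M) Ψ ∧
      ∀ η : T, ∃ hη : (η : Dual ℂ g) ∈ zeroFibre (B f) m, Ψ η = cls G (B f) m M ⟨η, hη⟩ := by
  obtain ⟨X, Y, S, -, hS, hmem, h1, h2⟩ := exists_dual_decomposition hΓ hq hB hBinv hm
    (a := m.toSubmodule) (b := ⊥) (by simp) disjoint_bot_right (hm.isHomogeneousSub hΓ.internal)
    (isHomogeneousSub_bot hΓ.internal) hC hCle hCsup hCdisj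
  refine exists_slice_equiv hS (fun ξ hξ => ⟨(hT _).2 (hmem ξ).2.2,
    hM.exp ⟨X ξ, (hmem ξ).1⟩, ?_⟩) fun η hη u => ?_
  · have h0 : Y ξ = 0 := (Submodule.mem_bot ℂ).1 (hmem ξ).2.1
    have := h1 ξ hξ
    rw [h0, coexp_zero, LinearMap.id_apply] at this
    rwa [hM.coAd_exp]
  · obtain ⟨s, hs, rfl⟩ := (hT η).1 hη
    obtain ⟨x, rfl⟩ := hM.exp.surjective u
    have := h2 x x.2 0 (zero_mem _) s hs
    rw [coexp_zero, LinearMap.id_apply] at this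
    rw [hM.coAd_exp]
    exact ⟨this.1, this.2.2⟩

/-- The quotient `μ⁻¹(0) / M` has a regular section. -/
theorem exists_section (hΓ : IsGoodGrading Γ f) (hq : IsGradingElement Γ q)
    (hB : B.Nondegenerate) (hBinv : B.lieInvariant g) (hm : IsGoodAlgebra Γ (B f) m)
    (hM : IsExponential M m) :
    ∃ σ : Reduced G (B f) m M → Dual ℂ g,
      IsMorphism (regReduced G (B f) m M) (polyFun (Dual ℂ g)) σ ∧
      ∀ p, ∃ h : σ p ∈ zeroFibre (B f) m, cls G (B f) m M ⟨σ p, h⟩ = p := by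
  -- An arbitrary graded complement suffices here, so no `sl₂`-triple has to be supplied.
  obtain ⟨C, hC, hCle, hCsup, hCdisj⟩ := exists_graded_complement hΓ hq hBinv hm
  obtain ⟨Ψ, hΨ, hΨ'⟩ := exists_equiv_of_complement hΓ hq hB hBinv hm hM hC hCle hCsup hCdisj
    (T := {ξ | ∃ s ∈ C, ξ = B (f + s)}) fun ξ => Iff.rfl
  refine ⟨fun p => Ψ.symm p, (isMorphism_id.restrict _).comp hΨ.2, fun p => ?_⟩
  obtain ⟨h, hp⟩ := hΨ' (Ψ.symm p)
  exact ⟨h, by rw [← hp, Equiv.apply_symm_apply]⟩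

/-- The Slodowy slice represents `μ⁻¹(0) / M`. -/
theorem IsGradedTriple.exists_equiv {e h : g} (ht : IsGradedTriple Γ e h f)
    (hΓ : IsGoodGrading Γ f) (hq : IsGradingElement Γ q) (hB : B.Nondegenerate)
    (hBinv : B.lieInvariant g) (hm : IsGoodAlgebra Γ (B f) m) (hM : IsExponential M m) :
    ∃ Ψ : slice (B f) e ≃ Reduced G (B f) m M,
      IsIsomorphism (regSub (polyFun (Dual ℂ g)) (slice (B f) e)) (regReduced G (B f) m M) Ψ ∧
      ∀ η : slice (B f) e, ∃ hη : (η : Dual ℂ g) ∈ zeroFibre (B f) m,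
        Ψ η = cls G (B f) m M ⟨η, hη⟩ :=
  exists_equiv_of_complement hΓ hq hB hBinv hm hM (ht.isHomogeneousSub_ker hΓ)
    (ht.ker_le_perp hΓ hm hBinv) (ht.perp_le_sup hΓ hm hB hBinv hq)
    (fun _ hx hx' => ht.disjoint hΓ (hm.le_filt_one hx) hx')
    fun _ => mem_slice_iff_exists hB hBinv

end Quotient

variable {χ₁ χ₂ : Dual ℂ g} {m₁ m₀ : LieSubalgebra ℂ g} {M₁ M₀ : Subgroup G.carrier}

/-- The second stage of the reduction: a polynomial decomposition of the points of
`χ₂ + (m₁ + m₀)^⊥` trivializes the action of `M₀` on the zero fibre of the moment map. -/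
theorem IsStageDatum.exists_equiv (hS : IsStageDatum χ₁ χ₂ m₁ m₀) (hM₁ : IsExponential M₁ m₁)
    (hM₀ : IsExponential M₀ m₀) {σ : Reduced G χ₁ m₁ M₁ → Dual ℂ g}
    (hσ : IsMorphism (regReduced G χ₁ m₁ M₁) (polyFun (Dual ℂ g)) σ)
    (hσ' : ∀ p, ∃ h : σ p ∈ zeroFibre χ₁ m₁, cls G χ₁ m₁ M₁ ⟨σ p, h⟩ = p)
    {T : Set (Dual ℂ g)} {Y : Dual ℂ g → g} {S : Dual ℂ g → Dual ℂ g}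
    (hY : IsMorphism (polyFun (Dual ℂ g)) (polyFun g) Y)
    (hS' : IsMorphism (polyFun (Dual ℂ g)) (polyFun (Dual ℂ g)) S)
    (hYmem : ∀ ξ, Y ξ ∈ m₀) (hST : ∀ ξ, S ξ ∈ T)
    (h1 : ∀ ξ ∈ zeroFibre χ₁ m₁, ξ ∈ zeroFibre χ₂ m₀ →
      ∃ x ∈ m₁, coexp x (coexp (Y ξ) (S ξ)) = ξ)
    (h2 : ∀ x ∈ m₁, ∀ y ∈ m₀, ∀ η ∈ T, coexp x (coexp y η) ∈ zeroFibre χ₁ m₁ ∧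
      coexp x (coexp y η) ∈ zeroFibre χ₂ m₀ ∧ Y (coexp x (coexp y η)) = y ∧
      S (coexp x (coexp y η)) = η) :
    letI := hS.action hM₁ hM₀
    ∃ Φ : M₀ × T ≃ ↥(hS.moment hM₁ ⁻¹' {0}),
      IsIsomorphism (regProd (G.regSubgroup M₀) (regSub (polyFun (Dual ℂ g)) T))
        (regSub (regReduced G χ₁ m₁ M₁) (hS.moment hM₁ ⁻¹' {0})) Φ ∧
      ∀ (u : M₀) (ξ : T), ∃ hξ : (ξ : Dual ℂ g) ∈ zeroFibre χ₁ m₁,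
        (Φ (u, ξ)).val = u • cls G χ₁ m₁ M₁ ⟨ξ, hξ⟩ := by
  let := hS.action hM₁ hM₀
  have hact : ∀ (u : M₀) (ξ : zeroFibre χ₁ m₁), u • cls G χ₁ m₁ M₁ ξ =
      cls G χ₁ m₁ M₁ ⟨G.coAd (u : G.carrier) ξ, hS.coAd_mem₀ hM₀ u ξ ξ.2⟩ := fun u ξ => rfl
  have hT : ∀ η ∈ T, η ∈ zeroFibre χ₁ m₁ := fun η hη => by
    have := (h2 0 (zero_mem _) 0 (zero_mem _) η hη).1
    rwa [coexp_zero] at this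
  have hcls : IsMorphism (regSub (polyFun (Dual ℂ g)) T) (regReduced G χ₁ m₁ M₁)
      (fun η => cls G χ₁ m₁ M₁ ⟨η, hT η η.2⟩) := fun F hF => by
    obtain ⟨F', hF'⟩ := exists_isLift hF
    exact ⟨F', hF'.mem, funext fun η => hF'.eq ⟨η, hT η η.2⟩⟩
  have hzero : ∀ (u : M₀) (η : T),
      u • cls G χ₁ m₁ M₁ ⟨η, hT η η.2⟩ ∈ hS.moment hM₁ ⁻¹' {0} := by
    intro u η
    obtain ⟨y, rfl⟩ := hM₀.exp.surjective u
    have := (h2 0 (zero_mem _) y y.2 η η.2).2.1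
    rw [coexp_zero, LinearMap.id_apply, ← hM₀.coAd_exp] at this
    exact this
  let inv : Reduced G χ₁ m₁ M₁ → M₀ × T := fun p =>
    (hM₀.exp ⟨Y (σ p), hYmem _⟩, ⟨S (σ p), hST _⟩)
  have hinv : ∀ (u : M₀) (η : T), inv (u • cls G χ₁ m₁ M₁ ⟨η, hT η η.2⟩) = (u, η) := by
    intro u η
    obtain ⟨p, hp⟩ : ∃ p, p = u • cls G χ₁ m₁ M₁ ⟨η, hT η η.2⟩ := ⟨_, rfl⟩
    rw [← hp]
    obtain ⟨hσp, hσp'⟩ := hσ' p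
    -- The representative `σ p` differs from `u · η` by an element `exp(x)` of `M₁`. The coordinates
    -- `Y` and `S` ignore `x`, so they return `y` and `η`.
    obtain ⟨v, hv⟩ := exists_coAd_of_cls_eq ((hact u ⟨η, hT η η.2⟩).symm.trans
      (hp.symm.trans hσp'.symm))
    obtain ⟨y, rfl⟩ := hM₀.exp.surjective u
    obtain ⟨x, rfl⟩ := hM₁.exp.surjective v
    have h := h2 x x.2 y y.2 η η.2
    simp only [hM₀.coAd_exp, hM₁.coAd_exp] at hv
    rw [hv] at h
    exact Prod.ext (congrArg hM₀.exp (Subtype.ext h.2.2.1)) (Subtype.ext h.2.2.2)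
  have hinv' : ∀ p ∈ hS.moment hM₁ ⁻¹' {0},
      (inv p).1 • cls G χ₁ m₁ M₁ ⟨(inv p).2, hT _ (inv p).2.2⟩ = p := by
    intro p hp
    obtain ⟨hσp, hσp'⟩ := hσ' p
    have hp0 : σ p ∈ zeroFibre χ₂ m₀ := by
      rw [← hσp'] at hp
      exact hp
    obtain ⟨x, hx, hxe⟩ := h1 _ hσp hp0
    refine Eq.trans ?_ hσp'
    rw [hact]
    refine Quotient.sound (s := G.orbitSetoid M₁ (zeroFibre χ₁ m₁)) ⟨hM₁.exp ⟨x, hx⟩, ?_⟩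
    simp only [inv, hM₁.coAd_exp, hM₀.coAd_exp]
    exact hxe
  let Φ : M₀ × T ≃ ↥(hS.moment hM₁ ⁻¹' {0}) :=
    { toFun := fun z => ⟨z.1 • cls G χ₁ m₁ M₁ ⟨z.2, hT _ z.2.2⟩, hzero z.1 z.2⟩
      invFun := fun p => inv p
      left_inv := fun z => hinv z.1 z.2
      right_inv := fun p => Subtype.ext (hinv' p p.2) }
  refine ⟨Φ, ⟨?_, ?_⟩, fun u ξ => ⟨hT ξ ξ.2, rfl⟩⟩
  · have halg := hS.isAlgebraicAction hM₁ hM₀ hσ hσ'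
    exact IsMorphism.codRestrict_set (halg.comp (isMorphism_fst.prodMk' (hcls.comp isMorphism_snd)))
      _ fun z => hzero z.1 z.2
  · have hexp : IsMorphism (regReduced G χ₁ m₁ M₁) (G.regSubgroup M₀)
        (fun p => hM₀.exp ⟨Y (σ p), hYmem _⟩) :=
      (isMorphism_expEquiv hM₀.unipotent hM₀.nilpotent).comp
        (isMorphism_lieSubalgebra_mk (hY.comp hσ) m₀ fun _ => hYmem _)
    exact (hexp.prodMk' ((hS'.comp hσ).codRestrict_set T fun _ => hST _)).restrict _

end StageSlices

end SlodowyStages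

end

/-! ### The theorem on reduction by stages. -/

open SlodowyStages Module in
theorem theorem2p2
    {g : Type*} [LieRing g] [LieAlgebra ℂ g] [FiniteDimensional ℂ g] [LieAlgebra.IsSimple ℂ g]
    -- a connected algebraic group with Lie algebra `g`
    {V : Type*} [AddCommGroup V] [Module ℂ V] [FiniteDimensional ℂ V]
    (G : ConnectedAlgebraicGroup g V)
    -- the invariant form identifying `g` with its dual
    (B : LinearMap.BilinForm ℂ g) (hB : B.Nondegenerate) (hBsymm : B.IsSymm)
    (hBinv : B.lieInvariant g)
    -- two nilpotent elements with good gradings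
    (f₁ f₂ : g) (hf₁ : IsNilpotent (LieAlgebra.ad ℂ g f₁)) (hf₂ : IsNilpotent (LieAlgebra.ad ℂ g f₂))
    (Γ₁ Γ₂ : ℤ → Submodule ℂ g) (hΓ₁ : IsGoodGrading Γ₁ f₁) (hΓ₂ : IsGoodGrading Γ₂ f₂)
    (q₁ q₂ : g) (hq₁ : IsGradingElement Γ₁ q₁) (hq₂ : IsGradingElement Γ₂ q₂)
    (h : LieSubalgebra ℂ g) [h.IsCartanSubalgebra] (hq₁h : q₁ ∈ h) (hq₂h : q₂ ∈ h)
    -- the good algebras, and a graded triple for `f₂`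
    (m₁ m₂ m₀ : LieSubalgebra ℂ g)
    (hm₁ : IsGoodAlgebra Γ₁ (B f₁) m₁) (hm₂ : IsGoodAlgebra Γ₂ (B f₂) m₂)
    (e₂ h₂ : g) (ht₂ : IsGradedTriple Γ₂ e₂ h₂ f₂)
    -- `m₂ = m₁ ⊕ m₀`, with `m₁` an ideal of `m₂` and `m₀` an `h`-stable subalgebra
    (hsum : m₁.toSubmodule ⊔ m₀.toSubmodule = m₂.toSubmodule)
    (hdisj : Disjoint m₁.toSubmodule m₀.toSubmodule)
    (hideal : ∀ x ∈ m₂, ∀ y ∈ m₁, ⁅x, y⁆ ∈ m₁)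
    (hstable : ∀ x ∈ h, ∀ y ∈ m₀, ⁅x, y⁆ ∈ m₀)
    -- `f₂ - f₁` and `m₀` lie in degree `0` of the first grading
    (hf₀ : f₂ - f₁ ∈ Γ₁ 0) (hm₀ : m₀.toSubmodule ≤ Γ₁ 0)
    -- `q₂ - q₁` commutes with `f₁`
    (hq₀ : ⁅q₂ - q₁, f₁⁆ = 0)
    -- the connected unipotent subgroups with Lie algebras `m₁` and `m₀`
    (M₁ M₀ : Subgroup G.carrier)
    (hM₁ : G.IsUnipotentSubgroup M₁ m₁) (hM₀ : G.IsUnipotentSubgroup M₀ m₀) :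
    -- the quotient is isomorphic to the slice of `f₁`
    (∀ e₁ h₁ : g, IsGradedTriple Γ₁ e₁ h₁ f₁ →
      ∃ Ψ : slice (B f₁) e₁ ≃ Reduced G (B f₁) m₁ M₁,
        IsIsomorphism (regSub (polyFun (Dual ℂ g)) (slice (B f₁) e₁))
          (regReduced G (B f₁) m₁ M₁) Ψ ∧
        ∀ ξ : slice (B f₁) e₁, ∃ hξ : (ξ : Dual ℂ g) ∈ zeroFibre (B f₁) m₁,
          Ψ ξ = cls G (B f₁) m₁ M₁ ⟨ξ, hξ⟩) ∧
    ∃ (_ : MulAction M₀ (Reduced G (B f₁) m₁ M₁))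
      (μ₀ : Reduced G (B f₁) m₁ M₁ → Dual ℂ m₀)
      (P : PoissonBracket (regReduced G (B f₁) m₁ M₁)),
      -- the action is the natural one, and is algebraic
      (∀ (u : M₀) (ξ : zeroFibre (B f₁) m₁),
        ∃ hξ : G.coAd (u : G.carrier) (ξ : Dual ℂ g) ∈ zeroFibre (B f₁) m₁,
          u • cls G (B f₁) m₁ M₁ ξ = cls G (B f₁) m₁ M₁ ⟨_, hξ⟩) ∧
      IsAlgebraicAction G (regReduced G (B f₁) m₁ M₁) M₀ ∧
      -- the moment map is `[ξ] ↦ (ξ - χ₂)|_{m₀}`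
      (∀ ξ : zeroFibre (B f₁) m₁,
        μ₀ (cls G (B f₁) m₁ M₁ ξ) = twistedRestriction (B f₂) m₀ (ξ : Dual ℂ g)) ∧
      -- for the reduced Poisson structure the action is Hamiltonian
      IsReducedBracket G (B f₁) m₁ M₁ P ∧
      IsHamiltonian G (regReduced G (B f₁) m₁ M₁) P M₀ m₀ μ₀ ∧
      -- the equivariant isomorphism `M₀ × S₂ ≅ μ₀⁻¹(0)`, `(u, ξ) ↦ u • [ξ]`
      ∃ Φ₀ : M₀ × slice (B f₂) e₂ ≃ ↥(μ₀ ⁻¹' {0}),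
        IsIsomorphism
          (regProd (G.regSubgroup M₀) (regSub (polyFun (Dual ℂ g)) (slice (B f₂) e₂)))
          (regSub (regReduced G (B f₁) m₁ M₁) (μ₀ ⁻¹' {0})) Φ₀ ∧
        (∀ (u v : M₀) (ξ : slice (B f₂) e₂),
          (Φ₀ (u * v, ξ) : Reduced G (B f₁) m₁ M₁) = u • (Φ₀ (v, ξ)).val) ∧
        ∀ (u : M₀) (ξ : slice (B f₂) e₂), ∃ hξ : (ξ : Dual ℂ g) ∈ zeroFibre (B f₁) m₁,
          (Φ₀ (u, ξ)).val = u • cls G (B f₁) m₁ M₁ ⟨ξ, hξ⟩ := by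
  have hm₁₂ : ∀ x ∈ m₁, x ∈ m₂ := fun x hx =>
    (hsum ▸ Submodule.mem_sup_left hx : x ∈ m₂.toSubmodule)
  have hm₀₂ : ∀ x ∈ m₀, x ∈ m₂ := fun x hx =>
    (hsum ▸ Submodule.mem_sup_right hx : x ∈ m₂.toSubmodule)
  have hE₁ : IsExponential M₁ m₁ := ⟨hM₁, fun x hx =>
    ConnectedAlgebraicGroup.isNilpotent_lieMap_of_mem_filt hq₁ (hm₁.le_filt_one hx)⟩
  have hE₀ : IsExponential M₀ m₀ := ⟨hM₀, fun x hx =>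
    ConnectedAlgebraicGroup.isNilpotent_lieMap_of_mem_filt hq₂ (hm₂.le_filt_one (hm₀₂ x hx))⟩
  -- `f₂ - f₁` has degree `0` and `m₁` positive degree for the first grading, so they are
  -- orthogonal.
  have hχ : ∀ x ∈ m₁, B f₁ x = B f₂ x := fun x hx => by
    have := form_eq_zero_of_mem_filt hBinv hq₁ (by omega) hf₀ (hm₁.le_filt_one hx)
    rw [map_sub, LinearMap.sub_apply, sub_eq_zero] at this
    exact this.symm
  have hχ₂ : ∀ x ∈ m₂, ∀ y ∈ m₂, B f₂ ⁅x, y⁆ = 0 := fun x hx y hy =>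
    hm₂.form_lie_eq_zero hBinv hq₂ hΓ₂ hx hy
  have hD : IsStageDatum (B f₁) (B f₂) m₁ m₀ :=
    { lie_mem := fun x hx y hy => hideal x (hm₀₂ x hx) y hy
      character := fun x hx y hy => hm₁.form_lie_eq_zero hBinv hq₁ hΓ₁ hx hy
      invariant := fun x hx y hy => by
        rw [hχ _ (hideal x (hm₀₂ x hx) y hy)]
        exact hχ₂ x (hm₀₂ x hx) y (hm₁₂ y hy)
      character' := fun x hx y hy => hχ₂ x (hm₀₂ x hx) y (hm₀₂ y hy) }
  -- As `m₀` has first degree `0`, the positive part of `m₂` is exactly `m₁`. This makes `m₁` graded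
  -- for the second grading, since `ad q₂` preserves the first.
  have hm₁eq : m₁.toSubmodule = m₂.toSubmodule ⊓ filt Γ₁ 1 := by
    refine le_antisymm (fun x hx => ⟨hm₁₂ x hx, hm₁.le_filt_one hx⟩) ?_
    rintro z ⟨hz, hz1⟩
    rw [← hsum] at hz
    obtain ⟨x, hx, y, hy, rfl⟩ := Submodule.mem_sup.1 hz
    have hy1 : y ∈ filt Γ₁ 1 := by
      simpa using sub_mem hz1 (hm₁.le_filt_one hx)
    have hy0 : y = 0 := by
      rw [← gproj_same hΓ₁.internal (hm₀ hy)]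
      exact gproj_eq_zero_of_mem_filt hΓ₁.internal (by omega) hy1
    rw [hy0, add_zero]
    exact hx
  have hadq : ∀ j : ℤ, ∀ x ∈ Γ₂ j, LieAlgebra.ad ℂ g q₂ x = (j : ℂ) • x := fun j x hx =>
    (hq₂ j x).1 hx
  have hq₂0 : q₂ ∈ Γ₁ 0 := hq₁.mem_zero_of_cartan hΓ₁.internal h hq₁h hq₂h
  have hhom₁ : IsHomogeneousSub hΓ₂.internal m₁.toSubmodule := by
    rw [hm₁eq]
    refine (hm₂.isHomogeneousSub hΓ₂.internal).inf hΓ₂.internal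
      (isHomogeneousSub_of_stable hΓ₂.internal (LieAlgebra.ad ℂ g q₂) hadq fun x hx => ?_)
    have := map_mem_filt (T := LieAlgebra.ad ℂ g q₂) (i := 0)
      (fun j y hy => hΓ₁.lie_mem 0 j q₂ hq₂0 y hy) hx
    rwa [zero_add] at this
  have hhom₀ : IsHomogeneousSub hΓ₂.internal m₀.toSubmodule :=
    isHomogeneousSub_of_stable hΓ₂.internal (LieAlgebra.ad ℂ g q₂) hadq fun x hx =>
      hstable q₂ hq₂h x hx
  -- The one-step constraint for `m₂` is the conjunction of the two stages, because both characters
  -- agree on `m₁`.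
  have hfib : ∀ ξ, ξ ∈ zeroFibre (B f₂) m₂ ↔
      ξ ∈ zeroFibre (B f₁) m₁ ∧ ξ ∈ zeroFibre (B f₂) m₀ := by
    intro ξ
    simp only [mem_zeroFibre]
    refine ⟨fun hξ => ⟨fun x hx => (hξ x (hm₁₂ x hx)).trans (hχ x hx).symm,
      fun x hx => hξ x (hm₀₂ x hx)⟩, fun ⟨hξ1, hξ0⟩ z hz => ?_⟩
    rw [← LieSubalgebra.mem_toSubmodule, ← hsum] at hz
    obtain ⟨x, hx, y, hy, rfl⟩ := Submodule.mem_sup.1 hz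
    rw [map_add, map_add, hξ1 x hx, hξ0 y hy, hχ x hx]
  obtain ⟨σ, hσ, hσ'⟩ := exists_section (G := G) hΓ₁ hq₁ hB hBinv hm₁ hE₁
  obtain ⟨P, hP⟩ := exists_reducedBracket (hD.coAd_mem₁ hE₁) (hD.lie_dualGradient_eq_zero hE₁)
  obtain ⟨X, Y, S, hY, hS, hmem, h1, h2⟩ := exists_dual_decomposition hΓ₂ hq₂ hB hBinv hm₂ hsum
    hdisj hhom₁ hhom₀ (ht₂.isHomogeneousSub_ker hΓ₂) (ht₂.ker_le_perp hΓ₂ hm₂ hBinv)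
    (ht₂.perp_le_sup hΓ₂ hm₂ hB hBinv hq₂)
    (fun _ hx hx' => ht₂.disjoint hΓ₂ (hm₂.le_filt_one hx) hx')
  obtain ⟨Φ, hΦ, hΦ'⟩ := hD.exists_equiv hE₁ hE₀ hσ hσ' (T := slice (B f₂) e₂) hY hS
    (fun ξ => (hmem ξ).2.1) (fun ξ => (mem_slice_iff_exists hB hBinv).2 (hmem ξ).2.2)
    (fun ξ hξ hξ' => ⟨X ξ, (hmem ξ).1, h1 ξ ((hfib ξ).2 ⟨hξ, hξ'⟩)⟩)
    (fun x hx y hy η hη => by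
      obtain ⟨s, hs, rfl⟩ := (mem_slice_iff_exists hB hBinv).1 hη
      obtain ⟨h0, h0'⟩ := h2 x hx y hy s hs
      exact ⟨((hfib _).1 h0).1, ((hfib _).1 h0).2, h0'⟩)
  refine ⟨fun e₁ h₁ ht₁ => ht₁.exists_equiv hΓ₁ hq₁ hB hBinv hm₁ hE₁, hD.action hE₁ hE₀,
    hD.moment hE₁, P, fun u ξ => ⟨hD.coAd_mem₀ hE₀ u ξ ξ.2, rfl⟩,
    hD.isAlgebraicAction hE₁ hE₀ hσ hσ', hD.moment_cls hE₁, hP, hD.isHamiltonian hE₁ hE₀ hP,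
    Φ, hΦ, fun u v ξ => ?_, hΦ'⟩
  let := hD.action hE₁ hE₀
  obtain ⟨_, huv⟩ := hΦ' (u * v) ξ
  obtain ⟨_, hv⟩ := hΦ' v ξ
  rw [huv, hv, mul_smul]
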